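/- All manifolds, maps, vector fields and metrics are smooth; manifolds are finite-dimensional, Hausdorff and without boundary. Let $\pi\colon M\to B$ be a submersion, $\mathcal V=\ker d\pi$, let $b$ be a Riemannian metric on $B$, and let $\mathcal H$ be a horizontal connection, i.e. a distribution on $M$ complementary to $\mathcal V$; the superscripts $v$ and $h$ denote the components in $\mathcal V$ and $\mathcal H$. A Riemannian metric $g$ on $M$ is *adapted to* $(\mathcal H,b)$ if $g(\mathcal V,\mathcal H)=0$ and $d\pi|_{\mathcal H}\colon\mathcal H\to TB$ is a fiberwise isometry. Let $$A_XY=\tfrac12[\bar X,\bar Y]^v\qquad (X,Y\in\mathcal H_p),$$ where $\bar X,\bar Y$ are horizontal extensions of $X,Y$. For an adapted metric $g=\langle\cdot,\cdot\rangle$ with Levi-Civita connection $\nabla$, define for $X,Y\in\mathcal H_p$ and $\xi\in\mathcal V_p$ the vectors $A^*_X\xi\in\mathcal H_p$ and $S_X\xi\in\mathcal V_p$ by $$\langle A^*_X\xi,Y\rangle=\langle A_XY,\xi\rangle,\qquad S_X\xi=-(\nabla_\xi\bar X)^v,$$ and let $$(\nabla_XA^*)_X\xi=\nabla_X\big(A^*_{\bar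 X}\bar\xi\big)-A^*_{(\nabla_X\bar X)^h}\xi-A^*_X(\nabla_X\bar\xi)^v$$ for a horizontal extension $\bar X$ of $X$ and a vertical extension $\bar\xi$ of $\xi$. The adapted metric $g$ is *weakly non-negatively curved* (WNN) if every point of $M$ has a neighborhood $U$ for which there is $\tau>0$ with $$\tau\,\|X\|\,\|A^*_X\xi\|^2\ \ge\ \big\langle(\nabla_XA^*)_X\xi+A^*_XS_X\xi,\ A^*_X\xi\big\rangle\qquad\text{for all }X\in\mathcal H|_U,\ \xi\in\mathcal V|_U .$$ The connection $\mathcal H$ is *fat* if every non-zero $X\in\mathcal H$ extends to a local horizontal field $\bar X$ with $\mathcal V=[\bar X,\mathcal H]^v$. We say that $\pi$ (with its connection $\mathcal H$) has *compact structure group* if there are a compact Lie group $G$ acting smoothly on a manifold $F$ and local trivializations of $\pi$ with fiber $F$ over an open cover of $B$, with smooth $G$-valued transition functions, in which the parallel transport of $\mathcal H$ is given by elements of $G$: for every curve $\gamma$ in a trivializing open set there is a smooth curve $h$ in $G$ such that $t\mapsto(\gamma(t),h(t)\cdot f)$ is horizontal for every $f\in F$. **Theorem.** Let $g$ be a metric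 adapted to $(\mathcal H,b)$. Then: 1. $g$ is weakly non-negatively curved if and only if every metric adapted to $(\mathcal H,b)$ is weakly non-negatively curved (so being WNN depends only on the pair $(\mathcal H,b)$). 2. If $g$ has non-negative sectional curvature and the fibers of $\pi$ are totally geodesic, then $g$ is weakly non-negatively curved. 3. If $M$ is compact, $g$ is weakly non-negatively curved, $\pi$ has compact structure group, and $g$ has positive sectional curvature, then $\mathcal H$ is fat. -/

import Mathlib

open scoped Manifold ContDiff Topology

noncomputable section

namespace SubmersionCurvature

universe u v w x

section Riemannian

variable {E : Type u} [NormedAddCommGroup E] [NormedSpace ℝ E]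
  {M : Type v} [TopologicalSpace M] [ChartedSpace E M]

/-- Vector fields on `M`, without any regularity. -/
abbrev VField (E : Type u) [NormedAddCommGroup E] [NormedSpace ℝ E]
    (M : Type v) [TopologicalSpace M] [ChartedSpace E M] : Type (max u v) :=
  (p : M) → TangentSpace 𝓘(ℝ, E) p

/-- The vector field `X` is differentiable at `p`. -/
def DiffFieldAt [IsManifold 𝓘(ℝ, E) ∞ M] (X : VField E M) (p : M) : Prop :=
  MDifferentiableAt 𝓘(ℝ, E) 𝓘(ℝ, E).tangent
    (fun q => (⟨q, X q⟩ : TangentBundle 𝓘(ℝ, E) M)) p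

/-- The vector field `X` is smooth on the set `U`. -/
def SmoothFieldOn [IsManifold 𝓘(ℝ, E) ∞ M] (X : VField E M) (U : Set M) : Prop :=
  ContMDiffOn 𝓘(ℝ, E) 𝓘(ℝ, E).tangent ∞
    (fun q => (⟨q, X q⟩ : TangentBundle 𝓘(ℝ, E) M)) U

/-- The vector field `X` is smooth on the whole manifold. -/
def SmoothField [IsManifold 𝓘(ℝ, E) ∞ M] (X : VField E M) : Prop :=
  ContMDiff 𝓘(ℝ, E) 𝓘(ℝ, E).tangent ∞
    (fun q => (⟨q, X q⟩ : TangentBundle 𝓘(ℝ, E) M))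

/-- Smooth Riemannian metrics on `M`. -/
abbrev Metric (E : Type u) [NormedAddCommGroup E] [NormedSpace ℝ E]
    (M : Type v) [TopologicalSpace M] [ChartedSpace E M] [IsManifold 𝓘(ℝ, E) ∞ M] :
    Type (max u v) :=
  Bundle.ContMDiffRiemannianMetric 𝓘(ℝ, E) ∞ E (fun p : M => TangentSpace 𝓘(ℝ, E) p)

variable [IsManifold 𝓘(ℝ, E) ∞ M]

/-- The length of the tangent vector `a` at `p`. -/
def Metric.length (g : Metric E M) (p : M) (a : TangentSpace 𝓘(ℝ, E) p) : ℝ :=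
  Real.sqrt (g.inner p a a)

/-- The function `q ↦ g(X(q), Y(q))`. -/
def Metric.pairing (g : Metric E M) (X Y : VField E M) (q : M) : ℝ := g.inner q (X q) (Y q)

/-- The right-hand side of the Koszul formula for `2 g(∇_X Y, Z)` at the point `p`. -/
def Metric.koszul (g : Metric E M) (X Y Z : VField E M) (p : M) : ℝ :=
  mvfderiv 𝓘(ℝ, E) (g.pairing Y Z) p (X p)
    + mvfderiv 𝓘(ℝ, E) (g.pairing X Z) p (Y p)
    - mvfderiv 𝓘(ℝ, E) (g.pairing X Y) p (Z p)
    + g.inner p (VectorField.mlieBracket 𝓘(ℝ, E) X Y p) (Z p)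
    - g.inner p (VectorField.mlieBracket 𝓘(ℝ, E) X Z p) (Y p)
    - g.inner p (VectorField.mlieBracket 𝓘(ℝ, E) Y Z p) (X p)

theorem Metric.mdifferentiableAt_pairing (g : Metric E M) {X Y : VField E M} {p : M}
    (hX : DiffFieldAt X p) (hY : DiffFieldAt Y p) :
    MDifferentiableAt 𝓘(ℝ, E) 𝓘(ℝ, ℝ) (g.pairing X Y) p := by
  have h : MDifferentiableAt 𝓘(ℝ, E) (𝓘(ℝ, E).prod 𝓘(ℝ, ℝ))
      (fun m => Bundle.TotalSpace.mk' ℝ (E := Bundle.Trivial M ℝ) m (g.inner m (X m) (Y m))) p := by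
    apply MDifferentiableAt.clm_bundle_apply₂ (F₁ := E) (F₂ := E)
    · exact g.contMDiff.mdifferentiableAt (by simp)
    · exact hX
    · exact hY
  simp only [mdifferentiableAt_totalSpace] at h
  exact h.2

theorem Metric.tensorialAt_koszul [FiniteDimensional ℝ E] (g : Metric E M) {X Y : VField E M}
    {p : M} (hX : DiffFieldAt X p) (hY : DiffFieldAt Y p) :
    TensorialAt 𝓘(ℝ, E) E (fun Z : VField E M => g.koszul X Y Z p) p where
  smul {f Z} hf hZ := by
    have : CompleteSpace E := FiniteDimensional.complete ℝ E
    have e1 : g.pairing Y (f • Z) = f * g.pairing Y Z := by ext; simp [Metric.pairing]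
    have e2 : g.pairing X (f • Z) = f * g.pairing X Z := by ext; simp [Metric.pairing]
    simp only [Metric.koszul, e1, e2]
    rw [mvfderiv_mul hf (g.mdifferentiableAt_pairing hY hZ),
      mvfderiv_mul hf (g.mdifferentiableAt_pairing hX hZ),
      VectorField.mlieBracket_smul_right hf hZ, VectorField.mlieBracket_smul_right hf hZ]
    simp [Metric.pairing, g.symm p (Z p)]
    ring
  add {Z W} hZ hW := by
    have : CompleteSpace E := FiniteDimensional.complete ℝ E
    have e1 : g.pairing Y (Z + W) = g.pairing Y Z + g.pairing Y W := by
      ext; simp [Metric.pairing]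
    have e2 : g.pairing X (Z + W) = g.pairing X Z + g.pairing X W := by
      ext; simp [Metric.pairing]
    simp only [Metric.koszul, e1, e2]
    rw [mvfderiv_add (g.mdifferentiableAt_pairing hY hZ) (g.mdifferentiableAt_pairing hY hW),
      mvfderiv_add (g.mdifferentiableAt_pairing hX hZ) (g.mdifferentiableAt_pairing hX hW),
      VectorField.mlieBracket_add_right hZ hW, VectorField.mlieBracket_add_right hZ hW]
    simp
    ring

/-- The Koszul formula determines a unique vector. -/
theorem Metric.existsUnique_nabla [FiniteDimensional ℝ E] (g : Metric E M) {X Y : VField E M}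
    {p : M} (hX : DiffFieldAt X p) (hY : DiffFieldAt Y p) :
    ∃! a : TangentSpace 𝓘(ℝ, E) p,
      ∀ Z : VField E M, DiffFieldAt Z p → 2 * g.inner p a (Z p) = g.koszul X Y Z p := by
  have : FiniteDimensional ℝ (TangentSpace 𝓘(ℝ, E) p) := inferInstanceAs (FiniteDimensional ℝ E)
  have hinj : Function.Injective
      (ContinuousLinearMap.coeLM ℝ ∘ₗ (g.inner p).toLinearMap :
        TangentSpace 𝓘(ℝ, E) p →ₗ[ℝ] Module.Dual ℝ (TangentSpace 𝓘(ℝ, E) p)) := by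
    rw [injective_iff_map_eq_zero]
    intro a ha
    by_contra h
    have h1 := g.pos p a h
    have h2 := LinearMap.congr_fun ha a
    simp at h2
    linarith
  have hsurj := (LinearMap.injective_iff_surjective_of_finrank_eq_finrank
    (Subspace.dual_finrank_eq (K := ℝ) (V := TangentSpace 𝓘(ℝ, E) p)).symm).1 hinj
  let φ := TensorialAt.mkHom _ p (g.tensorialAt_koszul hX hY)
  obtain ⟨a, ha⟩ := hsurj ((1 / 2 : ℝ) • φ.toLinearMap)
  have key : ∀ Z : VField E M, DiffFieldAt Z p → 2 * g.inner p a (Z p) = g.koszul X Y Z p := by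
    intro Z hZ
    have h1 := LinearMap.congr_fun ha (Z p)
    have h2 : φ (Z p) = g.koszul X Y Z p := TensorialAt.mkHom_apply (g.tensorialAt_koszul hX hY) hZ
    simp at h1
    rw [h1, ← h2]
    ring
  refine ⟨a, key, fun c hc => hinj ?_⟩
  ext z
  have hz := FiberBundle.mdifferentiableAt_extend 𝓘(ℝ, E) E (V := fun r : M => TangentSpace 𝓘(ℝ, E) r) z
  have h1 := key _ hz
  have h2 := hc _ hz
  simp at h1 h2 ⊢
  linarith

/-- The Levi-Civita derivative `∇_X Y` at `p`: the vector characterized by the Koszul formula. It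
is uniquely determined when `X` and `Y` are differentiable at `p`, by `existsUnique_nabla`. -/
def Metric.nabla (g : Metric E M) (X Y : VField E M) : VField E M := fun p =>
  Classical.epsilon fun a : TangentSpace 𝓘(ℝ, E) p =>
    ∀ Z : VField E M, DiffFieldAt Z p → 2 * g.inner p a (Z p) = g.koszul X Y Z p

/-- The curvature `R(X, Y) Z = ∇_X ∇_Y Z - ∇_Y ∇_X Z - ∇_{[X, Y]} Z`. -/
def Metric.curvature (g : Metric E M) (X Y Z : VField E M) : VField E M := fun p =>
  g.nabla X (g.nabla Y Z) p - g.nabla Y (g.nabla X Z) p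
    - g.nabla (VectorField.mlieBracket 𝓘(ℝ, E) X Y) Z p

/-- The sectional curvature at `p` of the plane spanned by `X(p)` and `Y(p)` (which have to be
linearly independent). -/
def Metric.sectional (g : Metric E M) (X Y : VField E M) (p : M) : ℝ :=
  g.inner p (g.curvature X Y Y p) (X p) /
    (g.inner p (X p) (X p) * g.inner p (Y p) (Y p) - g.inner p (X p) (Y p) ^ 2)

/-- All sectional curvatures are non-negative. -/
def Metric.NonnegSectional (g : Metric E M) : Prop :=
  ∀ X Y : VField E M, SmoothField X → SmoothField Y → ∀ p : M,
    LinearIndependent ℝ ![X p, Y p] → 0 ≤ g.sectional X Y p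

/-- All sectional curvatures are positive. -/
def Metric.PosSectional (g : Metric E M) : Prop :=
  ∀ X Y : VField E M, SmoothField X → SmoothField Y → ∀ p : M,
    LinearIndependent ℝ ![X p, Y p] → 0 < g.sectional X Y p

end Riemannian

section Submersion

variable {E : Type u} [NormedAddCommGroup E] [NormedSpace ℝ E]
  {M : Type v} [TopologicalSpace M] [ChartedSpace E M] [IsManifold 𝓘(ℝ, E) ∞ M]
  {E' : Type w} [NormedAddCommGroup E'] [NormedSpace ℝ E']
  {B : Type x} [TopologicalSpace B] [ChartedSpace E' B]

/-- The vertical space `𝒱_p = ker dπ_p`. -/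
def vert (E : Type u) [NormedAddCommGroup E] [NormedSpace ℝ E]
    {M : Type v} [TopologicalSpace M] [ChartedSpace E M]
    (E' : Type w) [NormedAddCommGroup E'] [NormedSpace ℝ E']
    {B : Type x} [TopologicalSpace B] [ChartedSpace E' B]
    (π : M → B) (p : M) : Submodule ℝ (TangentSpace 𝓘(ℝ, E) p) :=
  LinearMap.ker (mfderiv 𝓘(ℝ, E) 𝓘(ℝ, E') π p).toLinearMap

/-- A horizontal connection for `π`: a smooth distribution complementary to `ker dπ`. Smoothness
means that every vector of the distribution extends to a local smooth section of it. -/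
structure HorizontalConnection (E : Type u) [NormedAddCommGroup E] [NormedSpace ℝ E]
    {M : Type v} [TopologicalSpace M] [ChartedSpace E M] [IsManifold 𝓘(ℝ, E) ∞ M]
    (E' : Type w) [NormedAddCommGroup E'] [NormedSpace ℝ E']
    {B : Type x} [TopologicalSpace B] [ChartedSpace E' B] (π : M → B) where
  /-- The horizontal space `ℋ_p`. -/
  hor : (p : M) → Submodule ℝ (TangentSpace 𝓘(ℝ, E) p)
  isCompl : ∀ p : M, IsCompl (hor p) (vert E E' π p)
  smooth : ∀ (p : M), ∀ a ∈ hor p, ∃ U : Set M, IsOpen U ∧ p ∈ U ∧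
    ∃ X : VField E M, SmoothFieldOn X U ∧ (∀ q ∈ U, X q ∈ hor q) ∧ X p = a

namespace HorizontalConnection

variable {π : M → B} (ℋ : HorizontalConnection E E' π)

/-- The horizontal component of a tangent vector. -/
def horProj (p : M) : TangentSpace 𝓘(ℝ, E) p →ₗ[ℝ] TangentSpace 𝓘(ℝ, E) p :=
  (ℋ.hor p).projection _ (ℋ.isCompl p)

/-- The vertical component of a tangent vector. -/
def verProj (p : M) : TangentSpace 𝓘(ℝ, E) p →ₗ[ℝ] TangentSpace 𝓘(ℝ, E) p :=
  (vert E E' π p).projection _ (ℋ.isCompl p).symm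

/-- The vector field `X` is horizontal. -/
def IsHorizontal (X : VField E M) : Prop := ∀ p, X p ∈ ℋ.hor p

/-- `ℋ` is fat: every non-zero horizontal vector extends to a local smooth horizontal field `X`
with `𝒱 = [X, ℋ]^v`. -/
def IsFat : Prop :=
  ∀ p : M, ∀ a ∈ ℋ.hor p, a ≠ 0 →
    ∃ U : Set M, IsOpen U ∧ p ∈ U ∧
      ∃ X : VField E M, SmoothFieldOn X U ∧ (∀ q ∈ U, X q ∈ ℋ.hor q) ∧ X p = a ∧
        ∀ q ∈ U, ∀ c ∈ vert E E' π q,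
          ∃ Y : VField E M, SmoothFieldOn Y U ∧ (∀ r ∈ U, Y r ∈ ℋ.hor r) ∧
            ℋ.verProj q (VectorField.mlieBracket 𝓘(ℝ, E) X Y q) = c

/-- A horizontal extension of the horizontal component of `a`, smooth near `p`. -/
def extend (p : M) (a : TangentSpace 𝓘(ℝ, E) p) : VField E M := fun q =>
  ℋ.horProj q (FiberBundle.extend E (E := fun r : M => TangentSpace 𝓘(ℝ, E) r) a q)

/-- The tensor `A_a c = (1/2) [X, Y]^v`, for horizontal extensions `X`, `Y` of the horizontal
vectors `a`, `c` at `p`. -/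
def tensorA (p : M) (a c : TangentSpace 𝓘(ℝ, E) p) : TangentSpace 𝓘(ℝ, E) p :=
  (1 / 2 : ℝ) • ℋ.verProj p
    (VectorField.mlieBracket 𝓘(ℝ, E) (ℋ.extend p a) (ℋ.extend p c) p)

/-- The dual `A^*_a ξ` of `A`, for horizontal `a` and vertical `ξ` at `p`: the horizontal vector
with `g(A^*_a ξ, c) = g(A_a c, ξ)` for all horizontal `c`. -/
def dualA (g : Metric E M) (p : M) (a ξ : TangentSpace 𝓘(ℝ, E) p) : TangentSpace 𝓘(ℝ, E) p :=
  Classical.epsilon fun z : TangentSpace 𝓘(ℝ, E) p =>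
    z ∈ ℋ.hor p ∧ ∀ c ∈ ℋ.hor p, g.inner p z c = g.inner p (ℋ.tensorA p a c) ξ

/-- The second fundamental form of the fibers, `S_X ξ = -(∇_ξ X)^v`, for a horizontal field `X`
and a vertical field `ξ`. -/
def shape (g : Metric E M) (X ξ : VField E M) : VField E M := fun p =>
  -ℋ.verProj p (g.nabla ξ X p)

/-- The covariant derivative `(∇_X A^*)_X ξ` of the tensor `A^* : ℋ × 𝒱 → ℋ`, for a horizontal
field `X` and a vertical field `ξ`. -/
def covDualA (g : Metric E M) (X ξ : VField E M) : VField E M := fun p =>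
  g.nabla X (fun q => ℋ.dualA g q (X q) (ξ q)) p
    - ℋ.dualA g p (ℋ.horProj p (g.nabla X X p)) (ξ p)
    - ℋ.dualA g p (X p) (ℋ.verProj p (g.nabla X ξ p))

/-- `g` is weakly non-negatively curved: near every point there is `τ > 0` with
`τ ‖X‖ ‖A^*_X ξ‖² ≥ ⟨(∇_X A^*)_X ξ + A^*_X S_X ξ, A^*_X ξ⟩` for all horizontal `X` and
vertical `ξ`. -/
def IsWNN (g : Metric E M) : Prop :=
  ∀ p : M, ∃ U ∈ 𝓝 p, ∃ τ : ℝ, 0 < τ ∧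
    ∀ X ξ : VField E M, SmoothField X → SmoothField ξ →
      ℋ.IsHorizontal X → (∀ q, ξ q ∈ vert E E' π q) → ∀ q ∈ U,
        g.inner q (ℋ.covDualA g X ξ q + ℋ.dualA g q (X q) (ℋ.shape g X ξ q))
            (ℋ.dualA g q (X q) (ξ q))
          ≤ τ * g.length q (X q) * g.length q (ℋ.dualA g q (X q) (ξ q)) ^ 2

/-- `g` is adapted to `(ℋ, b)`: `g(𝒱, ℋ) = 0` and `dπ` restricts to an isometry on `ℋ`. -/
def IsAdapted [IsManifold 𝓘(ℝ, E') ∞ B] (b : Metric E' B) (g : Metric E M) : Prop :=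
  (∀ p : M, ∀ ξ ∈ vert E E' π p, ∀ a ∈ ℋ.hor p, g.inner p ξ a = 0) ∧
  ∀ p : M, ∀ a ∈ ℋ.hor p, ∀ c ∈ ℋ.hor p,
    b.inner (π p) (mfderiv 𝓘(ℝ, E) 𝓘(ℝ, E') π p a) (mfderiv 𝓘(ℝ, E) 𝓘(ℝ, E') π p c)
      = g.inner p a c

end HorizontalConnection

/-- The fibers of `π` are totally geodesic: `∇_ξ η` is tangent to the fibers for all vector fields
`ξ`, `η` tangent to the fibers. -/
def TotallyGeodesicFibers (E' : Type w) [NormedAddCommGroup E'] [NormedSpace ℝ E']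
    {B : Type x} [TopologicalSpace B] [ChartedSpace E' B] (π : M → B) (g : Metric E M) : Prop :=
  ∀ ξ η : VField E M, SmoothField ξ → SmoothField η →
    (∀ q, ξ q ∈ vert E E' π q) → (∀ q, η q ∈ vert E E' π q) →
      ∀ p, g.nabla ξ η p ∈ vert E E' π p

/-- The structure of a smooth fiber bundle with fiber `F` and structure group `G` on `π`, for which
`ℋ` is a `G`-connection: local trivializations `triv i u f` over the open sets `U i`
(whose inverse is `y ↦ (π y, coord i y)`) with smooth `G`-valued transition functions, in which the
parallel transport of `ℋ` along any smooth curve of the base is given by elements of `G`. -/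
structure GBundleStructure {π : M → B} (ℋ : HorizontalConnection E E' π)
    {d k : ℕ} (G : Type) [TopologicalSpace G] [ChartedSpace (EuclideanSpace ℝ (Fin d)) G] [Group G]
    (F : Type v) [TopologicalSpace F] [ChartedSpace (EuclideanSpace ℝ (Fin k)) F]
    [MulAction G F] where
  /-- The trivializing open sets are indexed by the points of the base. -/
  U : B → Set B
  isOpen_U : ∀ i, IsOpen (U i)
  mem_U : ∀ i, i ∈ U i
  triv : B → B → F → M
  coord : B → M → F
  proj_triv : ∀ i, ∀ u ∈ U i, ∀ f, π (triv i u f) = u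
  coord_triv : ∀ i, ∀ u ∈ U i, ∀ f, coord i (triv i u f) = f
  triv_coord : ∀ i y, π y ∈ U i → triv i (π y) (coord i y) = y
  smooth_triv : ∀ i, ContMDiffOn (𝓘(ℝ, E').prod (𝓡 k)) 𝓘(ℝ, E) ∞
    (fun z : B × F => triv i z.1 z.2) (U i ×ˢ Set.univ)
  smooth_coord : ∀ i, ContMDiffOn 𝓘(ℝ, E) (𝓡 k) ∞ (coord i) (π ⁻¹' U i)
  /-- The transition functions. -/
  trans : B → B → B → G
  smooth_trans : ∀ i j, ContMDiffOn 𝓘(ℝ, E') (𝓡 d) ∞ (trans i j) (U i ∩ U j)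
  triv_eq : ∀ i j, ∀ u ∈ U i ∩ U j, ∀ f, triv i u f = triv j u (trans i j u • f)
  /-- For a smooth curve `γ` in `U i`, there is a smooth curve `h` in `G` such that the curves
  `t ↦ triv i (γ t) (h t • f)` are horizontal lifts of `γ`. -/
  transport : ∀ (i : B) (γ : ℝ → B) (α β : ℝ), ContMDiff 𝓘(ℝ, ℝ) 𝓘(ℝ, E') ∞ γ →
    (∀ t ∈ Set.Ioo α β, γ t ∈ U i) →
    ∃ h : ℝ → G, ContMDiffOn 𝓘(ℝ, ℝ) (𝓡 d) ∞ h (Set.Ioo α β) ∧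
      ∀ f, ∀ t ∈ Set.Ioo α β,
        mfderiv 𝓘(ℝ, ℝ) 𝓘(ℝ, E) (fun s => triv i (γ s) (h s • f)) t (1 : ℝ)
          ∈ ℋ.hor (triv i (γ t) (h t • f))

/-- `(π, ℋ)` has compact structure group: it is a bundle with connection whose structure group is a
compact Lie group acting smoothly on the fiber. -/
def HasCompactStructureGroup {π : M → B} (ℋ : HorizontalConnection E E' π) : Prop :=
  ∃ (d k : ℕ) (G : Type) (_ : TopologicalSpace G)
    (_ : ChartedSpace (EuclideanSpace ℝ (Fin d)) G) (_ : Group G)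
    (F : Type v) (_ : TopologicalSpace F) (_ : ChartedSpace (EuclideanSpace ℝ (Fin k)) F)
    (_ : MulAction G F),
    LieGroup (𝓡 d) ∞ G ∧ CompactSpace G ∧ IsManifold (𝓡 k) ∞ F ∧
      ContMDiffSMul (𝓡 d) (𝓡 k) ∞ G F ∧ Nonempty (GBundleStructure ℋ (d := d) (k := k) G F)

end Submersion

end SubmersionCurvature

end

/-!
# Weakly non-negatively curved submersion metrics

All computations are carried out with global smooth fields, which exist in abundance by cutting off
with bump functions, and with local orthonormal frames of horizontal and of vertical fields.

*Dependence on the pair `(ℋ, b)` only.* For a horizontal field `X`, a vertical field `ξ` and a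
horizontal field `Y`, the pairing of the vector `(∇_X A^*)_X ξ + A^*_X S_X ξ` with `Y` is the
pairing with `ξ` of a vertical vector built from brackets, from the projections of `ℋ`, and from
horizontal parts of covariant derivatives of horizontal fields (`inner_covDualA_add`). By the Koszul
formula these horizontal parts are the same for all adapted metrics (`horProj_nabla_congr`). So
passing from `g` to `g'` amounts to replacing `ξ` by the vertical vector with the same `g`-dual
covector on the fibre, and the inequality for one metric is the inequality for the other.

*Totally geodesic fibres and non-negative curvature.* Here `S = 0`, and the curvature of the plane
spanned by `X` and `ξ + sY` is the quadratic polynomial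
`|A^*_X ξ|² + 2s ⟨(∇_X A^*)_X ξ, Y⟩ + s² R(X, Y, Y, X)` in `s` (`inner_curvature_quadratic`). It is
non-negative, so its discriminant is not positive. With `Y = A^*_X ξ`, and with a local bound for
`R(X, Y, Y, X)` by a multiple of `|X|² |Y|²`, this is the inequality
(`isWNN_of_nonnegSectional`).

*Positive curvature implies fatness.* If `ℋ` is not fat, then `A^*_X ξ = 0` for some non-zero
horizontal `X` and some non-zero vertical `ξ`. An embedding of `M` in a Euclidean space restricts to
an embedding `κ` of the model fibre, and by compactness there is a longest vertical vector `ξ` among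
those with `A^*_X ξ = 0` for some `X ≠ 0` and dual to the differential of `c ∘ κ ∘ h` for some `h`
in the structure group and some linear form `c` of norm at most `1`
(`GBundleStructure.exists_forall_admissible_le`). Along the horizontal geodesic with initial
velocity `X`, parallel transport lies in the structure group, so transporting the function
`c ∘ κ ∘ h` on the fibre and taking its vertical gradient extends `ξ` to a field with
`(∇_X ξ)^v = S_X ξ` which has the same form `c` and other group elements
(`GBundleStructure.exists_parallel_field`). For such a field the inequality bounds the derivative of
`|A^*_X ξ|²` by a multiple of `|A^*_X ξ|²`, on both sides of the initial point after reversing the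
geodesic, so `A^*_X ξ` remains zero (`dualA_eq_zero_along`). Then the curvature of the plane spanned
by `X` and `ξ` is `½ (|ξ|²)'' - 3 |S_X ξ|²`, so in positive curvature `|ξ|²` is strictly convex and
cannot have a maximum (`not_isLocalMax_pairing`), contrary to the choice of `ξ`.
-/

noncomputable section

set_option linter.unusedSectionVars false

namespace SubmersionCurvature

/-! ### Calculus of smooth vector fields -/

section Calculus

open VectorField

variable {E : Type*} [NormedAddCommGroup E] [NormedSpace ℝ E]
  {M : Type*} [TopologicalSpace M] [ChartedSpace E M]
  {F : Type*} [NormedAddCommGroup F] [NormedSpace ℝ F]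

/-- The derivative `X f` of a vector-valued function `f` along a vector field `X`. -/
def dirD (X : VField E M) (f : M → F) : M → F := fun p => mvfderiv 𝓘(ℝ, E) f p (X p)

variable {X Y Z : VField E M} {f h : M → ℝ} {p : M}

theorem dirD_congr {f h : M → F} (hf : f =ᶠ[𝓝 p] h) : dirD X f p = dirD X h p := by
  simp only [dirD, mvfderiv]
  rw [hf.mfderiv_eq]
  rfl

theorem dirD_congr_left {X' : VField E M} (f : M → F) (h : X p = X' p) :
    dirD X f p = dirD X' f p := by
  simp only [dirD, h]

theorem dirD_add {f h : M → F} (hf : MDifferentiableAt 𝓘(ℝ, E) 𝓘(ℝ, F) f p)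
    (hh : MDifferentiableAt 𝓘(ℝ, E) 𝓘(ℝ, F) h p) :
    dirD X (fun q => f q + h q) p = dirD X f p + dirD X h p := by
  have := mvfderiv_add hf hh
  simp only [dirD]
  rw [show (fun q => f q + h q) = f + h from rfl, this]
  rfl

theorem dirD_mul (hf : MDifferentiableAt 𝓘(ℝ, E) 𝓘(ℝ, ℝ) f p)
    (hh : MDifferentiableAt 𝓘(ℝ, E) 𝓘(ℝ, ℝ) h p) :
    dirD X (fun q => f q * h q) p = f p * dirD X h p + h p * dirD X f p := by
  have := mvfderiv_mul hf hh
  simp only [dirD]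
  rw [show (fun q => f q * h q) = f * h from rfl, this]
  simp

theorem dirD_const (c : F) : dirD X (fun _ => c) p = 0 := by
  simp [dirD, mvfderiv_const]

theorem dirD_clm_comp {F' : Type*} [NormedAddCommGroup F'] [NormedSpace ℝ F'] (L : F →L[ℝ] F')
    {f : M → F} (hf : MDifferentiableAt 𝓘(ℝ, E) 𝓘(ℝ, F) f p) :
    dirD X (fun q => L (f q)) p = L (dirD X f p) := by
  have := mfderiv_comp (I := 𝓘(ℝ, E)) (I' := 𝓘(ℝ, F)) (I'' := 𝓘(ℝ, F')) (g := L) p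
    (L.differentiableAt.mdifferentiableAt) hf
  simp only [dirD, mvfderiv]
  rw [show (fun q => L (f q)) = L ∘ f from rfl, this, mfderiv_eq_fderiv, L.fderiv]
  rfl

/-- The chain rule for a function factoring through a map to a normed space. -/
theorem dirD_comp {F' : Type*} [NormedAddCommGroup F'] [NormedSpace ℝ F'] {ψ : M → F}
    {k : F → F'} (hk : DifferentiableAt ℝ k (ψ p))
    (hψ : MDifferentiableAt 𝓘(ℝ, E) 𝓘(ℝ, F) ψ p) :
    dirD X (fun q => k (ψ q)) p = fderiv ℝ k (ψ p) (dirD X ψ p) := by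
  have := mfderiv_comp (I := 𝓘(ℝ, E)) (I' := 𝓘(ℝ, F)) (I'' := 𝓘(ℝ, F')) (g := k) p
    (hk.mdifferentiableAt) hψ
  simp only [dirD, mvfderiv]
  rw [show (fun q => k (ψ q)) = k ∘ ψ from rfl, this, mfderiv_eq_fderiv]
  rfl

variable [IsManifold 𝓘(ℝ, E) ∞ M]

theorem SmoothField.diffFieldAt (hX : SmoothField X) (p : M) : DiffFieldAt X p :=
  (hX p).mdifferentiableAt (by simp)

theorem SmoothField.add (hX : SmoothField X) (hY : SmoothField Y) : SmoothField (X + Y) :=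
  ContMDiff.add_section hX hY

theorem SmoothField.sub (hX : SmoothField X) (hY : SmoothField Y) : SmoothField (X - Y) :=
  ContMDiff.sub_section hX hY

theorem SmoothField.neg (hX : SmoothField X) : SmoothField (-X) :=
  ContMDiff.neg_section hX

theorem SmoothField.smul (hf : ContMDiff 𝓘(ℝ, E) 𝓘(ℝ, ℝ) ∞ f) (hX : SmoothField X) :
    SmoothField (f • X) :=
  ContMDiff.smul_section hf hX

theorem SmoothField.const_smul (a : ℝ) (hX : SmoothField X) : SmoothField (a • X) :=
  ContMDiff.const_smul_section hX

theorem smoothField_zero : SmoothField (0 : VField E M) :=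
  Bundle.contMDiff_zeroSection ℝ (fun p : M => TangentSpace 𝓘(ℝ, E) p)

theorem SmoothField.sum {ι : Type*} (s : Finset ι) {X : ι → VField E M}
    (hX : ∀ i ∈ s, SmoothField (X i)) : SmoothField (fun p => ∑ i ∈ s, X i p) :=
  ContMDiff.sum_section hX

theorem two_le_infty : (2 : WithTop ℕ∞) ≤ ∞ :=
  (WithTop.coe_le_coe.2 le_top : ((2 : ℕ∞) : WithTop ℕ∞) ≤ ((⊤ : ℕ∞) : WithTop ℕ∞))

theorem isManifold_minSmoothness (k : ℕ) : IsManifold 𝓘(ℝ, E) (minSmoothness ℝ k) M := by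
  simp only [minSmoothness_of_isRCLikeNormedField]
  exact IsManifold.of_le (n := ∞) (by exact_mod_cast le_top)

theorem SmoothField.mlieBracket [CompleteSpace E] (hX : SmoothField X) (hY : SmoothField Y) :
    SmoothField (mlieBracket 𝓘(ℝ, E) X Y) := fun p =>
  haveI : IsManifold 𝓘(ℝ, E) (((⊤ : ℕ∞) : WithTop ℕ∞) + 1) M := by simpa
  haveI : IsManifold 𝓘(ℝ, E) (minSmoothness ℝ 2) M := isManifold_minSmoothness 2
  ContMDiffAt.mlieBracket_vectorField (n := ⊤) (m := ⊤) (hX p) (hY p) (by simp)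

theorem contMDiffOn_dirD {f : M → F} {U : Set M} (hU : IsOpen U)
    (hf : ContMDiffOn 𝓘(ℝ, E) 𝓘(ℝ, F) ∞ f U) (hX : SmoothFieldOn X U) :
    ContMDiffOn 𝓘(ℝ, E) 𝓘(ℝ, F) ∞ (dirD X f) U := by
  have h1 := hf.contMDiffOn_tangentMapWithin (m := ∞) (by simp) hU.uniqueMDiffOn
  have h2 := h1.comp hX (fun q hq => hq)
  intro p hp
  have h3 := h2 p hp
  rw [Bundle.contMDiffWithinAt_totalSpace] at h3
  refine h3.2.congr_of_mem (fun q hq => ?_) hp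
  simp [dirD, mvfderiv, tangentMapWithin, mfderivWithin_of_isOpen hU hq]
  rfl

theorem contMDiff_dirD {f : M → F} (hf : ContMDiff 𝓘(ℝ, E) 𝓘(ℝ, F) ∞ f) (hX : SmoothField X) :
    ContMDiff 𝓘(ℝ, E) 𝓘(ℝ, F) ∞ (dirD X f) := by
  rw [← contMDiffOn_univ] at hf ⊢
  exact contMDiffOn_dirD isOpen_univ hf (contMDiffOn_univ.2 hX)

/-- The derivation defined by `[X, Y]` is the commutator of the derivations `X` and `Y`. -/
theorem dirD_mlieBracket [CompleteSpace E] {U : Set M} (hU : IsOpen U) (hp : p ∈ U) {f : M → F}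
    (hf : ContMDiffOn 𝓘(ℝ, E) 𝓘(ℝ, F) ∞ f U) (hX : SmoothField X) (hY : SmoothField Y) :
    dirD (mlieBracket 𝓘(ℝ, E) X Y) f p = dirD X (dirD Y f) p - dirD Y (dirD X f) p := by
  set ψ := extChartAt 𝓘(ℝ, E) p with hψ
  set fh : E → F := fun y => f (ψ.symm y) with hfh
  have hsm : IsManifold 𝓘(ℝ, E) 1 M := IsManifold.of_le (n := ∞) (by simp)
  -- the coordinate expression of a vector field
  let co : VField E M → E → E := fun Z =>
    mpullbackWithin 𝓘(ℝ, E) 𝓘(ℝ, E) ψ.symm Z (Set.range 𝓘(ℝ, E))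
  have hfs : ∀ᶠ q in 𝓝 p, ContMDiffAt 𝓘(ℝ, E) 𝓘(ℝ, F) ∞ f q ∧ q ∈ ψ.source := by
    filter_upwards [hU.mem_nhds hp, extChartAt_source_mem_nhds (I := 𝓘(ℝ, E)) p] with q hq hq'
    exact ⟨hf.contMDiffAt (hU.mem_nhds hq), hq'⟩
  have hfhs : ∀ q, ContMDiffAt 𝓘(ℝ, E) 𝓘(ℝ, F) ∞ f q → q ∈ ψ.source → ContDiffAt ℝ ∞ fh (ψ q) := by
    intro q hq hqs
    rw [← contMDiffAt_iff_contDiffAt]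
    have h2 : ContMDiffAt 𝓘(ℝ, E) 𝓘(ℝ, E) ∞ ψ.symm (ψ q) :=
      ((contMDiffOn_extChartAt_symm p).contMDiffAt
        ((isOpen_extChartAt_target p).mem_nhds (ψ.map_source hqs)))
    refine ContMDiffAt.comp (ψ q) (g := f) ?_ h2
    rw [ψ.left_inv hqs]
    exact hq
  have hcoψ : ∀ (Z : VField E M), ∀ q ∈ ψ.source, dirD Z ψ q = co Z (ψ q) := by
    intro Z q hqs
    have hy := ψ.map_source hqs
    have h3 : (mfderivWithin 𝓘(ℝ, E) 𝓘(ℝ, E) ψ.symm (Set.range 𝓘(ℝ, E)) (ψ q)).inverse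
        = mfderiv 𝓘(ℝ, E) 𝓘(ℝ, E) ψ (ψ.symm (ψ q)) :=
      ContinuousLinearMap.inverse_eq
        (mfderivWithin_extChartAt_symm_comp_mfderiv_extChartAt hy)
        (mfderiv_extChartAt_comp_mfderivWithin_extChartAt_symm hy)
    simp only [co, mpullbackWithin_apply]
    rw [h3]
    have h4 : ∀ r, r = q → (mfderiv 𝓘(ℝ, E) 𝓘(ℝ, E) ψ r (Z r) : E)
        = mfderiv 𝓘(ℝ, E) 𝓘(ℝ, E) ψ q (Z q) := by
      rintro _ rfl; rfl
    exact (h4 _ (ψ.left_inv hqs)).symm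
  have key : ∀ (Z : VField E M), ∀ q, ContMDiffAt 𝓘(ℝ, E) 𝓘(ℝ, F) ∞ f q → q ∈ ψ.source →
      dirD Z f q = fderiv ℝ fh (ψ q) (co Z (ψ q)) := by
    intro Z q hq hqs
    have hqs' : q ∈ (chartAt E p).source := by simpa [hψ] using hqs
    have h1 : dirD Z f q = dirD Z (fun r => fh (ψ r)) q := by
      apply dirD_congr
      filter_upwards [(isOpen_extChartAt_source (I := 𝓘(ℝ, E)) p).mem_nhds hqs] with r hr
      simp [hfh, ψ.left_inv hr]
    rw [h1, dirD_comp ((hfhs q hq hqs).differentiableAt (by simp)) (mdifferentiableAt_extChartAt hqs')]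
    congr 1
    exact hcoψ Z q hqs
  have key2 : ∀ (Z : VField E M), dirD Z f =ᶠ[𝓝 p] fun q => fderiv ℝ fh (ψ q) (co Z (ψ q)) := by
    intro Z
    filter_upwards [hfs] with q hq
    exact key Z q hq.1 hq.2
  have hps := mem_extChartAt_source (I := 𝓘(ℝ, E)) p
  have hfp := hfs.self_of_nhds
  have hco : ∀ Z : VField E M, SmoothField Z → ContDiffAt ℝ ∞ (co Z) (ψ p) := by
    intro Z hZ
    have h1 := contMDiffWithinAt_mpullbackWithin_extChartAt_symm (m := ∞) (n := ∞) (s := Set.univ)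
      (hZ p).contMDiffWithinAt uniqueMDiffOn_univ (Set.mem_univ p) (by simp)
    have h2 := contMDiffWithinAt_vectorSpace_iff_contDiffWithinAt.1 h1
    refine h2.contDiffAt ?_
    simpa [hψ] using (isOpen_extChartAt_target (I := 𝓘(ℝ, E)) p).mem_nhds (ψ.map_source hps)
  have key3 : ∀ Z Z' : VField E M, SmoothField Z → SmoothField Z' → dirD Z (dirD Z' f) p
      = fderiv ℝ (fun y => fderiv ℝ fh y (co Z' y)) (ψ p) (co Z (ψ p)) := by
    intro Z Z' hZ hZ'
    have hd : ContDiffAt ℝ ∞ (fun y => fderiv ℝ fh y (co Z' y)) (ψ p) :=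
      ((hfhs p hfp.1 hps).fderiv_right (by simp)).clm_apply (hco Z' hZ')
    rw [dirD_congr (key2 Z'), dirD_comp (k := fun y => fderiv ℝ fh y (co Z' y))
      (hd.differentiableAt (by simp)) (mdifferentiableAt_extChartAt (mem_chart_source E p))]
    rw [hcoψ Z p hps]
  rw [key3 X Y hX hY, key3 Y X hY hX, key _ p hfp.1 hps, ← fderiv_apply_lieBracket (n := ∞)
    (hfhs p hfp.1 hps) (by simpa using two_le_infty) ((hco _ hY).differentiableAt (by simp))
    ((hco _ hX).differentiableAt (by simp))]
  congr 1
  rw [← hcoψ _ p hps]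
  have h5 := isInvertible_mfderiv_extChartAt (I := 𝓘(ℝ, E)) hps
  simp only [dirD, mvfderiv, mlieBracket, mlieBracketWithin_apply]
  simp only [co, Set.preimage_univ, Set.univ_inter, modelWithCornersSelf_coe, Set.range_id]
  have h6 : lieBracketWithin ℝ (mpullbackWithin 𝓘(ℝ, E) 𝓘(ℝ, E) ψ.symm X Set.univ)
      (mpullbackWithin 𝓘(ℝ, E) 𝓘(ℝ, E) ψ.symm Y Set.univ) Set.univ (ψ p)
      = lieBracket ℝ (mpullbackWithin 𝓘(ℝ, E) 𝓘(ℝ, E) ψ.symm X Set.univ)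
      (mpullbackWithin 𝓘(ℝ, E) 𝓘(ℝ, E) ψ.symm Y Set.univ) (ψ p) :=
    congrFun lieBracketWithin_univ _
  rw [← h6]
  exact h5.self_apply_inverse _

end Calculus

/-! ### Cut-offs and extensions -/

section Extension

variable {E : Type*} [NormedAddCommGroup E] [NormedSpace ℝ E] [FiniteDimensional ℝ E]
  {M : Type*} [TopologicalSpace M] [T2Space M] [ChartedSpace E M] [IsManifold 𝓘(ℝ, E) ∞ M]
  {p : M}

theorem exists_cutoff {U : Set M} (hU : U ∈ 𝓝 p) :
    ∃ φ : M → ℝ, ContMDiff 𝓘(ℝ, E) 𝓘(ℝ, ℝ) ∞ φ ∧ tsupport φ ⊆ U ∧ φ =ᶠ[𝓝 p] 1 := by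
  obtain ⟨f, -, hf⟩ := (SmoothBumpFunction.nhds_basis_tsupport (I := 𝓘(ℝ, E)) p).mem_iff.1 hU
  exact ⟨f, f.contMDiff, hf, f.eventuallyEq_one⟩

/-- A vector field which is smooth near `p` agrees near `p` with a multiple of it that is smooth on
all of `M`. -/
theorem exists_smoothField_smul {U : Set M} (hU : IsOpen U) (hp : p ∈ U) {X : VField E M}
    (hX : SmoothFieldOn X U) :
    ∃ φ : M → ℝ, φ =ᶠ[𝓝 p] 1 ∧ (∀ q ∉ U, φ q = 0) ∧ SmoothField (φ • X) := by
  obtain ⟨φ, h1, h2, h3⟩ := exists_cutoff (E := E) (hU.mem_nhds hp)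
  exact ⟨φ, h3, fun q hq => image_eq_zero_of_notMem_tsupport fun h => hq (h2 h),
    ContMDiffOn.smul_section_of_tsupport h1.contMDiffOn hU h2 hX⟩

theorem exists_smoothField_apply_eq (a : TangentSpace 𝓘(ℝ, E) p) :
    ∃ X : VField E M, SmoothField X ∧ X p = a := by
  obtain ⟨s, hs, h⟩ := FiberBundle.exists_contMDiffOn_extend (k := ∞) 𝓘(ℝ, E) E
    (V := fun r : M => TangentSpace 𝓘(ℝ, E) r) a
  obtain ⟨U, hUs, hU, hp⟩ := mem_nhds_iff.1 hs
  obtain ⟨φ, h1, -, h2⟩ := exists_smoothField_smul hU hp (h.mono hUs)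
  exact ⟨_, h2, by simp [h1.self_of_nhds]⟩

/-- A function which is smooth near `p` agrees near `p` with a function smooth on all of `M`. -/
theorem exists_contMDiff_eventuallyEq {F : Type*} [NormedAddCommGroup F] [NormedSpace ℝ F]
    {U : Set M} (hU : IsOpen U) (hp : p ∈ U) {f : M → F}
    (hf : ContMDiffOn 𝓘(ℝ, E) 𝓘(ℝ, F) ∞ f U) :
    ∃ f' : M → F, ContMDiff 𝓘(ℝ, E) 𝓘(ℝ, F) ∞ f' ∧ f' =ᶠ[𝓝 p] f := by
  obtain ⟨φ, h1, h2, h3⟩ := exists_cutoff (E := E) (hU.mem_nhds hp)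
  refine ⟨fun q => φ q • f q, ?_, ?_⟩
  · refine contMDiff_of_tsupport fun q hq => ?_
    have hqU : q ∈ U := h2 (tsupport_smul_subset_left φ f hq)
    exact (h1 q).smul (hf.contMDiffAt (hU.mem_nhds hqU))
  · filter_upwards [h3] with q hq
    simp [hq]

end Extension

/-! ### The Levi-Civita connection -/

section LeviCivita

open VectorField

variable {E : Type*} [NormedAddCommGroup E] [NormedSpace ℝ E]
  {M : Type*} [TopologicalSpace M] [ChartedSpace E M] [IsManifold 𝓘(ℝ, E) ∞ M]
  (g : Metric E M) {X X' Y Y' Z : VField E M} {f : M → ℝ} {p : M}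

theorem Metric.inner_self_nonneg (a : TangentSpace 𝓘(ℝ, E) p) : 0 ≤ g.inner p a a := by
  by_cases h : a = 0
  · simp [h]
  · exact (g.pos p a h).le

variable {g} in
theorem Metric.inner_self_eq_zero {a : TangentSpace 𝓘(ℝ, E) p} :
    g.inner p a a = 0 ↔ a = 0 := by
  refine ⟨fun h => ?_, fun h => by simp [h]⟩
  by_contra h'
  exact (g.pos p a h').ne' h

theorem Metric.ext_inner {a c : TangentSpace 𝓘(ℝ, E) p}
    (h : ∀ v, g.inner p a v = g.inner p c v) : a = c := by
  rw [← sub_eq_zero, ← g.inner_self_eq_zero]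
  have := h (a - c)
  simp only [map_sub, sub_apply] at this ⊢
  linarith

theorem Metric.pairing_comm : g.pairing X Y = g.pairing Y X := by
  ext q; exact g.symm q _ _

theorem Metric.contMDiffOn_pairing {U : Set M} (hX : SmoothFieldOn X U) (hY : SmoothFieldOn Y U) :
    ContMDiffOn 𝓘(ℝ, E) 𝓘(ℝ, ℝ) ∞ (g.pairing X Y) U := by
  intro p hp
  have h : ContMDiffWithinAt 𝓘(ℝ, E) (𝓘(ℝ, E).prod 𝓘(ℝ, ℝ)) ∞
      (fun m => Bundle.TotalSpace.mk' ℝ (E := Bundle.Trivial M ℝ) m (g.inner m (X m) (Y m))) U p := by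
    apply ContMDiffWithinAt.clm_bundle_apply₂ (F₁ := E) (F₂ := E)
    · exact g.contMDiff.contMDiffAt.contMDiffWithinAt
    · exact hX p hp
    · exact hY p hp
  rw [Bundle.contMDiffWithinAt_totalSpace] at h
  exact h.2

theorem Metric.contMDiff_pairing (hX : SmoothField X) (hY : SmoothField Y) :
    ContMDiff 𝓘(ℝ, E) 𝓘(ℝ, ℝ) ∞ (g.pairing X Y) := by
  rw [← contMDiffOn_univ]
  exact g.contMDiffOn_pairing (contMDiffOn_univ.2 hX) (contMDiffOn_univ.2 hY)

theorem Metric.mdifferentiable_pairing (hX : SmoothField X) (hY : SmoothField Y) (p : M) :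
    MDifferentiableAt 𝓘(ℝ, E) 𝓘(ℝ, ℝ) (g.pairing X Y) p :=
  (g.contMDiff_pairing hX hY).mdifferentiableAt (by simp)

theorem Metric.koszul_eq : g.koszul X Y Z p =
    dirD X (g.pairing Y Z) p + dirD Y (g.pairing X Z) p - dirD Z (g.pairing X Y) p
    + g.inner p (mlieBracket 𝓘(ℝ, E) X Y p) (Z p) - g.inner p (mlieBracket 𝓘(ℝ, E) X Z p) (Y p)
    - g.inner p (mlieBracket 𝓘(ℝ, E) Y Z p) (X p) := rfl

variable [FiniteDimensional ℝ E]

theorem Metric.nabla_spec_of_diffFieldAt (hX : DiffFieldAt X p) (hY : DiffFieldAt Y p)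
    (hZ : DiffFieldAt Z p) :
    2 * g.inner p (g.nabla X Y p) (Z p) = g.koszul X Y Z p :=
  Classical.epsilon_spec (g.existsUnique_nabla hX hY).exists Z hZ

theorem Metric.nabla_spec (hX : SmoothField X) (hY : SmoothField Y) (hZ : SmoothField Z) (p : M) :
    2 * g.inner p (g.nabla X Y p) (Z p) = g.koszul X Y Z p :=
  g.nabla_spec_of_diffFieldAt (hX.diffFieldAt p) (hY.diffFieldAt p) (hZ.diffFieldAt p)

/-- The Levi-Civita connection is compatible with the metric. -/
theorem Metric.dirD_pairing (hX : SmoothField X) (hY : SmoothField Y) (hZ : SmoothField Z)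
    (p : M) : dirD X (g.pairing Y Z) p
      = g.inner p (g.nabla X Y p) (Z p) + g.inner p (Y p) (g.nabla X Z p) := by
  have h1 := g.nabla_spec hX hY hZ p
  have h2 := g.nabla_spec hX hZ hY p
  rw [g.koszul_eq] at h1 h2
  rw [g.symm p (Y p), g.pairing_comm (X := Z) (Y := Y)] at *
  rw [mlieBracket_swap_apply (V := Z) (W := Y)] at h2
  simp only [map_neg, neg_apply] at h2
  linarith

theorem Metric.tensorialAt_koszul_left (hY : DiffFieldAt Y p) (hZ : DiffFieldAt Z p) :
    TensorialAt 𝓘(ℝ, E) E (fun X : VField E M => g.koszul X Y Z p) p where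
  smul {f X} hf hX := by
    have : CompleteSpace E := FiniteDimensional.complete ℝ E
    have e1 : g.pairing (f • X) Z = f * g.pairing X Z := by ext; simp [Metric.pairing]
    have e2 : g.pairing (f • X) Y = f * g.pairing X Y := by ext; simp [Metric.pairing]
    simp only [Metric.koszul, e1, e2]
    rw [mvfderiv_mul hf (g.mdifferentiableAt_pairing hX hZ),
      mvfderiv_mul hf (g.mdifferentiableAt_pairing hX hY),
      VectorField.mlieBracket_smul_left hf hX, VectorField.mlieBracket_smul_left hf hX]
    simp [Metric.pairing]
    ring
  add {X W} hX hW := by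
    have : CompleteSpace E := FiniteDimensional.complete ℝ E
    have e1 : g.pairing (X + W) Z = g.pairing X Z + g.pairing W Z := by
      ext; simp [Metric.pairing]
    have e2 : g.pairing (X + W) Y = g.pairing X Y + g.pairing W Y := by
      ext; simp [Metric.pairing]
    simp only [Metric.koszul, e1, e2]
    rw [mvfderiv_add (g.mdifferentiableAt_pairing hX hZ) (g.mdifferentiableAt_pairing hW hZ),
      mvfderiv_add (g.mdifferentiableAt_pairing hX hY) (g.mdifferentiableAt_pairing hW hY),
      VectorField.mlieBracket_add_left hX hW, VectorField.mlieBracket_add_left hX hW]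
    simp
    ring

theorem Metric.eq_sum_of_orthonormal {q : M} {n : ℕ} {e : Fin n → TangentSpace 𝓘(ℝ, E) q}
    (he : ∀ i j, g.inner q (e i) (e j) = if i = j then 1 else 0)
    {S : Submodule ℝ (TangentSpace 𝓘(ℝ, E) q)} (heS : ∀ i, e i ∈ S)
    (hS : Module.finrank ℝ S = n) {v : TangentSpace 𝓘(ℝ, E) q} (hv : v ∈ S) :
    v = ∑ i, g.inner q v (e i) • e i := by
  have : FiniteDimensional ℝ (TangentSpace 𝓘(ℝ, E) q) := inferInstanceAs (FiniteDimensional ℝ E)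
  have hli : LinearIndependent ℝ (fun i => (⟨e i, heS i⟩ : S)) := by
    rw [Fintype.linearIndependent_iff]
    intro c hc i
    have h1 : ∑ j, c j • e j = 0 := by
      have := congrArg (fun s : S => (s : TangentSpace 𝓘(ℝ, E) q)) hc
      simpa using this
    have h2 := congrArg (fun w => g.inner q w (e i)) h1
    simpa [he] using h2
  have hsp := hli.span_eq_top_of_card_eq_finrank' (by simp [hS])
  have hmem : (⟨v, hv⟩ : S) ∈ Submodule.span ℝ (Set.range fun i => (⟨e i, heS i⟩ : S)) := by
    rw [hsp]; trivial
  obtain ⟨c, hc⟩ := (Submodule.mem_span_range_iff_exists_fun ℝ).1 hmem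
  have h1 : ∑ j, c j • e j = v := by
    have := congrArg (fun s : S => (s : TangentSpace 𝓘(ℝ, E) q)) hc
    simpa using this
  have h2 : ∀ i, g.inner q v (e i) = c i := fun i => by rw [← h1]; simp [he]
  simp [h2, h1]

variable [T2Space M]

theorem Metric.ext_smoothField {a c : TangentSpace 𝓘(ℝ, E) p}
    (h : ∀ Z : VField E M, SmoothField Z → g.inner p a (Z p) = g.inner p c (Z p)) : a = c :=
  g.ext_inner fun v => by
    obtain ⟨Z, hZ, rfl⟩ := exists_smoothField_apply_eq v
    exact h Z hZ

/-- The Levi-Civita connection is torsion-free. -/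
theorem Metric.nabla_sub_nabla (hX : SmoothField X) (hY : SmoothField Y) (p : M) :
    g.nabla X Y p - g.nabla Y X p = mlieBracket 𝓘(ℝ, E) X Y p := by
  refine g.ext_smoothField fun Z hZ => ?_
  have h1 := g.nabla_spec hX hY hZ p
  have h2 := g.nabla_spec hY hX hZ p
  rw [g.koszul_eq] at h1 h2
  rw [g.pairing_comm (X := Y) (Y := X), mlieBracket_swap_apply (V := Y) (W := X)] at h2
  simp only [map_neg, map_sub, sub_apply, neg_apply] at h2 ⊢
  linarith

theorem Metric.nabla_congr_left (hX : SmoothField X) (hX' : SmoothField X') (hY : SmoothField Y)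
    (h : X p = X' p) : g.nabla X Y p = g.nabla X' Y p := by
  refine g.ext_smoothField fun Z hZ => ?_
  have h1 := g.nabla_spec hX hY hZ p
  have h2 := g.nabla_spec hX' hY hZ p
  have h3 := (g.tensorialAt_koszul_left (hY.diffFieldAt p) (hZ.diffFieldAt p)).pointwise
    (hX.diffFieldAt p) (hX'.diffFieldAt p) h
  linarith

theorem Metric.nabla_add_left (hX : SmoothField X) (hX' : SmoothField X') (hY : SmoothField Y)
    (p : M) : g.nabla (X + X') Y p = g.nabla X Y p + g.nabla X' Y p := by
  refine g.ext_smoothField fun Z hZ => ?_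
  have h1 := g.nabla_spec hX hY hZ p
  have h2 := g.nabla_spec hX' hY hZ p
  have h4 := g.nabla_spec (hX.add hX') hY hZ p
  have h3 := (g.tensorialAt_koszul_left (hY.diffFieldAt p) (hZ.diffFieldAt p)).add
    (hX.diffFieldAt p) (hX'.diffFieldAt p)
  simp only [map_add, add_apply] at h3 ⊢
  linarith

theorem Metric.nabla_smul_left (hf : ContMDiff 𝓘(ℝ, E) 𝓘(ℝ, ℝ) ∞ f) (hX : SmoothField X)
    (hY : SmoothField Y) (p : M) : g.nabla (f • X) Y p = f p • g.nabla X Y p := by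
  refine g.ext_smoothField fun Z hZ => ?_
  have h1 := g.nabla_spec hX hY hZ p
  have h4 := g.nabla_spec (hX.smul hf) hY hZ p
  have h3 := (g.tensorialAt_koszul_left (hY.diffFieldAt p) (hZ.diffFieldAt p)).smul
    (hf.mdifferentiableAt (by simp)) (hX.diffFieldAt p)
  simp only [map_smul, smul_apply, smul_eq_mul] at h3 ⊢
  rw [h3, ← h1] at h4
  linarith

theorem Metric.nabla_add_right (hX : SmoothField X) (hY : SmoothField Y) (hY' : SmoothField Y')
    (p : M) : g.nabla X (Y + Y') p = g.nabla X Y p + g.nabla X Y' p := by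
  refine g.ext_smoothField fun Z hZ => ?_
  have h1 := g.dirD_pairing hX hY hZ p
  have h2 := g.dirD_pairing hX hY' hZ p
  have h3 := g.dirD_pairing hX (hY.add hY') hZ p
  have h4 : g.pairing (Y + Y') Z = fun q => g.pairing Y Z q + g.pairing Y' Z q := by
    ext; simp [Metric.pairing]
  rw [h4, dirD_add (g.mdifferentiable_pairing hY hZ p) (g.mdifferentiable_pairing hY' hZ p)] at h3
  simp only [map_add, add_apply, Pi.add_apply] at h3 ⊢
  linarith

theorem Metric.nabla_smul_right (hf : ContMDiff 𝓘(ℝ, E) 𝓘(ℝ, ℝ) ∞ f) (hX : SmoothField X)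
    (hY : SmoothField Y) (p : M) :
    g.nabla X (f • Y) p = f p • g.nabla X Y p + dirD X f p • Y p := by
  refine g.ext_smoothField fun Z hZ => ?_
  have h1 := g.dirD_pairing hX hY hZ p
  have h3 := g.dirD_pairing hX (hY.smul hf) hZ p
  have h4 : g.pairing (f • Y) Z = fun q => f q * g.pairing Y Z q := by
    ext; simp [Metric.pairing]
  rw [h4, dirD_mul (hf.mdifferentiableAt (by simp)) (g.mdifferentiable_pairing hY hZ p), h1] at h3
  simp only [map_add, map_smul, add_apply, smul_apply,
    smul_eq_mul, Pi.smul_apply', Metric.pairing] at h3 ⊢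
  linarith

theorem Metric.nabla_congr_right (hX : SmoothField X) (hY : SmoothField Y) (hY' : SmoothField Y')
    (h : Y =ᶠ[𝓝 p] Y') : g.nabla X Y p = g.nabla X Y' p := by
  refine g.ext_smoothField fun Z hZ => ?_
  have h1 := g.dirD_pairing hX hY hZ p
  have h2 := g.dirD_pairing hX hY' hZ p
  have h3 : dirD X (g.pairing Y Z) p = dirD X (g.pairing Y' Z) p := by
    apply dirD_congr
    filter_upwards [h] with q hq
    simp [Metric.pairing, hq]
  have h4 := h.self_of_nhds
  rw [h4] at h1
  linarith

theorem Metric.nabla_neg_left (hX : SmoothField X) (hY : SmoothField Y) (p : M) :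
    g.nabla (-X) Y p = - g.nabla X Y p := by
  have h := g.nabla_smul_left (f := fun _ => (-1 : ℝ)) contMDiff_const hX hY p
  rw [show (fun _ : M => (-1 : ℝ)) • X = -X by ext; simp] at h
  simpa using h

theorem Metric.nabla_neg_right (hX : SmoothField X) (hY : SmoothField Y) (p : M) :
    g.nabla X (-Y) p = - g.nabla X Y p := by
  have h := g.nabla_smul_right (f := fun _ => (-1 : ℝ)) contMDiff_const hX hY p
  rw [show (fun _ : M => (-1 : ℝ)) • Y = -Y by ext; simp, dirD_const] at h
  simpa using h

/-! ### Orthonormal frames -/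

/-- Smooth Gram-Schmidt orthogonalization. The fields produced are smooth on all of `M` and lie in
the span of the given ones everywhere, but they are orthonormal only near `p`. -/
theorem Metric.exists_orthonormal {n : ℕ} (Z : Fin n → VField E M) (hZ : ∀ i, SmoothField (Z i))
    (p : M) (hli : LinearIndependent ℝ (fun i => Z i p)) :
    ∃ e : Fin n → VField E M, (∀ i, SmoothField (e i)) ∧
      (∀ i q, e i q ∈ Submodule.span ℝ (Set.range fun j => Z j q)) ∧
      ∀ᶠ q in 𝓝 p, ∀ i j, g.inner q (e i q) (e j q) = if i = j then 1 else 0 := by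
  induction n with
  | zero => exact ⟨fun i => i.elim0, fun i => i.elim0, fun i => i.elim0, by simp⟩
  | succ n ih =>
    obtain ⟨e, he, hspan, hon⟩ := ih (fun i => Z i.castSucc) (fun i => hZ _)
      (hli.comp _ (Fin.castSucc_injective n))
    set L := Z (Fin.last n) with hL
    let W : VField E M := L - fun q => ∑ i, (g.pairing L (e i) • e i) q
    have hW : SmoothField W := (hZ _).sub (SmoothField.sum _ fun i _ =>
      (he i).smul (g.contMDiff_pairing (hZ _) (he i)))
    have hsp : ∀ q, ∑ i, (g.pairing L (e i) • e i) q
        ∈ Submodule.span ℝ (Set.range fun j : Fin n => Z j.castSucc q) := fun q =>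
      Submodule.sum_mem _ fun i _ => Submodule.smul_mem _ _ (hspan i q)
    have hWp : W p ≠ 0 := by
      intro h0
      have h1 : L p = ∑ i, (g.pairing L (e i) • e i) p := sub_eq_zero.1 h0
      have h2 := (linearIndependent_finSucc'.1 hli).2
      apply h2
      have h3 := hsp p
      rw [← h1] at h3
      exact h3
    set N := g.pairing W W with hN
    have hNs := g.contMDiff_pairing hW hW
    have hNp : 0 < N p := g.pos p _ hWp
    have hNo : IsOpen {q | 0 < N q} := isOpen_lt continuous_const hNs.continuous
    have hs : SmoothFieldOn ((fun q => (Real.sqrt (N q))⁻¹) • W) {q | 0 < N q} := by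
      refine ContMDiffOn.smul_section ?_ hW.contMDiffOn
      intro q hq
      have h1 : ContDiffAt ℝ ∞ (fun t : ℝ => (Real.sqrt t)⁻¹) (N q) := by
        have h2 : N q ≠ 0 := (show 0 < N q from hq).ne'
        exact (Real.contDiffAt_sqrt h2).inv (by
          rw [Real.sqrt_ne_zero (le_of_lt hq)]; exact h2)
      exact (h1.contMDiffAt.comp q (hNs q)).contMDiffWithinAt
    obtain ⟨φ, hφ1, -, hφ⟩ := exists_smoothField_smul hNo hNp hs
    set V := φ • ((fun q => (Real.sqrt (N q))⁻¹) • W) with hV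
    have hWorth : ∀ᶠ q in 𝓝 p, ∀ i, g.inner q (W q) (e i q) = 0 := by
      filter_upwards [hon] with q hq i
      have : W q = L q - ∑ j, (g.pairing L (e j) • e j) q := rfl
      rw [this]
      simp [hq, Metric.pairing]
    refine ⟨Fin.snoc e V, ?_, ?_, ?_⟩
    · intro i
      refine Fin.lastCases ?_ (fun j => ?_) i
      · simpa using hφ
      · simpa using he j
    · intro i q
      have hmono : Submodule.span ℝ (Set.range fun j : Fin n => Z j.castSucc q)
          ≤ Submodule.span ℝ (Set.range fun j => Z j q) :=
        Submodule.span_mono (by rintro _ ⟨j, rfl⟩; exact ⟨j.castSucc, rfl⟩)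
      refine Fin.lastCases ?_ (fun j => ?_) i
      · simp only [Fin.snoc_last, hV]
        refine Submodule.smul_mem _ _ (Submodule.smul_mem _ _ (Submodule.sub_mem _ ?_ ?_))
        · exact Submodule.subset_span ⟨Fin.last n, rfl⟩
        · exact hmono (hsp q)
      · simpa using hmono (hspan j q)
    · filter_upwards [hon, hWorth, hφ1, hNo.mem_nhds hNp] with q hq hWq hφq hNq
      have hVq : V q = (Real.sqrt (N q))⁻¹ • W q := by simp [hV, hφq]
      have hVe : ∀ i, g.inner q (V q) (e i q) = 0 := fun i => by rw [hVq]; simp [hWq]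
      intro i j
      refine Fin.lastCases ?_ (fun i => ?_) i
      · refine Fin.lastCases ?_ (fun j => ?_) j
        · simp only [Fin.snoc_last, hVq, if_true]
          have h1 : g.inner q (W q) (W q) = N q := rfl
          have h2 := Real.mul_self_sqrt (le_of_lt hNq)
          have h3 : Real.sqrt (N q) ≠ 0 := Real.sqrt_ne_zero'.2 hNq
          simp only [map_smul, smul_apply, smul_eq_mul, h1]
          field_simp
          linarith
        · simp [hVe, (Fin.castSucc_lt_last j).ne']
      · refine Fin.lastCases ?_ (fun j => ?_) j
        · simp [g.symm q _ (V q), hVe, (Fin.castSucc_lt_last i).ne]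
        · simp [hq]

/-- A vector field is smooth if its inner products with all smooth fields are smooth. -/
theorem Metric.smoothField_of_pairing {W : VField E M}
    (h : ∀ Z : VField E M, SmoothField Z → ContMDiff 𝓘(ℝ, E) 𝓘(ℝ, ℝ) ∞ (g.pairing W Z)) :
    SmoothField W := by
  intro p
  have : FiniteDimensional ℝ (TangentSpace 𝓘(ℝ, E) p) := inferInstanceAs (FiniteDimensional ℝ E)
  let b := Module.finBasis ℝ (TangentSpace 𝓘(ℝ, E) p)
  choose Z hZ hZp using fun i => exists_smoothField_apply_eq (b i)
  obtain ⟨e, he, -, hon⟩ := g.exists_orthonormal Z hZ p (by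
    simp only [hZp]; exact b.linearIndependent)
  have hs : SmoothField (fun q => ∑ i, (g.pairing W (e i) • e i) q) :=
    SmoothField.sum _ fun i _ => (he i).smul (h _ (he i))
  refine (hs p).congr_of_eventuallyEq ?_
  filter_upwards [hon] with q hq
  congr 1
  exact g.eq_sum_of_orthonormal hq (S := ⊤) (fun i => trivial)
    (by rw [finrank_top]; rfl) trivial

theorem Metric.smoothField_nabla (hX : SmoothField X) (hY : SmoothField Y) :
    SmoothField (g.nabla X Y) := by
  have : CompleteSpace E := FiniteDimensional.complete ℝ E
  refine g.smoothField_of_pairing fun Z hZ => ?_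
  have h1 : g.pairing (g.nabla X Y) Z = fun p => (1 / 2 : ℝ) *
      (dirD X (g.pairing Y Z) p + dirD Y (g.pairing X Z) p - dirD Z (g.pairing X Y) p
    + g.pairing (mlieBracket 𝓘(ℝ, E) X Y) Z p - g.pairing (mlieBracket 𝓘(ℝ, E) X Z) Y p
    - g.pairing (mlieBracket 𝓘(ℝ, E) Y Z) X p) := by
    ext p
    have := g.nabla_spec hX hY hZ p
    rw [g.koszul_eq] at this
    simp only [Metric.pairing] at this ⊢
    linarith
  rw [h1]
  have c1 := contMDiff_dirD (g.contMDiff_pairing hY hZ) hX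
  have c2 := contMDiff_dirD (g.contMDiff_pairing hX hZ) hY
  have c3 := contMDiff_dirD (g.contMDiff_pairing hX hY) hZ
  have c4 := g.contMDiff_pairing (hX.mlieBracket hY) hZ
  have c5 := g.contMDiff_pairing (hX.mlieBracket hZ) hY
  have c6 := g.contMDiff_pairing (hY.mlieBracket hZ) hX
  exact contMDiff_const.mul (((((c1.add c2).sub c3).add c4).sub c5).sub c6)

end LeviCivita

/-! ### The metric of the base in a chart -/

section ChartMetric

open VectorField

variable {E' : Type*} [NormedAddCommGroup E'] [NormedSpace ℝ E']
  {B : Type*} [TopologicalSpace B] [ChartedSpace E' B] [IsManifold 𝓘(ℝ, E') ∞ B]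
  (b : Metric E' B) (x z : B)

/-- The metric at `z`, transported to the model space by the differential of the chart at `x`. -/
def Metric.inChart : E' →L[ℝ] E' →L[ℝ] ℝ :=
  let D : E' →L[ℝ] E' := (mfderiv 𝓘(ℝ, E') 𝓘(ℝ, E') (extChartAt 𝓘(ℝ, E') x) z).inverse
  let β : E' →L[ℝ] E' →L[ℝ] ℝ := b.inner z
  β.bilinearComp D D

theorem Metric.inChart_apply (u v : E') : b.inChart x z u v = b.inner z
    ((mfderiv 𝓘(ℝ, E') 𝓘(ℝ, E') (extChartAt 𝓘(ℝ, E') x) z).inverse u)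
    ((mfderiv 𝓘(ℝ, E') 𝓘(ℝ, E') (extChartAt 𝓘(ℝ, E') x) z).inverse v) := rfl

variable {x z}

theorem isManifold_one : IsManifold 𝓘(ℝ, E') 1 B := IsManifold.of_le (n := ∞) (by simp)

theorem Metric.inChart_mvfderiv (hz : z ∈ (extChartAt 𝓘(ℝ, E') x).source)
    (a c : TangentSpace 𝓘(ℝ, E') z) :
    b.inChart x z (mvfderiv 𝓘(ℝ, E') (extChartAt 𝓘(ℝ, E') x) z a)
      (mvfderiv 𝓘(ℝ, E') (extChartAt 𝓘(ℝ, E') x) z c) = b.inner z a c := by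
  have := isManifold_one (E' := E') (B := B)
  have h5 := isInvertible_mfderiv_extChartAt (I := 𝓘(ℝ, E')) hz
  have e : ∀ a, (mfderiv 𝓘(ℝ, E') 𝓘(ℝ, E') (extChartAt 𝓘(ℝ, E') x) z).inverse
      (mvfderiv 𝓘(ℝ, E') (extChartAt 𝓘(ℝ, E') x) z a) = a := fun a => h5.inverse_apply_self a
  rw [b.inChart_apply]
  exact congrArg₂ (fun a c => b.inner z a c) (e a) (e c)

variable [FiniteDimensional ℝ E']

theorem smoothFieldOn_inverse_mfderiv_extChartAt (x : B) (u : E') :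
    SmoothFieldOn (fun z : B =>
      (mfderiv 𝓘(ℝ, E') 𝓘(ℝ, E') (extChartAt 𝓘(ℝ, E') x) z).inverse u)
      (extChartAt 𝓘(ℝ, E') x).source := by
  have := isManifold_one (E' := E') (B := B)
  have : CompleteSpace E' := FiniteDimensional.complete ℝ E'
  intro z hz
  have h1 : ContMDiffAt 𝓘(ℝ, E') 𝓘(ℝ, E') ∞ (extChartAt 𝓘(ℝ, E') x) z :=
    contMDiffAt_extChartAt' (by simpa using hz)
  have h2 : ContMDiffAt 𝓘(ℝ, E') 𝓘(ℝ, E').tangent ∞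
      (fun y : E' => (⟨y, u⟩ : TangentBundle 𝓘(ℝ, E') E')) (extChartAt 𝓘(ℝ, E') x z) :=
    (contMDiffAt_vectorSpace_iff_contDiffAt (V := fun _ : E' => u)).2 contDiffAt_const
  exact (ContMDiffAt.mpullback_vectorField_preimage (m := ∞) h2 h1
    (isInvertible_mfderiv_extChartAt hz) (by simp)).contMDiffWithinAt

theorem Metric.contMDiffOn_inChart (x : B) :
    ContMDiffOn 𝓘(ℝ, E') 𝓘(ℝ, E' →L[ℝ] E' →L[ℝ] ℝ) ∞ (b.inChart x)
      (extChartAt 𝓘(ℝ, E') x).source := by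
  have key : ∀ u v, ContMDiffOn 𝓘(ℝ, E') 𝓘(ℝ, ℝ) ∞ (fun z => b.inChart x z u v)
      (extChartAt 𝓘(ℝ, E') x).source := fun u v => b.contMDiffOn_pairing
    (smoothFieldOn_inverse_mfderiv_extChartAt x u) (smoothFieldOn_inverse_mfderiv_extChartAt x v)
  set χ := extChartAt 𝓘(ℝ, E') x
  have hχ : ContMDiffOn 𝓘(ℝ, E') 𝓘(ℝ, E') ∞ χ χ.source := by
    simpa [χ] using contMDiffOn_extChartAt (I := 𝓘(ℝ, E')) (x := x) (n := ∞)
  have h1 : ContDiffOn ℝ ∞ (fun y => b.inChart x (χ.symm y)) χ.target := by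
    refine contDiffOn_clm_apply.2 fun u => contDiffOn_clm_apply.2 fun v => ?_
    rw [← contMDiffOn_iff_contDiffOn]
    exact (key u v).comp (contMDiffOn_extChartAt_symm x) χ.mapsTo_symm
  have h2 := (contMDiffOn_iff_contDiffOn.2 h1).comp hχ χ.mapsTo
  refine h2.congr fun z hz => ?_
  simp [χ.left_inv hz]

theorem Metric.contDiffOn_inChart_symm (x : B) :
    ContDiffOn ℝ ∞ (fun y => b.inChart x ((extChartAt 𝓘(ℝ, E') x).symm y))
      (extChartAt 𝓘(ℝ, E') x).target := by
  rw [← contMDiffOn_iff_contDiffOn]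
  exact (b.contMDiffOn_inChart x).comp (contMDiffOn_extChartAt_symm x)
    (extChartAt 𝓘(ℝ, E') x).mapsTo_symm

end ChartMetric

section Submersion

variable {E : Type*} [NormedAddCommGroup E] [NormedSpace ℝ E]
  {M : Type*} [TopologicalSpace M] [ChartedSpace E M] [IsManifold 𝓘(ℝ, E) ∞ M]
  {E' : Type*} [NormedAddCommGroup E'] [NormedSpace ℝ E']
  {B : Type*} [TopologicalSpace B] [ChartedSpace E' B] [IsManifold 𝓘(ℝ, E') ∞ B]
  {π : M → B}

theorem surjective_mfderiv_of_isSubmersion (hπ : Manifold.IsSubmersion 𝓘(ℝ, E) 𝓘(ℝ, E') ∞ π)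
    (p : M) : Function.Surjective (mfderiv 𝓘(ℝ, E) 𝓘(ℝ, E') π p) := by
  obtain ⟨F, _, _, h⟩ := hπ.isSubmersionAt p
  have hsE : IsManifold 𝓘(ℝ, E) 1 M := IsManifold.of_le (n := ∞) (by simp)
  have hsB : IsManifold 𝓘(ℝ, E') 1 B := IsManifold.of_le (n := ∞) (by simp)
  set φ := h.domChart
  set χ := h.codChart
  have hφp : p ∈ φ.source := h.mem_domChart_source
  have hχp : π p ∈ χ.source := h.mem_codChart_source
  have hφ : φ ∈ IsManifold.maximalAtlas 𝓘(ℝ, E) 1 M :=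
    IsManifold.maximalAtlas_subset_of_le (n := ∞) (by simp) h.domChart_mem_maximalAtlas
  have hχ : χ ∈ IsManifold.maximalAtlas 𝓘(ℝ, E') 1 B :=
    IsManifold.maximalAtlas_subset_of_le (n := ∞) (by simp) h.codChart_mem_maximalAtlas
  have hyt : φ p ∈ φ.target := φ.map_source hφp
  have h1 : MDifferentiableAt 𝓘(ℝ, E) 𝓘(ℝ, E) φ.symm (φ p) :=
    mdifferentiableAt_symm_of_mem_maximalAtlas hφ hyt
  have h2 : MDifferentiableAt 𝓘(ℝ, E) 𝓘(ℝ, E') π p := (hπ.contMDiff p).mdifferentiableAt (by simp)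
  have h3 : MDifferentiableAt 𝓘(ℝ, E') 𝓘(ℝ, E') χ (π p) :=
    mdifferentiableAt_of_mem_maximalAtlas hχ hχp
  have hχd : OpenPartialHomeomorph.MDifferentiable 𝓘(ℝ, E') 𝓘(ℝ, E') χ :=
    ⟨fun z hz => (mdifferentiableAt_of_mem_maximalAtlas hχ hz).mdifferentiableWithinAt,
      fun z hz => (mdifferentiableAt_symm_of_mem_maximalAtlas hχ hz).mdifferentiableWithinAt⟩
  have hleft : φ.symm (φ p) = p := φ.left_inv hφp
  have h4 : HasMFDerivAt 𝓘(ℝ, E) 𝓘(ℝ, E') (χ ∘ π) p _ := h3.hasMFDerivAt.comp p h2.hasMFDerivAt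
  have h5 : HasMFDerivAt 𝓘(ℝ, E) 𝓘(ℝ, E') ((χ ∘ π) ∘ φ.symm) (φ p) _ :=
    HasMFDerivAt.comp (φ p) (by rw [hleft]; exact h4) h1.hasMFDerivAt
  have h6 : HasMFDerivAt 𝓘(ℝ, E) 𝓘(ℝ, E') ((χ ∘ π) ∘ φ.symm) (φ p)
      ((ContinuousLinearMap.fst ℝ E' F).comp (h.equiv : E →L[ℝ] E' × F)) := by
    refine HasMFDerivAt.congr_of_eventuallyEq
      ((ContinuousLinearMap.fst ℝ E' F).comp (h.equiv : E →L[ℝ] E' × F)).hasMFDerivAt ?_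
    filter_upwards [φ.open_target.mem_nhds hyt] with y hy
    have hy' : y ∈ h.domChart.target := hy
    have := h.writtenInCharts (show y ∈ (h.domChart.extend 𝓘(ℝ, E)).target by simpa using hy')
    simpa using this
  have h7 := hasMFDerivAt_unique h5 h6
  intro w
  obtain ⟨e, he⟩ : ∃ e : E, (h.equiv e).1 = mfderiv 𝓘(ℝ, E') 𝓘(ℝ, E') χ (π p) w :=
    ⟨h.equiv.symm (mfderiv 𝓘(ℝ, E') 𝓘(ℝ, E') χ (π p) w, 0), by
      rw [ContinuousLinearEquiv.apply_symm_apply]⟩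
  have h8 := DFunLike.congr_fun h7 e
  refine ⟨mfderiv 𝓘(ℝ, E) 𝓘(ℝ, E) φ.symm (φ p) e, hχd.mfderiv_injective hχp ?_⟩
  rw [← he]
  exact h8

end Submersion

section Splitting

open VectorField

variable {E : Type*} [NormedAddCommGroup E] [NormedSpace ℝ E]
  {M : Type*} [TopologicalSpace M] [ChartedSpace E M] [IsManifold 𝓘(ℝ, E) ∞ M]
  {E' : Type*} [NormedAddCommGroup E'] [NormedSpace ℝ E']
  {B : Type*} [TopologicalSpace B] [ChartedSpace E' B]
  {π : M → B}

/-! ### The splitting into horizontal and vertical vectors -/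

theorem mem_vert {p : M} {v : TangentSpace 𝓘(ℝ, E) p} :
    v ∈ vert E E' π p ↔ mfderiv 𝓘(ℝ, E) 𝓘(ℝ, E') π p v = 0 := Iff.rfl

/-- Every linear form on a subspace of a tangent space is represented by a vector of the
subspace. -/
theorem Metric.exists_inner_eq [FiniteDimensional ℝ E] (g : Metric E M) {p : M}
    (S : Submodule ℝ (TangentSpace 𝓘(ℝ, E) p)) (φ : S →ₗ[ℝ] ℝ) :
    ∃ z ∈ S, ∀ c : S, g.inner p z c = φ c := by
  have : FiniteDimensional ℝ (TangentSpace 𝓘(ℝ, E) p) := inferInstanceAs (FiniteDimensional ℝ E)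
  let Φ : S →ₗ[ℝ] Module.Dual ℝ S := LinearMap.mk₂ ℝ
    (fun a c => g.inner p (a : TangentSpace 𝓘(ℝ, E) p) (c : TangentSpace 𝓘(ℝ, E) p))
    (by intros; simp) (by intros; simp) (by intros; simp) (by intros; simp)
  have hinj : Function.Injective Φ := by
    rw [injective_iff_map_eq_zero]
    intro a ha
    have h2 : g.inner p (a : TangentSpace 𝓘(ℝ, E) p) a = 0 := LinearMap.congr_fun ha a
    exact Subtype.ext (g.inner_self_eq_zero.1 h2)
  obtain ⟨z, hz⟩ := (LinearMap.injective_iff_surjective_of_finrank_eq_finrank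
    (Subspace.dual_finrank_eq (K := ℝ) (V := S)).symm).1 hinj φ
  exact ⟨z, z.2, fun c => LinearMap.congr_fun hz c⟩

theorem Metric.ext_inner_mem (g : Metric E M) {p : M} {S : Submodule ℝ (TangentSpace 𝓘(ℝ, E) p)}
    {a c : TangentSpace 𝓘(ℝ, E) p} (ha : a ∈ S) (hc : c ∈ S)
    (h : ∀ v ∈ S, g.inner p a v = g.inner p c v) : a = c := by
  rw [← sub_eq_zero, ← g.inner_self_eq_zero]
  have := h (a - c) (S.sub_mem ha hc)
  simp only [map_sub, sub_apply] at this ⊢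
  linarith

namespace HorizontalConnection

variable (ℋ : HorizontalConnection E E' π) {p : M}

theorem horProj_mem (v : TangentSpace 𝓘(ℝ, E) p) : ℋ.horProj p v ∈ ℋ.hor p :=
  Submodule.projection_apply_mem _ _

theorem verProj_mem (v : TangentSpace 𝓘(ℝ, E) p) : ℋ.verProj p v ∈ vert E E' π p :=
  Submodule.projection_apply_mem _ _

variable {ℋ} in
theorem horProj_of_mem {v : TangentSpace 𝓘(ℝ, E) p} (hv : v ∈ ℋ.hor p) : ℋ.horProj p v = v :=
  Submodule.projection_apply_of_mem_left _ hv

theorem verProj_of_mem {v : TangentSpace 𝓘(ℝ, E) p} (hv : v ∈ vert E E' π p) :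
    ℋ.verProj p v = v :=
  Submodule.projection_apply_of_mem_left _ hv

theorem horProj_of_mem_vert {v : TangentSpace 𝓘(ℝ, E) p} (hv : v ∈ vert E E' π p) :
    ℋ.horProj p v = 0 :=
  Submodule.projection_apply_of_mem_right _ hv

variable {ℋ} in
theorem verProj_of_mem_hor {v : TangentSpace 𝓘(ℝ, E) p} (hv : v ∈ ℋ.hor p) :
    ℋ.verProj p v = 0 :=
  Submodule.projection_apply_of_mem_right _ hv

theorem horProj_add_verProj (v : TangentSpace 𝓘(ℝ, E) p) :
    ℋ.horProj p v + ℋ.verProj p v = v := by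
  obtain ⟨a, ha, c, hc, rfl⟩ : ∃ a ∈ ℋ.hor p, ∃ c ∈ vert E E' π p, a + c = v := by
    have : v ∈ ℋ.hor p ⊔ vert E E' π p := by rw [(ℋ.isCompl p).sup_eq_top]; trivial
    exact Submodule.mem_sup.1 this
  rw [map_add, map_add, horProj_of_mem ha, ℋ.verProj_of_mem hc, ℋ.horProj_of_mem_vert hc,
    verProj_of_mem_hor ha]
  simp

theorem mfderiv_horProj (v : TangentSpace 𝓘(ℝ, E) p) :
    mfderiv 𝓘(ℝ, E) 𝓘(ℝ, E') π p (ℋ.horProj p v) = mfderiv 𝓘(ℝ, E) 𝓘(ℝ, E') π p v := by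
  conv_rhs => rw [← ℋ.horProj_add_verProj v, map_add, mem_vert.1 (ℋ.verProj_mem v), add_zero]

variable [IsManifold 𝓘(ℝ, E') ∞ B] {ℋ} {b : Metric E' B} {g : Metric E M}

section Adapted

variable (hg : ℋ.IsAdapted b g)
include hg

theorem IsAdapted.inner_vert_hor {ξ a : TangentSpace 𝓘(ℝ, E) p} (hξ : ξ ∈ vert E E' π p)
    (ha : a ∈ ℋ.hor p) : g.inner p ξ a = 0 := hg.1 p ξ hξ a ha

theorem IsAdapted.inner_hor_vert {ξ a : TangentSpace 𝓘(ℝ, E) p} (ha : a ∈ ℋ.hor p)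
    (hξ : ξ ∈ vert E E' π p) : g.inner p a ξ = 0 := by
  rw [g.symm]; exact hg.1 p ξ hξ a ha

theorem IsAdapted.inner_horProj {a : TangentSpace 𝓘(ℝ, E) p} (v : TangentSpace 𝓘(ℝ, E) p)
    (ha : a ∈ ℋ.hor p) : g.inner p (ℋ.horProj p v) a = g.inner p v a := by
  conv_rhs => rw [← ℋ.horProj_add_verProj v]
  simp [hg.inner_vert_hor (ℋ.verProj_mem v) ha]

theorem IsAdapted.inner_verProj {ξ : TangentSpace 𝓘(ℝ, E) p} (v : TangentSpace 𝓘(ℝ, E) p)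
    (hξ : ξ ∈ vert E E' π p) : g.inner p (ℋ.verProj p v) ξ = g.inner p v ξ := by
  conv_rhs => rw [← ℋ.horProj_add_verProj v]
  simp [hg.inner_hor_vert (ℋ.horProj_mem v) hξ]

end Adapted

/-! ### Horizontal and vertical frames -/

section Frames

variable [FiniteDimensional ℝ E]

theorem finrank_hor (hπ : Manifold.IsSubmersion 𝓘(ℝ, E) 𝓘(ℝ, E') ∞ π) (p : M) :
    Module.finrank ℝ (ℋ.hor p) = Module.finrank ℝ E' := by
  have : FiniteDimensional ℝ (TangentSpace 𝓘(ℝ, E) p) := inferInstanceAs (FiniteDimensional ℝ E)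
  let L : ℋ.hor p →ₗ[ℝ] TangentSpace 𝓘(ℝ, E') (π p) :=
    (mfderiv 𝓘(ℝ, E) 𝓘(ℝ, E') π p).toLinearMap ∘ₗ (ℋ.hor p).subtype
  have hinj : Function.Injective L := by
    rw [injective_iff_map_eq_zero]
    intro a ha
    have h1 : (a : TangentSpace 𝓘(ℝ, E) p) ∈ vert E E' π p := ha
    exact Subtype.ext ((Submodule.disjoint_def.1 (ℋ.isCompl p).disjoint) _ a.2 h1)
  have hsurj : Function.Surjective L := by
    intro w
    obtain ⟨v, hv⟩ := surjective_mfderiv_of_isSubmersion hπ p w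
    exact ⟨⟨_, ℋ.horProj_mem v⟩, (ℋ.mfderiv_horProj v).trans hv⟩
  exact (LinearEquiv.ofBijective L ⟨hinj, hsurj⟩).finrank_eq

theorem finrank_vert (ℋ : HorizontalConnection E E' π)
    (hπ : Manifold.IsSubmersion 𝓘(ℝ, E) 𝓘(ℝ, E') ∞ π) (p : M) :
    Module.finrank ℝ (vert E E' π p) = Module.finrank ℝ E - Module.finrank ℝ E' := by
  have : FiniteDimensional ℝ (TangentSpace 𝓘(ℝ, E) p) := inferInstanceAs (FiniteDimensional ℝ E)
  have h1 := Submodule.finrank_add_eq_of_isCompl (ℋ.isCompl p)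
  rw [finrank_hor hπ p] at h1
  have h2 : Module.finrank ℝ (TangentSpace 𝓘(ℝ, E) p) = Module.finrank ℝ E := rfl
  omega

variable [T2Space M]

theorem exists_horizontal_apply_eq (ℋ : HorizontalConnection E E' π) {a : TangentSpace 𝓘(ℝ, E) p}
    (ha : a ∈ ℋ.hor p) : ∃ X : VField E M, SmoothField X ∧ ℋ.IsHorizontal X ∧ X p = a := by
  obtain ⟨U, hU, hp, X, hX, hXh, hXp⟩ := ℋ.smooth p a ha
  obtain ⟨φ, h1, h0, h2⟩ := exists_smoothField_smul hU hp hX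
  refine ⟨_, h2, fun q => ?_, by simp [h1.self_of_nhds, hXp]⟩
  by_cases hq : q ∈ U
  · exact Submodule.smul_mem _ _ (hXh q hq)
  · simp [h0 q hq]

theorem exists_horizontal_frame (ℋ : HorizontalConnection E E' π) (g : Metric E M)
    (hπ : Manifold.IsSubmersion 𝓘(ℝ, E) 𝓘(ℝ, E') ∞ π) (p : M) :
    ∃ e : Fin (Module.finrank ℝ E') → VField E M, (∀ i, SmoothField (e i)) ∧
      (∀ i, ℋ.IsHorizontal (e i)) ∧
      ∀ᶠ q in 𝓝 p, ∀ i j, g.inner q (e i q) (e j q) = if i = j then 1 else 0 := by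
  have : FiniteDimensional ℝ (TangentSpace 𝓘(ℝ, E) p) := inferInstanceAs (FiniteDimensional ℝ E)
  let β := Module.finBasisOfFinrankEq ℝ (ℋ.hor p) (finrank_hor hπ p)
  choose Z hZ hZh hZp using fun i => ℋ.exists_horizontal_apply_eq (β i).2
  obtain ⟨e, he, hsp, hon⟩ := g.exists_orthonormal Z hZ p (by
    simp only [hZp]
    exact β.linearIndependent.map' (ℋ.hor p).subtype (Submodule.ker_subtype _))
  refine ⟨e, he, fun i q => ?_, hon⟩
  refine Submodule.span_le.2 ?_ (hsp i q)
  rintro _ ⟨j, rfl⟩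
  exact hZh j q

variable (hπ : Manifold.IsSubmersion 𝓘(ℝ, E) 𝓘(ℝ, E') ∞ π) (hg : ℋ.IsAdapted b g)
  {X Y ξ η : VField E M}
include hπ hg

theorem IsAdapted.smoothField_horProj (hX : SmoothField X) :
    SmoothField (fun q => ℋ.horProj q (X q)) := by
  intro p
  obtain ⟨e, he, heh, hon⟩ := ℋ.exists_horizontal_frame g hπ p
  have hs : SmoothField (fun q => ∑ i, (g.pairing X (e i) • e i) q) :=
    SmoothField.sum _ fun i _ => (he i).smul (g.contMDiff_pairing hX (he i))
  refine (hs p).congr_of_eventuallyEq ?_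
  filter_upwards [hon] with q hq
  congr 1
  rw [g.eq_sum_of_orthonormal hq (fun i => heh i q) (finrank_hor hπ q) (ℋ.horProj_mem (X q))]
  simp only [hg.inner_horProj _ (heh _ q)]
  rfl

theorem IsAdapted.smoothField_verProj (hX : SmoothField X) :
    SmoothField (fun q => ℋ.verProj q (X q)) := by
  have h := hX.sub (hg.smoothField_horProj hπ hX)
  have e : (fun q => ℋ.verProj q (X q)) = X - fun q => ℋ.horProj q (X q) := by
    ext q
    rw [eq_comm, Pi.sub_apply, sub_eq_iff_eq_add, add_comm]
    exact (ℋ.horProj_add_verProj (X q)).symm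
  rw [e]; exact h

theorem IsAdapted.exists_vertical_apply_eq {a : TangentSpace 𝓘(ℝ, E) p}
    (ha : a ∈ vert E E' π p) :
    ∃ X : VField E M, SmoothField X ∧ (∀ q, X q ∈ vert E E' π q) ∧ X p = a := by
  obtain ⟨X, hX, hXp⟩ := exists_smoothField_apply_eq a
  exact ⟨_, hg.smoothField_verProj hπ hX, fun q => ℋ.verProj_mem _, by
    rw [hXp]; exact ℋ.verProj_of_mem ha⟩

theorem IsAdapted.exists_vertical_frame (p : M) :
    ∃ e : Fin (Module.finrank ℝ E - Module.finrank ℝ E') → VField E M, (∀ i, SmoothField (e i)) ∧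
      (∀ i q, e i q ∈ vert E E' π q) ∧
      ∀ᶠ q in 𝓝 p, ∀ i j, g.inner q (e i q) (e j q) = if i = j then 1 else 0 := by
  have : FiniteDimensional ℝ (TangentSpace 𝓘(ℝ, E) p) := inferInstanceAs (FiniteDimensional ℝ E)
  let β := Module.finBasisOfFinrankEq ℝ (vert E E' π p) (finrank_vert ℋ hπ p)
  choose Z hZ hZh hZp using fun i => hg.exists_vertical_apply_eq hπ (β i).2
  obtain ⟨e, he, hsp, hon⟩ := g.exists_orthonormal Z hZ p (by
    simp only [hZp]
    exact β.linearIndependent.map' (vert E E' π p).subtype (Submodule.ker_subtype _))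
  refine ⟨e, he, fun i q => ?_, hon⟩
  refine Submodule.span_le.2 ?_ (hsp i q)
  rintro _ ⟨j, rfl⟩
  exact hZh j q

end Frames

/-! ### The tensor `A` and its dual -/

section Tensor

variable [FiniteDimensional ℝ E] [T2Space M]
  (hπ : Manifold.IsSubmersion 𝓘(ℝ, E) 𝓘(ℝ, E') ∞ π) (hg : ℋ.IsAdapted b g)
  {X X' Y Y' ξ η : VField E M}

theorem tensorA_mem (ℋ : HorizontalConnection E E' π) (a c : TangentSpace 𝓘(ℝ, E) p) :
    ℋ.tensorA p a c ∈ vert E E' π p :=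
  Submodule.smul_mem _ _ (ℋ.verProj_mem _)

/-- The vertical part of `[X, Y]` is tensorial in horizontal `X` and `Y`. -/
theorem IsAdapted.inner_mlieBracket_vert (hg : ℋ.IsAdapted b g) (hX : SmoothField X)
    (hY : SmoothField Y)
    (hξ : SmoothField ξ) (hXh : ℋ.IsHorizontal X) (hYh : ℋ.IsHorizontal Y)
    (hξv : ∀ q, ξ q ∈ vert E E' π q) (p : M) :
    g.inner p (mlieBracket 𝓘(ℝ, E) X Y p) (ξ p)
      = g.inner p (X p) (g.nabla Y ξ p) - g.inner p (Y p) (g.nabla X ξ p) := by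
  have h1 := g.dirD_pairing hX hY hξ p
  have h2 := g.dirD_pairing hY hX hξ p
  have e1 : g.pairing Y ξ = fun _ => 0 := by ext q; exact hg.inner_hor_vert (hYh q) (hξv q)
  have e2 : g.pairing X ξ = fun _ => 0 := by ext q; exact hg.inner_hor_vert (hXh q) (hξv q)
  rw [e1, dirD_const] at h1
  rw [e2, dirD_const] at h2
  rw [← g.nabla_sub_nabla hX hY]
  simp only [map_sub, sub_apply]
  linarith

include hπ hg

theorem IsAdapted.verProj_mlieBracket_congr (hX : SmoothField X) (hY : SmoothField Y)
    (hX' : SmoothField X') (hY' : SmoothField Y') (hXh : ℋ.IsHorizontal X)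
    (hYh : ℋ.IsHorizontal Y) (hXh' : ℋ.IsHorizontal X') (hYh' : ℋ.IsHorizontal Y')
    (h : X p = X' p) (h' : Y p = Y' p) :
    ℋ.verProj p (mlieBracket 𝓘(ℝ, E) X Y p) = ℋ.verProj p (mlieBracket 𝓘(ℝ, E) X' Y' p) := by
  refine g.ext_inner_mem (ℋ.verProj_mem _) (ℋ.verProj_mem _) fun v hv => ?_
  obtain ⟨ξ, hξ, hξv, rfl⟩ := hg.exists_vertical_apply_eq hπ hv
  rw [hg.inner_verProj _ hv, hg.inner_verProj _ hv,
    hg.inner_mlieBracket_vert hX hY hξ hXh hYh hξv, hg.inner_mlieBracket_vert hX' hY' hξ hXh' hYh' hξv,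
    g.nabla_congr_left hX hX' hξ h, g.nabla_congr_left hY hY' hξ h', h, h']

theorem IsAdapted.exists_extend_eq (a : TangentSpace 𝓘(ℝ, E) p) :
    ∃ X : VField E M, SmoothField X ∧ ℋ.IsHorizontal X ∧ X =ᶠ[𝓝 p] ℋ.extend p a := by
  obtain ⟨s, hs, h⟩ := FiberBundle.exists_contMDiffOn_extend (k := ∞) 𝓘(ℝ, E) E
    (V := fun r : M => TangentSpace 𝓘(ℝ, E) r) a
  obtain ⟨U, hUs, hU, hp⟩ := mem_nhds_iff.1 hs
  obtain ⟨φ, h1, -, h2⟩ := exists_smoothField_smul hU hp (h.mono hUs)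
  refine ⟨_, hg.smoothField_horProj hπ h2, fun q => ℋ.horProj_mem _, ?_⟩
  filter_upwards [h1] with q hq
  simp only [HorizontalConnection.extend, Pi.smul_apply', hq, Pi.one_apply, one_smul]
  rfl

theorem IsAdapted.tensorA_eq (hX : SmoothField X) (hY : SmoothField Y) (hXh : ℋ.IsHorizontal X)
    (hYh : ℋ.IsHorizontal Y) (p : M) :
    ℋ.tensorA p (X p) (Y p) = (1 / 2 : ℝ) • ℋ.verProj p (mlieBracket 𝓘(ℝ, E) X Y p) := by
  obtain ⟨X', hX', hXh', hXe⟩ := hg.exists_extend_eq hπ (X p)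
  obtain ⟨Y', hY', hYh', hYe⟩ := hg.exists_extend_eq hπ (Y p)
  have e : ∀ Z : VField E M, ℋ.IsHorizontal Z → ℋ.extend p (Z p) p = Z p := fun Z hZ => by
    simp [HorizontalConnection.extend, horProj_of_mem (hZ p)]
  rw [tensorA, ← Filter.EventuallyEq.mlieBracket_vectorField_eq hXe hYe,
    hg.verProj_mlieBracket_congr hπ hX' hY' hX hY hXh' hYh' hXh hYh
      (by rw [hXe.self_of_nhds, e X hXh]) (by rw [hYe.self_of_nhds, e Y hYh])]

theorem IsAdapted.tensorA_swap {a c : TangentSpace 𝓘(ℝ, E) p} (ha : a ∈ ℋ.hor p)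
    (hc : c ∈ ℋ.hor p) : ℋ.tensorA p a c = - ℋ.tensorA p c a := by
  obtain ⟨X, hX, hXh, rfl⟩ := ℋ.exists_horizontal_apply_eq ha
  obtain ⟨Y, hY, hYh, rfl⟩ := ℋ.exists_horizontal_apply_eq hc
  rw [hg.tensorA_eq hπ hX hY hXh hYh, hg.tensorA_eq hπ hY hX hYh hXh, mlieBracket_swap_apply]
  simp

theorem IsAdapted.tensorA_add_right {a c d : TangentSpace 𝓘(ℝ, E) p} (ha : a ∈ ℋ.hor p)
    (hc : c ∈ ℋ.hor p) (hd : d ∈ ℋ.hor p) :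
    ℋ.tensorA p a (c + d) = ℋ.tensorA p a c + ℋ.tensorA p a d := by
  have : CompleteSpace E := FiniteDimensional.complete ℝ E
  obtain ⟨X, hX, hXh, rfl⟩ := ℋ.exists_horizontal_apply_eq ha
  obtain ⟨Y, hY, hYh, rfl⟩ := ℋ.exists_horizontal_apply_eq hc
  obtain ⟨Z, hZ, hZh, rfl⟩ := ℋ.exists_horizontal_apply_eq hd
  rw [hg.tensorA_eq hπ hX hY hXh hYh, hg.tensorA_eq hπ hX hZ hXh hZh, ← Pi.add_apply,
    hg.tensorA_eq hπ hX (hY.add hZ) hXh (fun q => Submodule.add_mem _ (hYh q) (hZh q)),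
    mlieBracket_add_right (hY.diffFieldAt p) (hZ.diffFieldAt p), map_add, smul_add]

theorem IsAdapted.tensorA_smul_right (r : ℝ) {a c : TangentSpace 𝓘(ℝ, E) p} (ha : a ∈ ℋ.hor p)
    (hc : c ∈ ℋ.hor p) : ℋ.tensorA p a (r • c) = r • ℋ.tensorA p a c := by
  have : CompleteSpace E := FiniteDimensional.complete ℝ E
  obtain ⟨X, hX, hXh, rfl⟩ := ℋ.exists_horizontal_apply_eq ha
  obtain ⟨Y, hY, hYh, rfl⟩ := ℋ.exists_horizontal_apply_eq hc
  rw [hg.tensorA_eq hπ hX hY hXh hYh, ← Pi.smul_apply,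
    hg.tensorA_eq hπ hX (hY.const_smul r) hXh (fun q => Submodule.smul_mem _ r (hYh q)),
    mlieBracket_const_smul_right (hY.diffFieldAt p), map_smul, smul_comm]

theorem IsAdapted.tensorA_add_left {a c d : TangentSpace 𝓘(ℝ, E) p} (ha : a ∈ ℋ.hor p)
    (hc : c ∈ ℋ.hor p) (hd : d ∈ ℋ.hor p) :
    ℋ.tensorA p (c + d) a = ℋ.tensorA p c a + ℋ.tensorA p d a := by
  rw [hg.tensorA_swap hπ (Submodule.add_mem _ hc hd) ha, hg.tensorA_add_right hπ ha hc hd,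
    hg.tensorA_swap hπ hc ha, hg.tensorA_swap hπ hd ha, neg_add]

theorem IsAdapted.tensorA_smul_left (r : ℝ) {a c : TangentSpace 𝓘(ℝ, E) p} (ha : a ∈ ℋ.hor p)
    (hc : c ∈ ℋ.hor p) : ℋ.tensorA p (r • c) a = r • ℋ.tensorA p c a := by
  rw [hg.tensorA_swap hπ (Submodule.smul_mem _ _ hc) ha, hg.tensorA_smul_right hπ r ha hc,
    hg.tensorA_swap hπ hc ha, smul_neg]

theorem IsAdapted.dualA_spec {a : TangentSpace 𝓘(ℝ, E) p} (ha : a ∈ ℋ.hor p)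
    (v : TangentSpace 𝓘(ℝ, E) p) : ℋ.dualA g p a v ∈ ℋ.hor p ∧
      ∀ c ∈ ℋ.hor p, g.inner p (ℋ.dualA g p a v) c = g.inner p (ℋ.tensorA p a c) v := by
  let φ : ℋ.hor p →ₗ[ℝ] ℝ :=
    { toFun := fun c => g.inner p (ℋ.tensorA p a c) v
      map_add' := fun c d => by
        rw [Submodule.coe_add, hg.tensorA_add_right hπ ha c.2 d.2]; simp
      map_smul' := fun r c => by
        rw [Submodule.coe_smul, hg.tensorA_smul_right hπ r ha c.2]; simp }
  obtain ⟨z, hz, h⟩ := g.exists_inner_eq (ℋ.hor p) φ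
  exact Classical.epsilon_spec (p := fun z => z ∈ ℋ.hor p ∧ ∀ c ∈ ℋ.hor p,
    g.inner p z c = g.inner p (ℋ.tensorA p a c) v) ⟨z, hz, fun c hc => h ⟨c, hc⟩⟩

theorem IsAdapted.dualA_mem {a : TangentSpace 𝓘(ℝ, E) p} (ha : a ∈ ℋ.hor p)
    (v : TangentSpace 𝓘(ℝ, E) p) : ℋ.dualA g p a v ∈ ℋ.hor p := (hg.dualA_spec hπ ha v).1

theorem IsAdapted.inner_dualA {a c : TangentSpace 𝓘(ℝ, E) p} (ha : a ∈ ℋ.hor p)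
    (hc : c ∈ ℋ.hor p) (v : TangentSpace 𝓘(ℝ, E) p) :
    g.inner p (ℋ.dualA g p a v) c = g.inner p (ℋ.tensorA p a c) v :=
  (hg.dualA_spec hπ ha v).2 c hc

theorem IsAdapted.dualA_eq {a z v : TangentSpace 𝓘(ℝ, E) p} (ha : a ∈ ℋ.hor p)
    (hz : z ∈ ℋ.hor p) (h : ∀ c ∈ ℋ.hor p, g.inner p z c = g.inner p (ℋ.tensorA p a c) v) :
    ℋ.dualA g p a v = z :=
  g.ext_inner_mem (hg.dualA_mem hπ ha v) hz fun c hc => by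
    rw [hg.inner_dualA hπ ha hc, h c hc]

theorem IsAdapted.dualA_smul_right {a : TangentSpace 𝓘(ℝ, E) p} (ha : a ∈ ℋ.hor p) (r : ℝ)
    (v : TangentSpace 𝓘(ℝ, E) p) : ℋ.dualA g p a (r • v) = r • ℋ.dualA g p a v :=
  hg.dualA_eq hπ ha (Submodule.smul_mem _ _ (hg.dualA_mem hπ ha v))
    fun c hc => by simp [hg.inner_dualA hπ ha hc]

theorem IsAdapted.dualA_smul_left {a : TangentSpace 𝓘(ℝ, E) p} (ha : a ∈ ℋ.hor p) (r : ℝ)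
    (v : TangentSpace 𝓘(ℝ, E) p) : ℋ.dualA g p (r • a) v = r • ℋ.dualA g p a v :=
  hg.dualA_eq hπ (Submodule.smul_mem _ _ ha) (Submodule.smul_mem _ _ (hg.dualA_mem hπ ha v))
    fun c hc => by simp [hg.inner_dualA hπ ha hc, hg.tensorA_smul_left hπ r hc ha]

/-- The function `⟨A_X Y, ξ⟩` in terms of the bracket. -/
theorem IsAdapted.inner_tensorA (hX : SmoothField X) (hY : SmoothField Y)
    (hXh : ℋ.IsHorizontal X) (hYh : ℋ.IsHorizontal Y) (hξv : ξ p ∈ vert E E' π p) :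
    g.inner p (ℋ.tensorA p (X p) (Y p)) (ξ p)
      = (1 / 2 : ℝ) * g.inner p (mlieBracket 𝓘(ℝ, E) X Y p) (ξ p) := by
  rw [hg.tensorA_eq hπ hX hY hXh hYh, map_smul, smul_apply, hg.inner_verProj _ hξv, smul_eq_mul]

theorem IsAdapted.smoothField_tensorA (hX : SmoothField X) (hY : SmoothField Y)
    (hXh : ℋ.IsHorizontal X) (hYh : ℋ.IsHorizontal Y) :
    SmoothField (fun q => ℋ.tensorA q (X q) (Y q)) := by
  have : CompleteSpace E := FiniteDimensional.complete ℝ E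
  have := (hg.smoothField_verProj hπ (hX.mlieBracket hY)).const_smul (1 / 2 : ℝ)
  rwa [show (fun q => ℋ.tensorA q (X q) (Y q))
    = (1 / 2 : ℝ) • fun q => ℋ.verProj q (mlieBracket 𝓘(ℝ, E) X Y q) from
    funext fun q => hg.tensorA_eq hπ hX hY hXh hYh q]

theorem IsAdapted.smoothField_dualA (hX : SmoothField X) (hξ : SmoothField ξ)
    (hXh : ℋ.IsHorizontal X) : SmoothField (fun q => ℋ.dualA g q (X q) (ξ q)) := by
  refine g.smoothField_of_pairing fun Z hZ => ?_
  have hZ' := hg.smoothField_horProj hπ hZ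
  have e : g.pairing (fun q => ℋ.dualA g q (X q) (ξ q)) Z
      = g.pairing (fun q => ℋ.tensorA q (X q) (ℋ.horProj q (Z q))) ξ := by
    ext q
    simp only [Metric.pairing]
    rw [g.symm, ← hg.inner_horProj _ (hg.dualA_mem hπ (hXh q) _), g.symm,
      hg.inner_dualA hπ (hXh q) (ℋ.horProj_mem _)]
  rw [e]
  exact g.contMDiff_pairing (hg.smoothField_tensorA hπ hX hZ' hXh fun q => ℋ.horProj_mem _) hξ

end Tensor

end HorizontalConnection

end Splitting

/-! ### Derivatives of horizontal inner products along the fibers -/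

section ChainRule

variable {E : Type*} [NormedAddCommGroup E] [NormedSpace ℝ E]
  {M : Type*} [TopologicalSpace M] [ChartedSpace E M]
  {E' : Type*} [NormedAddCommGroup E'] [NormedSpace ℝ E']
  {B : Type*} [TopologicalSpace B] [ChartedSpace E' B]
  {F F' : Type*} [NormedAddCommGroup F] [NormedSpace ℝ F] [NormedAddCommGroup F']
  [NormedSpace ℝ F'] {X : VField E M} {p : M}

theorem dirD_comp_map {π : M → B} {k : B → F} (hk : MDifferentiableAt 𝓘(ℝ, E') 𝓘(ℝ, F) k (π p))
    (hπ : MDifferentiableAt 𝓘(ℝ, E) 𝓘(ℝ, E') π p) :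
    dirD X (fun q => k (π q)) p
      = mvfderiv 𝓘(ℝ, E') k (π p) (mfderiv 𝓘(ℝ, E) 𝓘(ℝ, E') π p (X p)) :=
  mfderiv_comp_apply p hk hπ (X p)

theorem dirD_eq_fderiv {f : M → F} (hf : MDifferentiableAt 𝓘(ℝ, E) 𝓘(ℝ, F) f p) :
    dirD X f p = fderiv ℝ (fun y => f ((extChartAt 𝓘(ℝ, E) p).symm y))
      (extChartAt 𝓘(ℝ, E) p p) (X p) := by
  have := hf.mvfderiv
  simp only [modelWithCornersSelf_coe, Set.range_id, fderivWithin_univ] at this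
  rw [dirD, this]
  rfl

theorem dirD_clm_apply {c : M → F →L[ℝ] F'} {f : M → F}
    (hc : MDifferentiableAt 𝓘(ℝ, E) 𝓘(ℝ, F →L[ℝ] F') c p)
    (hf : MDifferentiableAt 𝓘(ℝ, E) 𝓘(ℝ, F) f p) :
    dirD X (fun q => c q (f q)) p = dirD X c p (f p) + c p (dirD X f p) := by
  have hcd := hc.differentiableWithinAt_writtenInExtChartAt
  have hfd := hf.differentiableWithinAt_writtenInExtChartAt
  simp only [modelWithCornersSelf_coe, Set.range_id, differentiableWithinAt_univ] at hcd hfd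
  have hcf : MDifferentiableAt 𝓘(ℝ, E) 𝓘(ℝ, F') (fun q => c q (f q)) p := by
    rw [mdifferentiableAt_iff]
    refine ⟨hc.continuousAt.clm_apply hf.continuousAt, ?_⟩
    simp only [modelWithCornersSelf_coe, Set.range_id, differentiableWithinAt_univ]
    exact hcd.clm_apply hfd
  rw [dirD_eq_fderiv hcf, dirD_eq_fderiv hc, dirD_eq_fderiv hf]
  have := fderiv_clm_apply hcd hfd
  have e := DFunLike.congr_fun this (X p)
  simp only [writtenInExtChartAt, extChartAt_model_space_eq_id, PartialEquiv.refl_coe,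
    Function.comp_def, id, extChartAt_to_inv] at e
  rw [add_comm]
  exact e

end ChainRule

section VerticalDerivative

open VectorField

variable {E : Type*} [NormedAddCommGroup E] [NormedSpace ℝ E] [FiniteDimensional ℝ E]
  {M : Type*} [TopologicalSpace M] [T2Space M] [ChartedSpace E M] [IsManifold 𝓘(ℝ, E) ∞ M]
  {E' : Type*} [NormedAddCommGroup E'] [NormedSpace ℝ E'] [FiniteDimensional ℝ E']
  {B : Type*} [TopologicalSpace B] [ChartedSpace E' B] [IsManifold 𝓘(ℝ, E') ∞ B]
  {π : M → B} {ℋ : HorizontalConnection E E' π} {b : Metric E' B} {g : Metric E M}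
  {X Y Z ξ η : VField E M}

/-- A chart of the base at `x`, composed with the submersion. -/
def baseCoord (E' : Type*) [NormedAddCommGroup E'] [NormedSpace ℝ E'] {B : Type*}
    [TopologicalSpace B] [ChartedSpace E' B] (π : M → B) (x : B) : M → E' :=
  fun q => extChartAt 𝓘(ℝ, E') x (π q)

/-- The domain of `baseCoord`. -/
def baseDomain (E' : Type*) [NormedAddCommGroup E'] [NormedSpace ℝ E'] {B : Type*}
    [TopologicalSpace B] [ChartedSpace E' B] (π : M → B) (x : B) : Set M :=
  π ⁻¹' (extChartAt 𝓘(ℝ, E') x).source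

variable (hπ : Manifold.IsSubmersion 𝓘(ℝ, E) 𝓘(ℝ, E') ∞ π) {x : B} {p q : M}

theorem mem_baseDomain : p ∈ baseDomain E' π (π p) := mem_extChartAt_source _

include hπ

theorem isOpen_baseDomain (x : B) : IsOpen (baseDomain E' π x) :=
  (isOpen_extChartAt_source x).preimage hπ.contMDiff.continuous

theorem contMDiffOn_baseCoord (x : B) :
    ContMDiffOn 𝓘(ℝ, E) 𝓘(ℝ, E') ∞ (baseCoord E' π x) (baseDomain E' π x) :=
  (by simpa using contMDiffOn_extChartAt (I := 𝓘(ℝ, E')) (x := x) (n := ∞) :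
    ContMDiffOn 𝓘(ℝ, E') 𝓘(ℝ, E') ∞ (extChartAt 𝓘(ℝ, E') x) (extChartAt 𝓘(ℝ, E') x).source).comp
    hπ.contMDiff.contMDiffOn fun _ h => h

theorem mdifferentiableAt_submersion (p : M) : MDifferentiableAt 𝓘(ℝ, E) 𝓘(ℝ, E') π p :=
  (hπ.contMDiff p).mdifferentiableAt (by simp)

theorem dirD_baseCoord (hq : q ∈ baseDomain E' π x) :
    dirD X (baseCoord E' π x) q = mvfderiv 𝓘(ℝ, E') (extChartAt 𝓘(ℝ, E') x) (π q)
      (mfderiv 𝓘(ℝ, E) 𝓘(ℝ, E') π q (X q)) := by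
  have : π q ∈ (extChartAt 𝓘(ℝ, E') x).source := hq
  exact dirD_comp_map (mdifferentiableAt_extChartAt (by simpa using this))
    (mdifferentiableAt_submersion hπ q)

theorem dirD_baseCoord_eq_zero_iff (hq : q ∈ baseDomain E' π x) :
    dirD X (baseCoord E' π x) q = 0 ↔ X q ∈ vert E E' π q := by
  have := isManifold_one (E' := E') (B := B)
  have h5 := isInvertible_mfderiv_extChartAt (I := 𝓘(ℝ, E')) (x := x) (y := π q) hq
  rw [dirD_baseCoord hπ hq, mem_vert]
  exact map_eq_zero_iff _ h5.injective

namespace HorizontalConnection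

theorem dirD_baseCoord_horProj (hq : q ∈ baseDomain E' π x) :
    dirD (fun r => ℋ.horProj r (X r)) (baseCoord E' π x) q = dirD X (baseCoord E' π x) q := by
  rw [dirD_baseCoord hπ hq, dirD_baseCoord hπ hq, ℋ.mfderiv_horProj]

theorem mlieBracket_mem_vert (hξ : SmoothField ξ) (hη : SmoothField η)
    (hξv : ∀ q, ξ q ∈ vert E E' π q) (hηv : ∀ q, η q ∈ vert E E' π q) (p : M) :
    mlieBracket 𝓘(ℝ, E) ξ η p ∈ vert E E' π p := by
  have : CompleteSpace E := FiniteDimensional.complete ℝ E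
  have hU := isOpen_baseDomain hπ (π p)
  have h0 : ∀ ζ : VField E M, (∀ q, ζ q ∈ vert E E' π q) →
      dirD ζ (baseCoord E' π (π p)) =ᶠ[𝓝 p] fun _ => 0 := fun ζ hζ => by
    filter_upwards [hU.mem_nhds mem_baseDomain] with q hq
    exact (dirD_baseCoord_eq_zero_iff hπ hq).2 (hζ q)
  rw [← dirD_baseCoord_eq_zero_iff (X := mlieBracket 𝓘(ℝ, E) ξ η) hπ mem_baseDomain,
    dirD_mlieBracket hU mem_baseDomain (contMDiffOn_baseCoord hπ _) hξ hη,
    dirD_congr (h0 ξ hξv), dirD_congr (h0 η hηv)]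
  simp [dirD_const]

theorem IsAdapted.inChart_dirD (hg : ℋ.IsAdapted b g) (hXh : X q ∈ ℋ.hor q)
    (hYh : Y q ∈ ℋ.hor q) (hq : q ∈ baseDomain E' π x) :
    b.inChart x (π q) (dirD X (baseCoord E' π x) q) (dirD Y (baseCoord E' π x) q)
      = g.inner q (X q) (Y q) := by
  rw [dirD_baseCoord hπ hq, dirD_baseCoord hπ hq, b.inChart_mvfderiv hq, hg.2 q _ hXh _ hYh]

theorem contMDiffOn_inChart_comp (b : Metric E' B) (x : B) :
    ContMDiffOn 𝓘(ℝ, E) 𝓘(ℝ, E' →L[ℝ] E' →L[ℝ] ℝ) ∞ (fun q => b.inChart x (π q))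
      (baseDomain E' π x) :=
  (b.contMDiffOn_inChart x).comp hπ.contMDiff.contMDiffOn fun _ h => h

/-- The derivative of the inner product of two horizontal fields, computed in a chart of the
base. -/
theorem IsAdapted.dirD_pairing_hor (hg : ℋ.IsAdapted b g) (hX : SmoothField X)
    (hY : SmoothField Y)
    (hXh : ℋ.IsHorizontal X) (hYh : ℋ.IsHorizontal Y) (hp : p ∈ baseDomain E' π x) :
    dirD Z (g.pairing X Y) p = dirD Z (fun q => b.inChart x (π q)) p
        (dirD X (baseCoord E' π x) p) (dirD Y (baseCoord E' π x) p)
      + b.inChart x (π p) (dirD Z (dirD X (baseCoord E' π x)) p) (dirD Y (baseCoord E' π x) p)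
      + b.inChart x (π p) (dirD X (baseCoord E' π x) p)
          (dirD Z (dirD Y (baseCoord E' π x)) p) := by
  have hU := isOpen_baseDomain hπ x
  have md : ∀ {G : Type _} [NormedAddCommGroup G] [NormedSpace ℝ G] {f : M → G},
      ContMDiffOn 𝓘(ℝ, E) 𝓘(ℝ, G) ∞ f (baseDomain E' π x) → MDifferentiableAt 𝓘(ℝ, E) 𝓘(ℝ, G) f p :=
    fun hf => (hf.contMDiffAt (hU.mem_nhds hp)).mdifferentiableAt (by simp)
  have hψ := contMDiffOn_baseCoord hπ x
  have hβ := contMDiffOn_inChart_comp hπ b x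
  have hX' := contMDiffOn_dirD hU hψ (X := X) hX.contMDiffOn
  have hY' := contMDiffOn_dirD hU hψ (X := Y) hY.contMDiffOn
  have e : g.pairing X Y =ᶠ[𝓝 p] fun q =>
      b.inChart x (π q) (dirD X (baseCoord E' π x) q) (dirD Y (baseCoord E' π x) q) := by
    filter_upwards [hU.mem_nhds hp] with q hq
    exact (hg.inChart_dirD hπ (hXh q) (hYh q) hq).symm
  have hβX : ContMDiffOn 𝓘(ℝ, E) 𝓘(ℝ, E' →L[ℝ] ℝ) ∞
      (fun q => b.inChart x (π q) (dirD X (baseCoord E' π x) q)) (baseDomain E' π x) :=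
    hβ.clm_apply hX'
  rw [dirD_congr e, dirD_clm_apply (md hβX) (md hY'), dirD_clm_apply (md hβ) (md hX')]
  simp only [add_apply]

theorem dirD_inChart_vert (b : Metric E' B) (hp : p ∈ baseDomain E' π x)
    (hξ : ξ p ∈ vert E E' π p) : dirD ξ (fun q => b.inChart x (π q)) p = 0 := by
  have : MDifferentiableAt 𝓘(ℝ, E') 𝓘(ℝ, E' →L[ℝ] E' →L[ℝ] ℝ) (b.inChart x) (π p) :=
    ((b.contMDiffOn_inChart x).contMDiffAt
      ((isOpen_extChartAt_source x).mem_nhds hp)).mdifferentiableAt (by simp)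
  rw [dirD_comp_map this (mdifferentiableAt_submersion hπ p), mem_vert.1 hξ, map_zero]

variable (hg : ℋ.IsAdapted b g)
include hg

/-- The metric of the horizontal spaces is invariant under vertical flows: the Lie derivative of
the horizontal part of `g` along a vertical field `ξ` vanishes. -/
theorem IsAdapted.dirD_vert_pairing (hX : SmoothField X) (hY : SmoothField Y) (hξ : SmoothField ξ)
    (hXh : ℋ.IsHorizontal X) (hYh : ℋ.IsHorizontal Y) (hξv : ∀ q, ξ q ∈ vert E E' π q) (p : M) :
    dirD ξ (g.pairing X Y) p = g.inner p (mlieBracket 𝓘(ℝ, E) ξ X p) (Y p)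
      + g.inner p (X p) (mlieBracket 𝓘(ℝ, E) ξ Y p) := by
  have : CompleteSpace E := FiniteDimensional.complete ℝ E
  have hp : p ∈ baseDomain E' π (π p) := mem_baseDomain
  have hU := isOpen_baseDomain hπ (π p)
  have hψ := contMDiffOn_baseCoord hπ (π p)
  have h0 : dirD ξ (baseCoord E' π (π p)) =ᶠ[𝓝 p] fun _ => 0 := by
    filter_upwards [hU.mem_nhds hp] with q hq
    exact (dirD_baseCoord_eq_zero_iff hπ hq).2 (hξv q)
  have hb : ∀ Z : VField E M, SmoothField Z → dirD ξ (dirD Z (baseCoord E' π (π p))) p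
      = dirD (fun r => ℋ.horProj r (mlieBracket 𝓘(ℝ, E) ξ Z r)) (baseCoord E' π (π p)) p := by
    intro Z hZ
    rw [dirD_baseCoord_horProj hπ hp, dirD_mlieBracket hU hp hψ hξ hZ, dirD_congr h0, dirD_const,
      sub_zero]
  rw [hg.dirD_pairing_hor hπ hX hY hXh hYh hp, dirD_inChart_vert hπ b hp (hξv p), hb X hX, hb Y hY,
    hg.inChart_dirD hπ (ℋ.horProj_mem _) (hYh p) hp,
    hg.inChart_dirD hπ (hXh p) (ℋ.horProj_mem _) hp, hg.inner_horProj _ (hYh p),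
    g.symm p (X p), hg.inner_horProj _ (hXh p), g.symm p (X p)]
  simp

/-- The vertical part of `∇_X Y` is `A_X Y`, for all horizontal fields. -/
theorem IsAdapted.inner_nabla_hor (hX : SmoothField X) (hY : SmoothField Y) (hξ : SmoothField ξ)
    (hXh : ℋ.IsHorizontal X) (hYh : ℋ.IsHorizontal Y) (hξv : ∀ q, ξ q ∈ vert E E' π q) (p : M) :
    g.inner p (g.nabla X Y p) (ξ p) = g.inner p (ℋ.tensorA p (X p) (Y p)) (ξ p) := by
  have h := g.nabla_spec hX hY hξ p
  have e1 : g.pairing Y ξ = fun _ => 0 := by ext q; exact hg.inner_hor_vert (hYh q) (hξv q)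
  have e2 : g.pairing X ξ = fun _ => 0 := by ext q; exact hg.inner_hor_vert (hXh q) (hξv q)
  rw [g.koszul_eq, hg.dirD_vert_pairing hπ hX hY hξ hXh hYh hξv, e1, e2, dirD_const, dirD_const,
    mlieBracket_swap_apply (V := X) (W := ξ), mlieBracket_swap_apply (V := Y) (W := ξ),
    g.symm p (X p)] at h
  rw [hg.inner_tensorA hπ hX hY hXh hYh (hξv p)]
  simp only [map_neg, neg_apply] at h
  linarith

theorem IsAdapted.verProj_nabla_hor (hX : SmoothField X) (hY : SmoothField Y)
    (hXh : ℋ.IsHorizontal X) (hYh : ℋ.IsHorizontal Y) (p : M) :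
    ℋ.verProj p (g.nabla X Y p) = ℋ.tensorA p (X p) (Y p) := by
  refine g.ext_inner_mem (ℋ.verProj_mem _) (ℋ.tensorA_mem _ _) fun v hv => ?_
  obtain ⟨ξ, hξ, hξv, rfl⟩ := hg.exists_vertical_apply_eq hπ hv
  rw [hg.inner_verProj _ hv, hg.inner_nabla_hor hπ hX hY hξ hXh hYh hξv]

/-- The horizontal part of `∇_X ξ` is `-A^*_X ξ`, for horizontal `X` and vertical `ξ`. -/
theorem IsAdapted.inner_nabla_vert (hX : SmoothField X) (hY : SmoothField Y) (hξ : SmoothField ξ)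
    (hXh : ℋ.IsHorizontal X) (hYh : ℋ.IsHorizontal Y) (hξv : ∀ q, ξ q ∈ vert E E' π q) (p : M) :
    g.inner p (g.nabla X ξ p) (Y p) = - g.inner p (ℋ.tensorA p (X p) (Y p)) (ξ p) := by
  have h := g.dirD_pairing hX hξ hY p
  have e1 : g.pairing ξ Y = fun _ => 0 := by ext q; exact hg.inner_vert_hor (hξv q) (hYh q)
  rw [e1, dirD_const, g.symm p (ξ p), hg.inner_nabla_hor hπ hX hY hξ hXh hYh hξv] at h
  linarith

theorem IsAdapted.horProj_nabla_vert (hX : SmoothField X) (hξ : SmoothField ξ)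
    (hXh : ℋ.IsHorizontal X) (hξv : ∀ q, ξ q ∈ vert E E' π q) (p : M) :
    ℋ.horProj p (g.nabla X ξ p) = - ℋ.dualA g p (X p) (ξ p) := by
  refine g.ext_inner_mem (ℋ.horProj_mem _)
    (Submodule.neg_mem _ (hg.dualA_mem hπ (hXh p) _)) fun c hc => ?_
  obtain ⟨Y, hY, hYh, rfl⟩ := ℋ.exists_horizontal_apply_eq hc
  rw [hg.inner_horProj _ hc, hg.inner_nabla_vert hπ hX hY hξ hXh hYh hξv, map_neg, neg_apply,
    hg.inner_dualA hπ (hXh p) hc]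

/-- The shape operators of the fibers are symmetric. -/
theorem IsAdapted.inner_nabla_vert_symm (hX : SmoothField X) (hξ : SmoothField ξ)
    (hη : SmoothField η) (hXh : ℋ.IsHorizontal X) (hξv : ∀ q, ξ q ∈ vert E E' π q)
    (hηv : ∀ q, η q ∈ vert E E' π q) (p : M) :
    g.inner p (g.nabla ξ X p) (η p) = g.inner p (g.nabla η X p) (ξ p) := by
  have h1 := g.dirD_pairing hξ hX hη p
  have h2 := g.dirD_pairing hη hX hξ p
  have e1 : g.pairing X η = fun _ => 0 := by ext q; exact hg.inner_hor_vert (hXh q) (hηv q)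
  have e2 : g.pairing X ξ = fun _ => 0 := by ext q; exact hg.inner_hor_vert (hXh q) (hξv q)
  rw [e1, dirD_const] at h1
  rw [e2, dirD_const] at h2
  have h3 := congrArg (g.inner p (X p)) (g.nabla_sub_nabla hξ hη p)
  rw [map_sub, hg.inner_hor_vert (hXh p) (mlieBracket_mem_vert hπ hξ hη hξv hηv p)] at h3
  linarith

/-! ### The expression defining weak non-negativity -/

/-- The vector `(∇_X A^*)_X ξ + A^*_X S_X ξ`, paired with a horizontal field `Y`, involves the
metric of the fibers only through the final pairing with `ξ`. -/
theorem IsAdapted.inner_covDualA_add (hX : SmoothField X) (hY : SmoothField Y) (hξ : SmoothField ξ)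
    (hXh : ℋ.IsHorizontal X) (hYh : ℋ.IsHorizontal Y) (hξv : ∀ q, ξ q ∈ vert E E' π q) (p : M) :
    g.inner p (ℋ.covDualA g X ξ p + ℋ.dualA g p (X p) (ℋ.shape g X ξ p)) (Y p)
      = g.inner p (ℋ.verProj p (mlieBracket 𝓘(ℝ, E) X (fun q => ℋ.tensorA q (X q) (Y q)) p)
          - ℋ.tensorA p (X p) (ℋ.horProj p (g.nabla X Y p))
          - ℋ.tensorA p (ℋ.horProj p (g.nabla X X p)) (Y p)) (ξ p) := by
  set η : VField E M := fun q => ℋ.tensorA q (X q) (Y q) with hηdef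
  have hη : SmoothField η := hg.smoothField_tensorA hπ hX hY hXh hYh
  have hηv : ∀ q, η q ∈ vert E E' π q := fun q => ℋ.tensorA_mem _ _
  have hA : SmoothField (fun q => ℋ.dualA g q (X q) (ξ q)) := hg.smoothField_dualA hπ hX hξ hXh
  have h1 := g.dirD_pairing hX hA hY p
  have h2 := g.dirD_pairing hX hη hξ p
  have e1 : g.pairing (fun q => ℋ.dualA g q (X q) (ξ q)) Y = g.pairing η ξ := by
    ext q; exact hg.inner_dualA hπ (hXh q) (hYh q) _
  have e2 : g.inner p (ℋ.dualA g p (X p) (ξ p)) (g.nabla X Y p)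
      = g.inner p (ℋ.tensorA p (X p) (ℋ.horProj p (g.nabla X Y p))) (ξ p) := by
    rw [← hg.inner_dualA hπ (hXh p) (ℋ.horProj_mem _), g.symm, g.symm _ _ (ℋ.horProj _ _),
      hg.inner_horProj _ (hg.dualA_mem hπ (hXh p) _)]
  have h3 := hg.inner_nabla_vert_symm hπ hX hξ hη hXh hξv hηv p
  have h4 := congrArg (fun v => g.inner p v (ξ p)) (g.nabla_sub_nabla hX hη p)
  rw [e1, h2, e2] at h1
  simp only [covDualA, shape, map_add, map_sub, add_apply, sub_apply] at h4 ⊢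
  rw [hg.inner_dualA hπ (ℋ.horProj_mem _) (hYh p), hg.inner_dualA hπ (hXh p) (hYh p),
    hg.inner_dualA hπ (hXh p) (hYh p), hg.inner_verProj _ (hξv p), map_neg,
    g.symm _ _ (ℋ.verProj _ _), g.symm _ _ (ℋ.verProj _ _),
    hg.inner_verProj _ (hηv p), hg.inner_verProj _ (hηv p), g.symm _ (g.nabla X ξ p)]
  simp only [hηdef] at h1 h3 h4 ⊢
  linarith

omit hπ in
theorem IsAdapted.horProj_nabla_congr {g' : Metric E M} (hg' : ℋ.IsAdapted b g')
    (hX : SmoothField X) (hY : SmoothField Y) (hXh : ℋ.IsHorizontal X) (hYh : ℋ.IsHorizontal Y)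
    (p : M) : ℋ.horProj p (g.nabla X Y p) = ℋ.horProj p (g'.nabla X Y p) := by
  have hin : ∀ q, ∀ a ∈ ℋ.hor q, ∀ c ∈ ℋ.hor q, g.inner q a c = g'.inner q a c :=
    fun q a ha c hc => by rw [← hg.2 q a ha c hc, hg'.2 q a ha c hc]
  refine g.ext_inner_mem (ℋ.horProj_mem _) (ℋ.horProj_mem _) fun c hc => ?_
  obtain ⟨Z, hZ, hZh, rfl⟩ := ℋ.exists_horizontal_apply_eq hc
  rw [hin p _ (ℋ.horProj_mem (g'.nabla X Y p)) _ hc, hg.inner_horProj _ hc,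
    hg'.inner_horProj _ hc]
  have h1 := g.nabla_spec hX hY hZ p
  have h2 := g'.nabla_spec hX hY hZ p
  have hpair : ∀ V W : VField E M, ℋ.IsHorizontal V → ℋ.IsHorizontal W →
      g.pairing V W = g'.pairing V W := fun V W hV hW => by
    ext q; exact hin q _ (hV q) _ (hW q)
  have hbr : ∀ (v : TangentSpace 𝓘(ℝ, E) p) (W : VField E M), ℋ.IsHorizontal W →
      g.inner p v (W p) = g'.inner p v (W p) := fun v W hW => by
    rw [← hg.inner_horProj v (hW p), ← hg'.inner_horProj v (hW p),
      hin p _ (ℋ.horProj_mem v) _ (hW p)]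
  rw [g.koszul_eq, hpair Y Z hYh hZh, hpair X Z hXh hZh, hpair X Y hXh hYh, hbr _ X hXh,
    hbr (mlieBracket 𝓘(ℝ, E) X Y p) Z hZh, hbr _ Y hYh] at h1
  rw [g'.koszul_eq] at h2
  linarith

theorem IsAdapted.isWNN_of_isWNN {g' : Metric E M} (hg' : ℋ.IsAdapted b g') (h : ℋ.IsWNN g) :
    ℋ.IsWNN g' := by
  have hin : ∀ q, ∀ a ∈ ℋ.hor q, ∀ c ∈ ℋ.hor q, g.inner q a c = g'.inner q a c :=
    fun q a ha c hc => by rw [← hg.2 q a ha c hc, hg'.2 q a ha c hc]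
  intro p
  obtain ⟨U, hU, τ, hτ, H⟩ := h p
  refine ⟨U, hU, τ, hτ, fun X ξ' hX hξ' hXh hξv' q hq => ?_⟩
  -- the vertical vector which represents the form `g' (ξ', ·)` with respect to `g`
  obtain ⟨v, hv, hvξ⟩ := g.exists_inner_eq (vert E E' π q)
    ((g'.inner q (ξ' q)).toLinearMap ∘ₗ (vert E E' π q).subtype)
  obtain ⟨ξ, hξ, hξv, rfl⟩ := hg.exists_vertical_apply_eq hπ hv
  have hvξ' : ∀ c ∈ vert E E' π q, g.inner q c (ξ q) = g'.inner q c (ξ' q) := fun c hc => by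
    rw [g.symm, g'.symm]; exact hvξ ⟨c, hc⟩
  have hdual : ℋ.dualA g' q (X q) (ξ' q) = ℋ.dualA g q (X q) (ξ q) := by
    refine hg'.dualA_eq hπ (hXh q) (hg.dualA_mem hπ (hXh q) _) fun c hc => ?_
    rw [← hin q _ (hg.dualA_mem hπ (hXh q) _) _ hc, hg.inner_dualA hπ (hXh q) hc,
      hvξ' _ (ℋ.tensorA_mem _ _)]
  have hmem := hg.dualA_mem hπ (hXh q) (ξ q)
  obtain ⟨Y, hY, hYh, hYq⟩ := ℋ.exists_horizontal_apply_eq hmem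
  have key := H X ξ hX hξ hXh hξv q hq
  rw [hdual, ← hYq] at *
  rw [hg'.inner_covDualA_add hπ hX hY hξ' hXh hYh hξv',
    ← hg.horProj_nabla_congr hg' hX hY hXh hYh, ← hg.horProj_nabla_congr hg' hX hX hXh hXh,
    ← hvξ' _ (Submodule.sub_mem _ (Submodule.sub_mem _ (ℋ.verProj_mem _) (ℋ.tensorA_mem _ _))
      (ℋ.tensorA_mem _ _)), ← hg.inner_covDualA_add hπ hX hY hξ hXh hYh hξv]
  simp only [Metric.length] at key ⊢
  rwa [← hin q _ (hXh q) _ (hXh q), ← hin q _ (hYh q) _ (hYh q)]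

end HorizontalConnection

end VerticalDerivative

/-! ### Symmetries and local bounds of the curvature tensor -/

section Curvature

open VectorField

variable {E : Type*} [NormedAddCommGroup E] [NormedSpace ℝ E] [FiniteDimensional ℝ E]
  {M : Type*} [TopologicalSpace M] [T2Space M] [ChartedSpace E M] [IsManifold 𝓘(ℝ, E) ∞ M]
  (g : Metric E M) {X X' Y Y' Z Z' W : VField E M} {f : M → ℝ} {p : M}

theorem Metric.pairing_sub_sq_pos {a c : TangentSpace 𝓘(ℝ, E) p}
    (h : LinearIndependent ℝ ![a, c]) :
    0 < g.inner p a a * g.inner p c c - g.inner p a c ^ 2 := by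
  have ha : a ≠ 0 := h.ne_zero 0
  have hv : g.inner p a a • c - g.inner p a c • a ≠ 0 := by
    intro h0
    have := LinearIndependent.pair_iff.1 h (- g.inner p a c) (g.inner p a a) (by
      rw [neg_smul, neg_add_eq_sub]; exact h0)
    exact ha (g.inner_self_eq_zero.1 this.2)
  have h1 := g.pos p a ha
  have h2 := g.pos p _ hv
  simp only [map_sub, map_smul, sub_apply, smul_apply, smul_eq_mul, g.symm p c a] at h2
  have h3 : 0 < g.inner p a a * (g.inner p a a * g.inner p c c - g.inner p a c ^ 2) := by
    linarith
  exact pos_of_mul_pos_right h3 h1.le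

theorem Metric.curvature_swap (hX : SmoothField X) (hY : SmoothField Y) (hZ : SmoothField Z)
    (p : M) : g.curvature X Y Z p = - g.curvature Y X Z p := by
  have : CompleteSpace E := FiniteDimensional.complete ℝ E
  have e : mlieBracket 𝓘(ℝ, E) X Y = - mlieBracket 𝓘(ℝ, E) Y X := mlieBracket_swap
  simp only [Metric.curvature]
  rw [e, g.nabla_neg_left (hY.mlieBracket hX) hZ]
  abel

theorem Metric.smoothField_curvature (hX : SmoothField X) (hY : SmoothField Y)
    (hZ : SmoothField Z) : SmoothField (g.curvature X Y Z) := by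
  have : CompleteSpace E := FiniteDimensional.complete ℝ E
  exact ((g.smoothField_nabla hX (g.smoothField_nabla hY hZ)).sub
    (g.smoothField_nabla hY (g.smoothField_nabla hX hZ))).sub
    (g.smoothField_nabla (hX.mlieBracket hY) hZ)

theorem Metric.dirD_dirD_pairing (hX : SmoothField X) (hY : SmoothField Y) (hZ : SmoothField Z)
    (hW : SmoothField W) (p : M) : dirD X (dirD Y (g.pairing Z W)) p
      = g.inner p (g.nabla X (g.nabla Y Z) p) (W p) + g.inner p (g.nabla Y Z p) (g.nabla X W p)
      + g.inner p (g.nabla X Z p) (g.nabla Y W p)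
      + g.inner p (Z p) (g.nabla X (g.nabla Y W) p) := by
  have hYZ := g.smoothField_nabla hY hZ
  have hYW := g.smoothField_nabla hY hW
  have e : dirD Y (g.pairing Z W)
      = fun q => g.pairing (g.nabla Y Z) W q + g.pairing Z (g.nabla Y W) q :=
    funext fun q => g.dirD_pairing hY hZ hW q
  rw [e, dirD_add (g.mdifferentiable_pairing hYZ hW p) (g.mdifferentiable_pairing hZ hYW p),
    g.dirD_pairing hX hYZ hW, g.dirD_pairing hX hZ hYW]
  ring

theorem Metric.inner_curvature_swap_right (hX : SmoothField X) (hY : SmoothField Y)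
    (hZ : SmoothField Z) (hW : SmoothField W) (p : M) :
    g.inner p (g.curvature X Y Z p) (W p) = - g.inner p (g.curvature X Y W p) (Z p) := by
  have : CompleteSpace E := FiniteDimensional.complete ℝ E
  have h1 := dirD_mlieBracket isOpen_univ (Set.mem_univ p)
    (g.contMDiff_pairing hZ hW).contMDiffOn hX hY
  rw [g.dirD_dirD_pairing hX hY hZ hW, g.dirD_dirD_pairing hY hX hZ hW,
    g.dirD_pairing (hX.mlieBracket hY) hZ hW] at h1
  simp only [Metric.curvature, map_sub, sub_apply]
  rw [g.symm p (Z p), g.symm p (Z p), g.symm p (Z p)] at h1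
  linarith

/-- The first Bianchi identity. -/
theorem Metric.curvature_bianchi (hX : SmoothField X) (hY : SmoothField Y) (hZ : SmoothField Z)
    (p : M) : g.curvature X Y Z p + g.curvature Y Z X p + g.curvature Z X Y p = 0 := by
  have hE : CompleteSpace E := FiniteDimensional.complete ℝ E
  have hM : IsManifold 𝓘(ℝ, E) (minSmoothness ℝ 3) M := isManifold_minSmoothness 3
  have key : ∀ {X Y Z : VField E M}, SmoothField X → SmoothField Y → SmoothField Z →
      g.nabla X (g.nabla Y Z) p - g.nabla X (g.nabla Z Y) p
        - g.nabla (mlieBracket 𝓘(ℝ, E) Y Z) X p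
        = mlieBracket 𝓘(ℝ, E) X (mlieBracket 𝓘(ℝ, E) Y Z) p := by
    intro X Y Z hX hY hZ
    have e : g.nabla Y Z = g.nabla Z Y + mlieBracket 𝓘(ℝ, E) Y Z := by
      ext q
      rw [Pi.add_apply, ← g.nabla_sub_nabla hY hZ q]; abel
    rw [← g.nabla_sub_nabla hX (hY.mlieBracket hZ), e,
      g.nabla_add_right hX (g.smoothField_nabla hZ hY) (hY.mlieBracket hZ)]
    abel
  have hle : minSmoothness ℝ 2 ≤ (∞ : WithTop ℕ∞) := by
    rw [minSmoothness_of_isRCLikeNormedField]; exact two_le_infty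
  have h := leibniz_identity_mlieBracket_apply (I := 𝓘(ℝ, E)) (x := p)
    ((hX p).of_le hle) ((hY p).of_le hle) ((hZ p).of_le hle)
  have h1 := key hX hY hZ
  have h2 := key hY hZ hX
  have h3 := key hZ hX hY
  rw [mlieBracket_swap_apply (V := mlieBracket 𝓘(ℝ, E) X Y)] at h
  have e2 : mlieBracket 𝓘(ℝ, E) Y (mlieBracket 𝓘(ℝ, E) Z X) p
      = - mlieBracket 𝓘(ℝ, E) Y (mlieBracket 𝓘(ℝ, E) X Z) p := by
    have e : mlieBracket 𝓘(ℝ, E) Z X = (-1 : ℝ) • mlieBracket 𝓘(ℝ, E) X Z := by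
      rw [mlieBracket_swap]; simp
    rw [e, mlieBracket_const_smul_right ((hX.mlieBracket hZ).diffFieldAt p)]
    simp
  have h4 : mlieBracket 𝓘(ℝ, E) X (mlieBracket 𝓘(ℝ, E) Y Z) p
      + mlieBracket 𝓘(ℝ, E) Y (mlieBracket 𝓘(ℝ, E) Z X) p
      + mlieBracket 𝓘(ℝ, E) Z (mlieBracket 𝓘(ℝ, E) X Y) p = 0 := by
    rw [e2, h]; abel
  rw [← h4, ← h1, ← h2, ← h3]
  simp only [Metric.curvature]
  abel

theorem Metric.inner_curvature_pair_symm (hX : SmoothField X) (hY : SmoothField Y)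
    (hZ : SmoothField Z) (hW : SmoothField W) (p : M) :
    g.inner p (g.curvature X Y Z p) (W p) = g.inner p (g.curvature Z W X p) (Y p) := by
  have B : ∀ {X Y Z W : VField E M}, SmoothField X → SmoothField Y → SmoothField Z →
      g.inner p (g.curvature X Y Z p) (W p) + g.inner p (g.curvature Y Z X p) (W p)
        + g.inner p (g.curvature Z X Y p) (W p) = 0 := by
    intro X Y Z W hX hY hZ
    have := congrArg (fun v => g.inner p v (W p)) (g.curvature_bianchi hX hY hZ p)
    simpa using this
  have S1 : ∀ {X Y Z W : VField E M}, SmoothField X → SmoothField Y → SmoothField Z →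
      g.inner p (g.curvature X Y Z p) (W p) = - g.inner p (g.curvature Y X Z p) (W p) := by
    intro X Y Z W hX hY hZ
    rw [g.curvature_swap hX hY hZ]; simp
  have h1 := B (W := W) hX hY hZ
  have h2 := B (W := X) hY hZ hW
  have h3 := B (W := Y) hZ hW hX
  have h4 := B (W := Z) hW hX hY
  linarith [g.inner_curvature_swap_right hX hY hZ hW p, g.inner_curvature_swap_right hY hZ hX hW p,
    g.inner_curvature_swap_right hX hZ hY hW p, g.inner_curvature_swap_right hZ hW hY hX p,
    g.inner_curvature_swap_right hY hW hZ hX p, g.inner_curvature_swap_right hW hX hZ hY p,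
    S1 (W := W) hZ hX hY, S1 (W := X) hW hY hZ]

theorem Metric.curvature_add_left (hX : SmoothField X) (hX' : SmoothField X')
    (hY : SmoothField Y) (hZ : SmoothField Z) (p : M) :
    g.curvature (X + X') Y Z p = g.curvature X Y Z p + g.curvature X' Y Z p := by
  have : CompleteSpace E := FiniteDimensional.complete ℝ E
  have e1 : mlieBracket 𝓘(ℝ, E) (X + X') Y
      = mlieBracket 𝓘(ℝ, E) X Y + mlieBracket 𝓘(ℝ, E) X' Y := funext fun q =>
    mlieBracket_add_left (hX.diffFieldAt q) (hX'.diffFieldAt q)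
  have e2 : g.nabla (X + X') Z = g.nabla X Z + g.nabla X' Z :=
    funext fun q => g.nabla_add_left hX hX' hZ q
  simp only [Metric.curvature]
  rw [e1, e2, g.nabla_add_left hX hX' (g.smoothField_nabla hY hZ),
    g.nabla_add_left (hX.mlieBracket hY) (hX'.mlieBracket hY) hZ,
    g.nabla_add_right hY (g.smoothField_nabla hX hZ) (g.smoothField_nabla hX' hZ)]
  abel

theorem Metric.curvature_smul_left (hf : ContMDiff 𝓘(ℝ, E) 𝓘(ℝ, ℝ) ∞ f) (hX : SmoothField X)
    (hY : SmoothField Y) (hZ : SmoothField Z) (p : M) :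
    g.curvature (f • X) Y Z p = f p • g.curvature X Y Z p := by
  have : CompleteSpace E := FiniteDimensional.complete ℝ E
  have e1 : mlieBracket 𝓘(ℝ, E) (f • X) Y
      = (fun q => - dirD Y f q) • X + f • mlieBracket 𝓘(ℝ, E) X Y := funext fun q => by
    rw [mlieBracket_smul_left (hf.mdifferentiableAt (by simp)) (hX.diffFieldAt q)]
    simp [dirD]
  have e2 : g.nabla (f • X) Z = f • g.nabla X Z :=
    funext fun q => g.nabla_smul_left hf hX hZ q
  have hd : ContMDiff 𝓘(ℝ, E) 𝓘(ℝ, ℝ) ∞ (fun q => - dirD Y f q) := (contMDiff_dirD hf hY).neg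
  simp only [Metric.curvature]
  rw [e1, e2, g.nabla_smul_left hf hX (g.smoothField_nabla hY hZ),
    g.nabla_add_left (hX.smul hd) ((hX.mlieBracket hY).smul hf) hZ,
    g.nabla_smul_left hd hX hZ, g.nabla_smul_left hf (hX.mlieBracket hY) hZ,
    g.nabla_smul_right hf hY (g.smoothField_nabla hX hZ)]
  simp only [smul_sub, neg_smul]
  abel

theorem Metric.curvature_congr_left (hX : SmoothField X) (hX' : SmoothField X')
    (hY : SmoothField Y) (hZ : SmoothField Z) (h : X =ᶠ[𝓝 p] X') :
    g.curvature X Y Z p = g.curvature X' Y Z p := by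
  have : CompleteSpace E := FiniteDimensional.complete ℝ E
  have e2 : g.nabla X Z =ᶠ[𝓝 p] g.nabla X' Z := by
    filter_upwards [h] with q hq
    exact g.nabla_congr_left hX hX' hZ hq
  simp only [Metric.curvature]
  rw [g.nabla_congr_left hX hX' (g.smoothField_nabla hY hZ) h.self_of_nhds,
    g.nabla_congr_right hY (g.smoothField_nabla hX hZ) (g.smoothField_nabla hX' hZ) e2,
    g.nabla_congr_left (hX.mlieBracket hY) (hX'.mlieBracket hY) hZ
      (h.mlieBracket_vectorField_eq Filter.EventuallyEq.rfl)]

theorem Metric.abs_inner_le_length {a c : TangentSpace 𝓘(ℝ, E) p}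
    (hc : g.inner p c c = 1) : |g.inner p a c| ≤ g.length p a := by
  refine Real.abs_le_sqrt ?_
  have := g.inner_self_nonneg (a - g.inner p a c • c)
  simp only [map_sub, map_smul, sub_apply, smul_apply, smul_eq_mul, hc, g.symm p c a] at this
  nlinarith

theorem Metric.curvature_sum_left {n : ℕ} {e : Fin n → VField E M} (he : ∀ i, SmoothField (e i))
    {f : Fin n → M → ℝ} (hf : ∀ i, ContMDiff 𝓘(ℝ, E) 𝓘(ℝ, ℝ) ∞ (f i))
    (hY : SmoothField Y) (hZ : SmoothField Z) (p : M) :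
    g.curvature (fun q => ∑ i, (f i • e i) q) Y Z p = ∑ i, f i p • g.curvature (e i) Y Z p := by
  induction n with
  | zero =>
    have h := g.curvature_smul_left (f := fun _ => (0 : ℝ)) contMDiff_const
      (smoothField_zero (E := E) (M := M)) hY hZ p
    simp only [Finset.univ_eq_empty, Finset.sum_empty]
    simp only [smul_zero, zero_smul] at h
    exact h
  | succ n ih =>
    have e1 : (fun q => ∑ i, (f i • e i) q)
        = (fun q => ∑ i : Fin n, (f i.castSucc • e i.castSucc) q)
          + f (Fin.last n) • e (Fin.last n) := by
      ext q; simp only [Fin.sum_univ_castSucc, Pi.add_apply]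
    rw [e1, g.curvature_add_left (SmoothField.sum _ fun i _ => (he _).smul (hf _))
      ((he _).smul (hf _)) hY hZ, ih (fun i => he _) (fun i => hf _),
      g.curvature_smul_left (hf _) (he _) hY hZ, Fin.sum_univ_castSucc]

/-- Near every point there is a smooth orthonormal frame. -/
theorem Metric.exists_frame (p : M) :
    ∃ e : Fin (Module.finrank ℝ E) → VField E M, (∀ i, SmoothField (e i)) ∧
      ∀ᶠ q in 𝓝 p, ∀ i j, g.inner q (e i q) (e j q) = if i = j then 1 else 0 := by
  have : FiniteDimensional ℝ (TangentSpace 𝓘(ℝ, E) p) := inferInstanceAs (FiniteDimensional ℝ E)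
  let β := Module.finBasis ℝ (TangentSpace 𝓘(ℝ, E) p)
  choose Z hZ hZp using fun i => exists_smoothField_apply_eq (β i)
  obtain ⟨e, he, -, hon⟩ := g.exists_orthonormal Z hZ p (by
    simp only [hZp]; exact β.linearIndependent)
  exact ⟨e, he, hon⟩

theorem Metric.abs_inner_curvature_le_left {n : ℕ} (hn : n = Module.finrank ℝ E)
    {e : Fin n → VField E M}
    (he : ∀ i, SmoothField (e i))
    (hon : ∀ᶠ q in 𝓝 p, ∀ i j, g.inner q (e i q) (e j q) = if i = j then 1 else 0)
    (hX : SmoothField X) (hY : SmoothField Y) (hZ : SmoothField Z) :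
    |g.inner p (g.curvature X Y Z p) (W p)|
      ≤ g.length p (X p) * ∑ i, |g.inner p (g.curvature (e i) Y Z p) (W p)| := by
  have hf : ∀ i, ContMDiff 𝓘(ℝ, E) 𝓘(ℝ, ℝ) ∞ (g.pairing X (e i)) :=
    fun i => g.contMDiff_pairing hX (he i)
  have e1 : X =ᶠ[𝓝 p] fun q => ∑ i, (g.pairing X (e i) • e i) q := by
    filter_upwards [hon] with q hq
    exact g.eq_sum_of_orthonormal hq (S := ⊤) (fun i => trivial)
      (by rw [finrank_top, hn]; rfl) trivial
  rw [g.curvature_congr_left hX (SmoothField.sum _ fun i _ => (he i).smul (hf i)) hY hZ e1,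
    g.curvature_sum_left he hf hY hZ, map_sum, sum_apply, Finset.mul_sum]
  refine (Finset.abs_sum_le_sum_abs _ _).trans (Finset.sum_le_sum fun i _ => ?_)
  rw [map_smul, smul_apply, smul_eq_mul, abs_mul]
  have h1 : g.inner p (e i p) (e i p) = 1 := by simpa using hon.self_of_nhds i i
  exact mul_le_mul_of_nonneg_right (g.abs_inner_le_length h1) (abs_nonneg _)

/-- The curvature tensor is locally bounded. -/
theorem Metric.exists_abs_inner_curvature_le (p : M) : ∃ C : ℝ, 0 < C ∧ ∃ U ∈ 𝓝 p, ∀ q ∈ U,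
    ∀ X Y Z W : VField E M, SmoothField X → SmoothField Y → SmoothField Z → SmoothField W →
      |g.inner q (g.curvature X Y Z q) (W q)|
        ≤ C * (g.length q (X q) * g.length q (Y q) * g.length q (Z q) * g.length q (W q)) := by
  obtain ⟨e, he, hon⟩ := g.exists_frame p
  set Φ : M → ℝ := fun q => ∑ i, ∑ j, ∑ k, ∑ l,
    |g.inner q (g.curvature (e l) (e k) (e j) q) (e i q)| with hΦ
  have hΦc : Continuous Φ := continuous_finsetSum _ fun i _ => continuous_finsetSum _ fun j _ =>
    continuous_finsetSum _ fun k _ => continuous_finsetSum _ fun l _ =>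
      (g.contMDiff_pairing (g.smoothField_curvature (he l) (he k) (he j)) (he i)).continuous.abs
  have hΦ0 : ∀ q, 0 ≤ Φ q := fun q => Finset.sum_nonneg fun i _ => Finset.sum_nonneg fun j _ =>
    Finset.sum_nonneg fun k _ => Finset.sum_nonneg fun l _ => abs_nonneg _
  refine ⟨Φ p + 1, by linarith [hΦ0 p], {q | (∀ᶠ r in 𝓝 q, ∀ i j,
      g.inner r (e i r) (e j r) = if i = j then 1 else 0) ∧ Φ q < Φ p + 1},
    Filter.Eventually.and (eventually_eventually_nhds.2 hon)
      (hΦc.continuousAt.eventually_lt continuousAt_const (by linarith)), ?_⟩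
  rintro q ⟨hq, hqΦ⟩ X Y Z W hX hY hZ hW
  have hl : ∀ V : VField E M, 0 ≤ g.length q (V q) := fun V => Real.sqrt_nonneg _
  have b1 : ∀ {X Y Z W : VField E M}, SmoothField X → SmoothField Y → SmoothField Z →
      |g.inner q (g.curvature X Y Z q) (W q)|
        ≤ g.length q (X q) * ∑ i, |g.inner q (g.curvature (e i) Y Z q) (W q)| :=
    fun hX hY hZ => g.abs_inner_curvature_le_left rfl he hq hX hY hZ
  have sw : ∀ {X Y Z W : VField E M}, SmoothField X → SmoothField Y → SmoothField Z →
      |g.inner q (g.curvature X Y Z q) (W q)| = |g.inner q (g.curvature Y X Z q) (W q)| := by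
    intro X Y Z W hX hY hZ
    rw [g.curvature_swap hX hY hZ, map_neg, neg_apply, abs_neg]
  have key : |g.inner q (g.curvature X Y Z q) (W q)| ≤ g.length q (X q) * ∑ i,
      (g.length q (Y q) * ∑ j, (g.length q (Z q) * ∑ k, (g.length q (W q) *
        ∑ l, |g.inner q (g.curvature (e l) (e k) (e j) q) (e i q)|))) := by
    refine (b1 hX hY hZ).trans (mul_le_mul_of_nonneg_left (Finset.sum_le_sum fun i _ => ?_) (hl X))
    rw [sw (he i) hY hZ]
    refine (b1 hY (he i) hZ).trans
      (mul_le_mul_of_nonneg_left (Finset.sum_le_sum fun j _ => ?_) (hl Y))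
    rw [g.inner_curvature_pair_symm (he j) (he i) hZ hW]
    refine (b1 hZ hW (he j)).trans
      (mul_le_mul_of_nonneg_left (Finset.sum_le_sum fun k _ => ?_) (hl Z))
    rw [sw (he k) hW (he j)]
    exact b1 hW (he k) (he j)
  refine key.trans ?_
  have e2 : g.length q (X q) * ∑ i,
      (g.length q (Y q) * ∑ j, (g.length q (Z q) * ∑ k, (g.length q (W q) *
        ∑ l, |g.inner q (g.curvature (e l) (e k) (e j) q) (e i q)|)))
      = Φ q * (g.length q (X q) * g.length q (Y q) * g.length q (Z q) * g.length q (W q)) := by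
    simp only [hΦ, ← Finset.mul_sum]; ring
  rw [e2]
  exact mul_le_mul_of_nonneg_right hqΦ.le
    (mul_nonneg (mul_nonneg (mul_nonneg (hl X) (hl Y)) (hl Z)) (hl W))

end Curvature

/-! ### Non-negative curvature and totally geodesic fibers -/

section TotallyGeodesic

open VectorField

variable {E : Type*} [NormedAddCommGroup E] [NormedSpace ℝ E] [FiniteDimensional ℝ E]
  {M : Type*} [TopologicalSpace M] [T2Space M] [ChartedSpace E M] [IsManifold 𝓘(ℝ, E) ∞ M]
  {E' : Type*} [NormedAddCommGroup E'] [NormedSpace ℝ E'] [FiniteDimensional ℝ E']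
  {B : Type*} [TopologicalSpace B] [ChartedSpace E' B] [IsManifold 𝓘(ℝ, E') ∞ B]
  {π : M → B} {ℋ : HorizontalConnection E E' π} {b : Metric E' B} {g : Metric E M}
  {X Y Z ξ η : VField E M}
  (hπ : Manifold.IsSubmersion 𝓘(ℝ, E) 𝓘(ℝ, E') ∞ π) (hg : ℋ.IsAdapted b g)

theorem Metric.inner_curvature_quadratic (g : Metric E M) (hX : SmoothField X)
    (hY : SmoothField Y) (hξ : SmoothField ξ) (s : ℝ) (p : M) :
    g.inner p (g.curvature X (ξ + s • Y) (ξ + s • Y) p) (X p)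
      = g.inner p (g.curvature X ξ ξ p) (X p) + 2 * s * g.inner p (g.curvature X Y ξ p) (X p)
        + s ^ 2 * g.inner p (g.curvature X Y Y p) (X p) := by
  have hZ : SmoothField (ξ + s • Y) := hξ.add (hY.const_smul s)
  have lin : ∀ V : VField E M, SmoothField V →
      g.inner p (g.curvature (ξ + s • Y) X V p) (X p)
        = g.inner p (g.curvature ξ X V p) (X p) + s * g.inner p (g.curvature Y X V p) (X p) := by
    intro V hV
    have h := g.curvature_smul_left (f := fun _ => s) contMDiff_const hY hX hV p
    rw [g.curvature_add_left hξ (hY.const_smul s) hX hV,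
      show s • Y = (fun _ : M => s) • Y from rfl, h]
    simp
  have sw : ∀ V W : VField E M, SmoothField V → SmoothField W →
      g.inner p (g.curvature X V W p) (X p) = - g.inner p (g.curvature V X W p) (X p) := by
    intro V W hV hW
    rw [g.curvature_swap hX hV hW]; simp
  rw [sw _ _ hZ hZ, lin _ hZ, g.inner_curvature_pair_symm hξ hX hZ hX,
    g.inner_curvature_pair_symm hY hX hZ hX, lin _ hξ, lin _ hY, sw _ _ hξ hξ, sw _ _ hY hξ,
    sw _ _ hY hY, g.inner_curvature_pair_symm hξ hX hY hX]
  ring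

namespace HorizontalConnection

include hπ hg

theorem IsAdapted.tensorA_self {p : M} {a : TangentSpace 𝓘(ℝ, E) p} (ha : a ∈ ℋ.hor p) :
    ℋ.tensorA p a a = 0 := by
  have h := hg.tensorA_swap hπ ha ha
  have h2 : (2 : ℝ) • ℋ.tensorA p a a = 0 := by
    rw [two_smul]; nth_rewrite 1 [h]; simp
  exact (smul_eq_zero.1 h2).resolve_left two_ne_zero

theorem IsAdapted.inner_nabla_self (hX : SmoothField X) (hξ : SmoothField ξ)
    (hXh : ℋ.IsHorizontal X) (hξv : ∀ q, ξ q ∈ vert E E' π q) (p : M) :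
    g.inner p (g.nabla X ξ p) (X p) = 0 := by
  rw [hg.inner_nabla_vert hπ hX hX hξ hXh hXh hξv, hg.tensorA_self hπ (hXh p)]
  simp

variable (htg : TotallyGeodesicFibers E' π g)
include htg

theorem IsAdapted.nabla_vert_mem_hor (hX : SmoothField X) (hξ : SmoothField ξ)
    (hXh : ℋ.IsHorizontal X) (hξv : ∀ q, ξ q ∈ vert E E' π q) (p : M) :
    g.nabla ξ X p ∈ ℋ.hor p := by
  have h0 : ℋ.verProj p (g.nabla ξ X p) = 0 := by
    refine g.ext_inner_mem (ℋ.verProj_mem _) (Submodule.zero_mem _) fun v hv => ?_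
    obtain ⟨η, hη, hηv, rfl⟩ := hg.exists_vertical_apply_eq hπ hv
    have h := g.dirD_pairing hξ hX hη p
    have e1 : g.pairing X η = fun _ => 0 := by ext q; exact hg.inner_hor_vert (hXh q) (hηv q)
    rw [e1, dirD_const, hg.inner_hor_vert (hXh p) (htg ξ η hξ hη hξv hηv p)] at h
    rw [hg.inner_verProj _ hv]
    simp only [map_zero, zero_apply]
    linarith
  have h1 := ℋ.horProj_add_verProj (g.nabla ξ X p)
  rw [h0, add_zero] at h1
  rw [← h1]
  exact ℋ.horProj_mem _

/-- The vertizontal curvatures `⟨R(X, ξ)ξ, X⟩` for totally geodesic fibers. -/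
theorem IsAdapted.inner_curvature_vertizontal (hX : SmoothField X) (hξ : SmoothField ξ)
    (hXh : ℋ.IsHorizontal X) (hξv : ∀ q, ξ q ∈ vert E E' π q) (p : M) :
    g.inner p (g.curvature X ξ ξ p) (X p)
      = g.inner p (ℋ.dualA g p (X p) (ξ p)) (ℋ.dualA g p (X p) (ξ p)) := by
  have : CompleteSpace E := FiniteDimensional.complete ℝ E
  have hXξ := g.smoothField_nabla hX hξ
  have h1 := hg.inner_nabla_self hπ hX (g.smoothField_nabla hξ hξ) hXh
    (htg ξ ξ hξ hξ hξv hξv) p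
  have h2 := g.dirD_pairing hξ hXξ hX p
  have e2 : g.pairing (g.nabla X ξ) X = fun _ => 0 :=
    funext fun q => hg.inner_nabla_self hπ hX hξ hXh hξv q
  rw [e2, dirD_const] at h2
  have hN := hg.nabla_vert_mem_hor hπ htg hX hξ hXh hξv p
  set N := g.nabla ξ X p with hNdef
  have hd := hg.dualA_mem hπ (hXh p) (ξ p)
  set d := ℋ.dualA g p (X p) (ξ p) with hddef
  -- `∇_X ξ` has horizontal part `-d`, and `[X, ξ]` has horizontal part `-d - N`
  have h3 : g.inner p (g.nabla X ξ p) N = - g.inner p d N := by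
    rw [← hg.inner_horProj _ hN, hg.horProj_nabla_vert hπ hX hξ hXh hξv]
    simp [hddef]
  obtain ⟨L, hL, hLh, hLp⟩ := ℋ.exists_horizontal_apply_eq
    (ℋ.horProj_mem (mlieBracket 𝓘(ℝ, E) X ξ p))
  obtain ⟨V, hV, hVv, hVp⟩ := hg.exists_vertical_apply_eq hπ
    (ℋ.verProj_mem (mlieBracket 𝓘(ℝ, E) X ξ p))
  have h4 : g.nabla (mlieBracket 𝓘(ℝ, E) X ξ) ξ p = g.nabla L ξ p + g.nabla V ξ p := by
    rw [← g.nabla_add_left hL hV hξ]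
    refine g.nabla_congr_left (hX.mlieBracket hξ) (hL.add hV) hξ ?_
    rw [Pi.add_apply, hLp, hVp, ℋ.horProj_add_verProj]
  have h5 : g.inner p (g.nabla V ξ p) (X p) = 0 :=
    hg.inner_vert_hor (htg V ξ hV hξ hVv hξv p) (hXh p)
  have hLp' : L p = - d - N := by
    rw [hLp, ← g.nabla_sub_nabla hX hξ, map_sub, hg.horProj_nabla_vert hπ hX hξ hXh hξv,
      horProj_of_mem hN]
  have h6 : g.inner p (g.nabla L ξ p) (X p) = - g.inner p d d - g.inner p d N := by
    rw [hg.inner_nabla_vert hπ hL hX hξ hLh hXh hξv, hg.tensorA_swap hπ (hLh p) (hXh p), map_neg,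
      neg_apply, neg_neg, ← hg.inner_dualA hπ (hXh p) (hLh p), hLp', map_sub, map_neg]
  simp only [Metric.curvature, map_sub, sub_apply, h4, map_add, add_apply]
  linarith

/-- For totally geodesic fibers, `⟨R(X, Y)ξ, X⟩` is the expression defining weak
non-negativity. -/
theorem IsAdapted.inner_curvature_mixed (hX : SmoothField X) (hY : SmoothField Y)
    (hξ : SmoothField ξ) (hXh : ℋ.IsHorizontal X) (hYh : ℋ.IsHorizontal Y)
    (hξv : ∀ q, ξ q ∈ vert E E' π q) (p : M) :
    g.inner p (g.curvature X Y ξ p) (X p)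
      = g.inner p (ℋ.covDualA g X ξ p + ℋ.dualA g p (X p) (ℋ.shape g X ξ p)) (Y p) := by
  have : CompleteSpace E := FiniteDimensional.complete ℝ E
  have hη : SmoothField (fun q => ℋ.tensorA q (X q) (Y q)) :=
    hg.smoothField_tensorA hπ hX hY hXh hYh
  rw [hg.inner_covDualA_add hπ hX hY hξ hXh hYh hξv]
  set η : VField E M := fun q => ℋ.tensorA q (X q) (Y q) with hηdef
  have hηv : ∀ q, η q ∈ vert E E' π q := fun q => ℋ.tensorA_mem _ _
  have hYξ := g.smoothField_nabla hY hξ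
  have hXξ := g.smoothField_nabla hX hξ
  have nv := fun {V : VField E M} (hV : SmoothField V) (hVh : ℋ.IsHorizontal V)
    {W : VField E M} (hW : SmoothField W) (hWh : ℋ.IsHorizontal W) =>
    hg.inner_nabla_vert hπ hV hW hξ hVh hWh hξv
  -- the first term
  have h1 := g.dirD_pairing hX hYξ hX p
  have e1 : g.pairing (g.nabla Y ξ) X = g.pairing η ξ := by
    ext q
    have := nv hY hYh hX hXh q
    rw [hg.tensorA_swap hπ (hYh q) (hXh q), map_neg, neg_apply, neg_neg] at this
    exact this
  have h1' := g.dirD_pairing hX hη hξ p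
  have hXX : g.nabla X X p ∈ ℋ.hor p := by
    have h := ℋ.horProj_add_verProj (g.nabla X X p)
    rw [hg.verProj_nabla_hor hπ hX hX hXh hXh, hg.tensorA_self hπ (hXh p), add_zero] at h
    rw [← h]; exact ℋ.horProj_mem _
  obtain ⟨H, hH, hHh, hHp⟩ := ℋ.exists_horizontal_apply_eq hXX
  have h1'' := nv hY hYh hH hHh p
  rw [hg.tensorA_swap hπ (hYh p) (hHh p)] at h1''
  -- the second term
  have h2 := g.dirD_pairing hY hXξ hX p
  have e2 : g.pairing (g.nabla X ξ) X = fun _ => 0 :=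
    funext fun q => hg.inner_nabla_self hπ hX hξ hXh hξv q
  obtain ⟨K, hK, hKh, hKp⟩ := ℋ.exists_horizontal_apply_eq (ℋ.horProj_mem (g.nabla Y X p))
  have hYX : g.nabla Y X p = K p - η p := by
    have h := ℋ.horProj_add_verProj (g.nabla Y X p)
    rw [hg.verProj_nabla_hor hπ hY hX hYh hXh, hg.tensorA_swap hπ (hYh p) (hXh p), ← hKp,
      ← sub_eq_add_neg] at h
    exact h.symm
  have h2' := nv hX hXh hK hKh p
  rw [e1, h1'] at h1
  rw [e2, dirD_const, hYX, map_sub, h2'] at h2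
  -- the third term
  obtain ⟨J, hJ, hJh, hJp⟩ := ℋ.exists_horizontal_apply_eq (ℋ.horProj_mem (g.nabla X Y p))
  have hXY : g.nabla X Y p = J p + η p := by
    have h := ℋ.horProj_add_verProj (g.nabla X Y p)
    rw [hg.verProj_nabla_hor hπ hX hY hXh hYh, ← hJp] at h
    exact h.symm
  have h4 : g.nabla (mlieBracket 𝓘(ℝ, E) X Y) ξ p
      = g.nabla J ξ p + g.nabla (-K) ξ p + (g.nabla η ξ p + g.nabla η ξ p) := by
    rw [← g.nabla_add_left hJ hK.neg hξ, ← g.nabla_add_left hη hη hξ,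
      ← g.nabla_add_left (hJ.add hK.neg) (hη.add hη) hξ]
    refine g.nabla_congr_left (hX.mlieBracket hY) ((hJ.add hK.neg).add (hη.add hη)) hξ ?_
    rw [← g.nabla_sub_nabla hX hY, hXY, hYX]
    simp only [Pi.add_apply, Pi.neg_apply]
    abel
  have h5 := nv hJ hJh hX hXh p
  rw [hg.tensorA_swap hπ (hJh p) (hXh p)] at h5
  have h6 := nv hK hKh hX hXh p
  rw [hg.tensorA_swap hπ (hKh p) (hXh p)] at h6
  have h7 : g.inner p (g.nabla η ξ p) (X p) = 0 :=
    hg.inner_vert_hor (htg η ξ hη hξ hηv hξv p) (hXh p)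
  -- the bracket `[X, η]`
  have h8 := congrArg (fun v => g.inner p v (ξ p)) (g.nabla_sub_nabla hX hη p)
  have h9 : g.inner p (g.nabla η X p) (ξ p) = 0 :=
    hg.inner_hor_vert (hg.nabla_vert_mem_hor hπ htg hX hη hXh hηv p) (hξv p)
  rw [← hJp, ← hHp, horProj_of_mem (hHh p)]
  rw [← hHp, h1'', g.symm p (η p)] at h1
  simp only [Metric.curvature, map_sub, sub_apply, h4, map_add, add_apply, map_neg, neg_apply,
    g.nabla_neg_left hK hξ, hg.inner_verProj _ (hξv p)] at h1 h2 h5 h6 h8 ⊢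
  linarith

/-- Non-negativity of the curvatures of the planes spanned by `X` and `ξ + sY` for all `s` bounds
the mixed term `⟨R(X, Y)ξ, X⟩` by the square root of `|A^*_X ξ|² ⟨R(X, Y)Y, X⟩`. -/
theorem IsAdapted.isWNN_of_nonnegSectional (hsec : g.NonnegSectional) : ℋ.IsWNN g := by
  intro p
  obtain ⟨C, hC, U, hU, hbd⟩ := g.exists_abs_inner_curvature_le p
  refine ⟨U, hU, Real.sqrt C, Real.sqrt_pos.2 hC, fun X ξ hX hξ hXh hξv q hq => ?_⟩
  have hd := hg.dualA_mem hπ (hXh q) (ξ q)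
  obtain ⟨Y, hY, hYh, hYq⟩ := ℋ.exists_horizontal_apply_eq hd
  have hlen : ∀ v : TangentSpace 𝓘(ℝ, E) q, g.length q v ^ 2 = g.inner q v v :=
    fun v => Real.sq_sqrt (g.inner_self_nonneg v)
  have hl0 : ∀ v : TangentSpace 𝓘(ℝ, E) q, 0 ≤ g.length q v := fun v => Real.sqrt_nonneg _
  rw [← hYq, ← hg.inner_curvature_mixed hπ htg hX hY hξ hXh hYh hξv]
  by_cases h0 : X q = 0 ∨ ξ q = 0
  · have hY0 : Y q = 0 := by
      rw [hYq]
      refine hg.dualA_eq hπ (hXh q) (Submodule.zero_mem _) fun c hc => ?_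
      rcases h0 with h0 | h0
      · have := hg.tensorA_smul_left hπ 0 hc (hXh q)
        rw [zero_smul, zero_smul] at this
        rw [h0, this]; simp
      · rw [h0]; simp
    rw [g.inner_curvature_swap_right hX hY hξ hX,
      ← neg_neg (g.inner q (g.curvature X Y X q) (ξ q)), hY0]
    have h := hbd q hq X Y X ξ hX hY hX hξ
    simp only [hY0, Metric.length, map_zero, Real.sqrt_zero, mul_zero, zero_mul] at h ⊢
    rw [abs_nonpos_iff.1 h]; simp
  push Not at h0
  have hK : ∀ s : ℝ, 0 ≤ g.inner q (g.curvature X Y Y q) (X q) * (s * s)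
      + (2 * g.inner q (g.curvature X Y ξ q) (X q)) * s + g.inner q (Y q) (Y q) := by
    intro s
    have hli : LinearIndependent ℝ ![X q, (ξ + s • Y) q] := by
      rw [LinearIndependent.pair_iff]
      intro a c hac
      have h1 := congrArg (ℋ.verProj q) hac
      simp only [Pi.add_apply, Pi.smul_apply, map_add, map_smul, verProj_of_mem_hor (hXh q),
        verProj_of_mem_hor (hYh q), ℋ.verProj_of_mem (hξv q), smul_zero, add_zero, zero_add,
        map_zero] at h1
      have hc := (smul_eq_zero.1 h1).resolve_right h0.2
      rw [hc, zero_smul, add_zero] at hac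
      exact ⟨(smul_eq_zero.1 hac).resolve_right h0.1, hc⟩
    have h1 := hsec X (ξ + s • Y) hX (hξ.add (hY.const_smul s)) q hli
    have hpos := g.pairing_sub_sq_pos hli
    have h2 := mul_nonneg h1 hpos.le
    rw [Metric.sectional, div_mul_cancel₀ _ hpos.ne'] at h2
    rw [g.inner_curvature_quadratic hX hY hξ, hg.inner_curvature_vertizontal hπ htg hX hξ hXh hξv,
      ← hYq] at h2
    linarith
  have hdisc := discrim_le_zero hK
  simp only [discrim] at hdisc
  have hYY := (le_abs_self _).trans (hbd q hq X Y Y X hX hY hY hX)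
  refine (le_abs_self _).trans (abs_le_of_sq_le_sq ?_ ?_)
  · have hs := Real.sq_sqrt hC.le
    have h1 : (Real.sqrt C * g.length q (X q) * g.length q (Y q) ^ 2) ^ 2
        = (C * (g.length q (X q) * g.length q (Y q) * g.length q (Y q) * g.length q (X q)))
          * g.inner q (Y q) (Y q) := by
      rw [← hlen (Y q), mul_pow, mul_pow, hs]; ring
    rw [h1]
    have h2 := mul_le_mul_of_nonneg_right hYY (g.inner_self_nonneg (Y q))
    linarith
  · exact mul_nonneg (mul_nonneg (Real.sqrt_nonneg _) (hl0 _)) (sq_nonneg _)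

end HorizontalConnection
end TotallyGeodesic

/-! ### Functions on an interval -/

section Interval

open Filter Set

theorem eventually_neg_nhds_zero {P : ℝ → Prop} (h : ∀ᶠ t in 𝓝 (0 : ℝ), P t) :
    ∀ᶠ t in 𝓝 (0 : ℝ), P (-t) := by
  have h1 : Tendsto (fun t : ℝ => -t) (𝓝 0) (𝓝 0) := by
    simpa using (continuous_neg.tendsto (0 : ℝ))
  exact h1.eventually h

theorem exists_Ioo_of_eventually {P : ℝ → Prop} (h : ∀ᶠ t in 𝓝 (0 : ℝ), P t) :
    ∃ δ > 0, ∀ t ∈ Ioo (-δ) δ, P t := by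
  obtain ⟨δ, hδ, H⟩ := Metric.eventually_nhds_iff.1 h
  exact ⟨δ, hδ, fun t ht => H (by rw [Real.dist_eq, sub_zero, abs_lt]; exact ht)⟩

theorem eventually_eq_zero_of_abs_deriv_le {f f' : ℝ → ℝ} {K : ℝ}
    (hf : ∀ᶠ t in 𝓝 0, HasDerivAt f (f' t) t) (h0 : f 0 = 0)
    (hb : ∀ᶠ t in 𝓝 0, |f' t| ≤ K * |f t|) : ∀ᶠ t in 𝓝 0, f t = 0 := by
  have right : ∀ {f f' : ℝ → ℝ}, (∀ᶠ t in 𝓝 0, HasDerivAt f (f' t) t) → f 0 = 0 →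
      (∀ᶠ t in 𝓝 0, |f' t| ≤ K * |f t|) → ∀ᶠ t in 𝓝 0, 0 ≤ t → f t = 0 := by
    intro f f' hf h0 hb
    obtain ⟨δ, hδ, H⟩ := exists_Ioo_of_eventually (hf.and hb)
    filter_upwards [Ioo_mem_nhds (neg_lt_zero.2 hδ) hδ] with t ht ht0
    have hsub : ∀ s ∈ Icc 0 t, s ∈ Ioo (-δ) δ := fun s hs =>
      ⟨by linarith [hs.1], by linarith [hs.2, ht.2]⟩
    refine eq_zero_of_abs_deriv_le_mul_abs_self_of_eq_zero_right (K := K)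
      (fun s hs => (H s (hsub s hs)).1.continuousAt.continuousWithinAt)
      (fun s hs => (H s (hsub s ⟨hs.1, hs.2.le⟩)).1.hasDerivWithinAt) h0
      (fun s hs => (H s (hsub s ⟨hs.1, hs.2.le⟩)).2) t ⟨ht0, le_rfl⟩
  have h1 := right hf h0 hb
  have h2 := right (f := fun t => f (-t)) (f' := fun t => - f' (-t))
    (by
      filter_upwards [eventually_neg_nhds_zero hf] with t ht
      have h : HasDerivAt (f ∘ Neg.neg) _ t := HasDerivAt.scomp t ht (hasDerivAt_neg t)
      simpa [Function.comp_def] using h)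
    (by simpa using h0)
    (by
      filter_upwards [eventually_neg_nhds_zero hb] with t ht
      simpa using ht)
  filter_upwards [h1, eventually_neg_nhds_zero h2] with t ht ht'
  rcases le_total 0 t with h | h
  · exact ht h
  · simpa using ht' (by linarith)

theorem not_isLocalMax_of_hasDerivAt_pos {f f' : ℝ → ℝ} {a : ℝ}
    (hf : ∀ᶠ t in 𝓝 0, HasDerivAt f (f' t) t) (hf' : HasDerivAt f' a 0) (ha : 0 < a) :
    ¬ IsLocalMax f 0 := by
  intro hmax
  have hd : deriv f =ᶠ[𝓝 0] f' := hf.mono fun t ht => ht.deriv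
  have hdd : deriv (deriv f) 0 = a := by rw [hd.deriv_eq, hf'.deriv]
  have hmin : IsLocalMin f 0 := isLocalMin_of_deriv_deriv_pos (by rw [hdd]; exact ha)
    hmax.deriv_eq_zero hf.self_of_nhds.continuousAt
  have hconst : f =ᶠ[𝓝 0] fun _ => f 0 := by
    filter_upwards [hmax, hmin] with t h1 h2
    exact le_antisymm h1 h2
  have h1 : deriv f =ᶠ[𝓝 0] fun _ => 0 := by
    filter_upwards [hconst.deriv] with t ht
    rw [ht]; simp
  rw [h1.deriv_eq] at hdd
  simp at hdd
  exact ha.ne hdd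

/-- A real function attains its maximum if its values along every ultrafilter converge to one of
its values. -/
theorem exists_forall_le_of_ultrafilter {T : Type*} [Nonempty T] (f : T → ℝ)
    (h : ∀ 𝒰 : Ultrafilter T, ∃ t, Tendsto f 𝒰 (𝓝 (f t))) : ∃ t, ∀ s, f s ≤ f t := by
  have hne : NeBot (⨅ s, 𝓟 {t | f s ≤ f t}) := by
    refine iInf_neBot_of_directed ?_ fun s => principal_neBot_iff.2 ⟨s, le_refl (f s)⟩
    intro s s'
    rcases le_total (f s) (f s') with hs | hs
    · exact ⟨s', principal_mono.2 fun t ht => hs.trans ht, le_rfl⟩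
    · exact ⟨s, le_rfl, principal_mono.2 fun t ht => hs.trans ht⟩
  obtain ⟨t, ht⟩ := h (Ultrafilter.of (⨅ s, 𝓟 {t | f s ≤ f t}))
  refine ⟨t, fun s => ge_of_tendsto ht ?_⟩
  exact Ultrafilter.of_le _ (mem_iInf_of_mem s (mem_principal_self _))

end Interval

/-! ### Vertical fields along horizontal geodesics -/

section Core

open VectorField Filter

variable {E : Type*} [NormedAddCommGroup E] [NormedSpace ℝ E] [FiniteDimensional ℝ E]
  {M : Type*} [TopologicalSpace M] [T2Space M] [ChartedSpace E M] [IsManifold 𝓘(ℝ, E) ∞ M]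
  {E' : Type*} [NormedAddCommGroup E'] [NormedSpace ℝ E'] [FiniteDimensional ℝ E']
  {B : Type*} [TopologicalSpace B] [ChartedSpace E' B] [IsManifold 𝓘(ℝ, E') ∞ B]
  {π : M → B} {ℋ : HorizontalConnection E E' π} {b : Metric E' B} {g : Metric E M}
  {X Y Z ξ η : VField E M}
  (hπ : Manifold.IsSubmersion 𝓘(ℝ, E) 𝓘(ℝ, E') ∞ π) (hg : ℋ.IsAdapted b g)

/-- The curve `c` has velocity `X (c t)` at the time `t`. -/
def HasVelocityAt (X : VField E M) (c : ℝ → M) (t : ℝ) : Prop :=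
  HasMFDerivAt 𝓘(ℝ, ℝ) 𝓘(ℝ, E) c t ((1 : ℝ →L[ℝ] ℝ).smulRight (X (c t)))

theorem HasVelocityAt.hasDerivAt {F : Type*} [NormedAddCommGroup F] [NormedSpace ℝ F]
    {f : M → F} {c : ℝ → M} {t : ℝ} (hc : HasVelocityAt X c t)
    (hf : MDifferentiableAt 𝓘(ℝ, E) 𝓘(ℝ, F) f (c t)) :
    HasDerivAt (fun s => f (c s)) (dirD X f (c t)) t := by
  let L : ℝ →L[ℝ] F := (mvfderiv 𝓘(ℝ, E) f (c t)).comp ((1 : ℝ →L[ℝ] ℝ).smulRight (X (c t)))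
  have h : HasFDerivAt (f ∘ c) L t := (hf.hasMFDerivAt.comp t hc).hasFDerivAt
  have e : L 1 = dirD X f (c t) := by simp [L, dirD]
  rw [← e]
  exact h.hasDerivAt

namespace HorizontalConnection

include hπ hg

/-- Where `∇_X X = 0` and `(∇_X ξ)^v = S_X ξ`, the expression defining weak non-negativity is the
derivative of `A^*_X ξ`. -/
theorem IsAdapted.covDualA_add_eq (hXh : ℋ.IsHorizontal X) {q : M} (hXX : g.nabla X X q = 0)
    (hS : ℋ.verProj q (g.nabla X ξ q) = ℋ.shape g X ξ q) :
    ℋ.covDualA g X ξ q + ℋ.dualA g q (X q) (ℋ.shape g X ξ q)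
      = g.nabla X (fun r => ℋ.dualA g r (X r) (ξ r)) q := by
  have h0 : ℋ.dualA g q (0 : TangentSpace 𝓘(ℝ, E) q) (ξ q) = 0 := by
    have h := hg.dualA_smul_left hπ (hXh q) 0 (ξ q)
    rwa [zero_smul, zero_smul] at h
  simp only [covDualA]
  rw [hXX, map_zero, h0, hS]
  abel

/-- Along a curve on which `∇_X X = 0` and `(∇_X ξ)^v = S_X ξ`, weak non-negativity for `X` and
`-X` gives a linear differential inequality for `|A^*_X ξ|²`, so that `A^*_X ξ` vanishes if it
does at one point. -/
theorem IsAdapted.dualA_eq_zero_along (hwnn : ℋ.IsWNN g) (hX : SmoothField X)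
    (hξ : SmoothField ξ) (hXh : ℋ.IsHorizontal X) (hξv : ∀ q, ξ q ∈ vert E E' π q) {c : ℝ → M}
    (hc : ∀ᶠ t in 𝓝 0, HasVelocityAt X c t) (hXX : ∀ᶠ t in 𝓝 0, g.nabla X X (c t) = 0)
    (hS : ∀ᶠ t in 𝓝 0, ℋ.verProj (c t) (g.nabla X ξ (c t)) = ℋ.shape g X ξ (c t))
    (h0 : ℋ.dualA g (c 0) (X (c 0)) (ξ (c 0)) = 0) :
    ∀ᶠ t in 𝓝 0, ℋ.dualA g (c t) (X (c t)) (ξ (c t)) = 0 := by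
  set D : VField E M := fun r => ℋ.dualA g r (X r) (ξ r) with hD
  have hDs : SmoothField D := hg.smoothField_dualA hπ hX hξ hXh
  have hcont : ContinuousAt c 0 := (hc.self_of_nhds).continuousAt
  obtain ⟨U, hU, τ, hτ, H⟩ := hwnn (c 0)
  have hlenc : Continuous fun q => g.length q (X q) :=
    (g.contMDiff_pairing hX hX).continuous.sqrt
  set L := g.length (c 0) (X (c 0)) + 1 with hL
  have hlen : ∀ᶠ t in 𝓝 0, g.length (c t) (X (c t)) < L :=
    (hlenc.continuousAt.comp hcont).eventually_lt continuousAt_const (by simp [hL])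
  have hnn : ∀ q (v : TangentSpace 𝓘(ℝ, E) q), g.length q v ^ 2 = g.inner q v v :=
    fun q v => Real.sq_sqrt (g.inner_self_nonneg v)
  have hder : ∀ᶠ t in 𝓝 0, HasDerivAt (fun s => g.pairing D D (c s))
      (2 * g.inner (c t) (g.nabla X D (c t)) (D (c t))) t := by
    filter_upwards [hc] with t ht
    have h := ht.hasDerivAt (g.mdifferentiable_pairing hDs hDs (c t))
    rw [g.dirD_pairing hX hDs hDs, g.symm _ (D (c t)), ← two_mul] at h
    exact h
  have hbd : ∀ᶠ t in 𝓝 0, |2 * g.inner (c t) (g.nabla X D (c t)) (D (c t))|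
      ≤ (2 * (τ * L)) * |g.pairing D D (c t)| := by
    filter_upwards [hXX, hS, hlen, hcont hU] with t h1 h2 h3 h4
    have hXn : ℋ.IsHorizontal (-X) := fun q => Submodule.neg_mem _ (hXh q)
    have k1 := H X ξ hX hξ hXh hξv (c t) h4
    have k2 := H (-X) ξ hX.neg hξ hXn hξv (c t) h4
    have e1 : ∀ q, ℋ.dualA g q ((-X) q) (ξ q) = - D q := fun q => by
      have := hg.dualA_smul_left hπ (hXh q) (-1) (ξ q)
      simpa using this
    have e2 : g.nabla (-X) (-X) (c t) = 0 := by
      rw [g.nabla_neg_left hX hX.neg, g.nabla_neg_right hX hX, neg_neg, h1]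
    have e3 : ℋ.verProj (c t) (g.nabla (-X) ξ (c t)) = ℋ.shape g (-X) ξ (c t) := by
      simp only [shape] at h2 ⊢
      rw [g.nabla_neg_left hX hξ, g.nabla_neg_right hξ hX, map_neg, map_neg, h2]
    have e4 : g.nabla (-X) (fun r => ℋ.dualA g r ((-X) r) (ξ r)) (c t) = g.nabla X D (c t) := by
      rw [show (fun r => ℋ.dualA g r ((-X) r) (ξ r)) = -D from funext e1,
        g.nabla_neg_left hX hDs.neg, g.nabla_neg_right hX hDs, neg_neg]
    rw [hg.covDualA_add_eq hπ hXh h1 h2] at k1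
    rw [hg.covDualA_add_eq hπ hXn e2 e3, e4, e1] at k2
    have e5 : g.length (c t) ((-X) (c t)) = g.length (c t) (X (c t)) := by
      simp [Metric.length]
    rw [e5, hnn] at k2
    rw [hnn] at k1
    have hDD := g.inner_self_nonneg (D (c t))
    simp only [map_neg, neg_apply, neg_neg] at k2
    have k3 : |g.inner (c t) (g.nabla X D (c t)) (D (c t))|
        ≤ τ * g.length (c t) (X (c t)) * g.inner (c t) (D (c t)) (D (c t)) :=
      abs_le.2 ⟨by linarith, k1⟩
    have k4 : τ * g.length (c t) (X (c t)) * g.inner (c t) (D (c t)) (D (c t))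
        ≤ τ * L * g.inner (c t) (D (c t)) (D (c t)) :=
      mul_le_mul_of_nonneg_right (mul_le_mul_of_nonneg_left h3.le hτ.le) hDD
    have e6 : |g.pairing D D (c t)| = g.inner (c t) (D (c t)) (D (c t)) := abs_of_nonneg hDD
    rw [abs_mul, abs_two, e6]
    linarith
  have hzero := eventually_eq_zero_of_abs_deriv_le hder
    (show g.pairing D D (c 0) = 0 by simp [Metric.pairing, hD, h0]) hbd
  exact hzero.mono fun t ht => g.inner_self_eq_zero.1 ht

/-- In positive curvature, the length of a non-zero vertical field with `A^*_X ξ = 0` and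
`(∇_X ξ)^v = S_X ξ` along a horizontal geodesic does not have a maximum. -/
theorem IsAdapted.not_isLocalMax_pairing (hsec : g.PosSectional) (hX : SmoothField X)
    (hξ : SmoothField ξ) (hXh : ℋ.IsHorizontal X) (hξv : ∀ q, ξ q ∈ vert E E' π q) {c : ℝ → M}
    (hc : ∀ᶠ t in 𝓝 0, HasVelocityAt X c t) (hXX : g.nabla X X (c 0) = 0)
    (hS : ∀ᶠ t in 𝓝 0, ℋ.verProj (c t) (g.nabla X ξ (c t)) = ℋ.shape g X ξ (c t))
    (h0 : ℋ.dualA g (c 0) (X (c 0)) (ξ (c 0)) = 0) (hX0 : X (c 0) ≠ 0) (hξ0 : ξ (c 0) ≠ 0) :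
    ¬ IsLocalMax (fun t => g.pairing ξ ξ (c t)) 0 := by
  have : CompleteSpace E := FiniteDimensional.complete ℝ E
  have hXξ := g.smoothField_nabla hX hξ
  have hN := g.smoothField_nabla hξ hX
  set p := c 0 with hp
  -- the vertical part `s` of `∇_X ξ` and of `-∇_ξ X` at `c 0`
  obtain ⟨s, hs, hsv, hsp⟩ := hg.exists_vertical_apply_eq hπ (ℋ.verProj_mem (g.nabla X ξ p))
  have hsX : g.nabla X ξ p = s p := by
    rw [hsp, ← ℋ.horProj_add_verProj (g.nabla X ξ p), hg.horProj_nabla_vert hπ hX hξ hXh hξv, h0]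
    simp [ℋ.verProj_of_mem (ℋ.verProj_mem _)]
  have hS0 := hS.self_of_nhds
  have hNs : ℋ.verProj p (g.nabla ξ X p) = - s p := by
    rw [hsp, hS0, shape, neg_neg]
  obtain ⟨L, hL, hLh, hLp⟩ := ℋ.exists_horizontal_apply_eq (ℋ.horProj_mem (g.nabla ξ X p))
  have hNp : g.nabla ξ X p = L p - s p := by
    rw [hLp, ← ℋ.horProj_add_verProj (g.nabla ξ X p), hNs]
    simp [horProj_of_mem (ℋ.horProj_mem _), ℋ.horProj_of_mem_vert (hsv p), sub_eq_add_neg]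
  have hli : LinearIndependent ℝ ![X p, ξ p] := by
    rw [LinearIndependent.pair_iff]
    intro a d had
    have h1 := congrArg (ℋ.verProj p) had
    simp only [map_add, map_smul, verProj_of_mem_hor (hXh p), ℋ.verProj_of_mem (hξv p), smul_zero,
      zero_add, map_zero] at h1
    have hd := (smul_eq_zero.1 h1).resolve_right hξ0
    rw [hd, zero_smul, add_zero] at had
    exact ⟨(smul_eq_zero.1 had).resolve_right hX0, hd⟩
  have hK : 0 < g.inner p (g.curvature X ξ ξ p) (X p) := by
    have h1 := hsec X ξ hX hξ p hli
    have h2 := mul_pos h1 (g.pairing_sub_sq_pos hli)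
    rwa [Metric.sectional, div_mul_cancel₀ _ (g.pairing_sub_sq_pos hli).ne'] at h2
  rw [g.inner_curvature_pair_symm hX hξ hξ hX] at hK
  -- `⟨∇_ξ ∇_X X, ξ⟩ = 0`, as `∇_X X` is horizontal and vanishes at `c 0`
  have hXXh : g.pairing (g.nabla X X) ξ = fun _ => 0 := by
    ext q
    have h := hg.inner_nabla_hor hπ hX hX hξ hXh hXh hξv q
    rw [hg.tensorA_self hπ (hXh q), map_zero, zero_apply] at h
    exact h
  have hXXs := g.smoothField_nabla hX hX
  have t1 := g.dirD_pairing hξ hXXs hξ p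
  rw [hXXh, dirD_const, hXX] at t1
  simp only [map_zero, zero_apply, add_zero] at t1
  -- `⟨∇_X ∇_ξ X, ξ⟩`
  have t2 := g.dirD_pairing hX hN hξ p
  rw [hsX, hNp, map_sub, sub_apply, hg.inner_hor_vert (hLh p) (hsv p), zero_sub] at t2
  -- `⟨∇_{[ξ, X]} X, ξ⟩`
  have hbr : mlieBracket 𝓘(ℝ, E) ξ X p = L p + (-s p + -s p) := by
    rw [← g.nabla_sub_nabla hξ hX, hsX, hNp]; abel
  have t3 : g.nabla (mlieBracket 𝓘(ℝ, E) ξ X) X p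
      = g.nabla L X p + (- g.nabla s X p + - g.nabla s X p) := by
    rw [← g.nabla_neg_left hs hX, ← g.nabla_add_left hs.neg hs.neg hX,
      ← g.nabla_add_left hL (hs.neg.add hs.neg) hX]
    exact g.nabla_congr_left (hξ.mlieBracket hX) (hL.add (hs.neg.add hs.neg)) hX hbr
  have t4 : g.inner p (g.nabla L X p) (ξ p) = 0 := by
    rw [hg.inner_nabla_hor hπ hL hX hξ hLh hXh hξv, hg.tensorA_swap hπ (hLh p) (hXh p), map_neg,
      neg_apply, ← hg.inner_dualA hπ (hXh p) (hLh p), h0]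
    simp
  have t5 : g.inner p (g.nabla s X p) (ξ p) = - g.inner p (s p) (s p) := by
    rw [← hg.inner_nabla_vert_symm hπ hX hξ hs hXh hξv hsv, ← hg.inner_verProj (g.nabla ξ X p) (hsv p),
      hNs]
    simp only [map_neg, neg_apply]
  have hKe : g.inner p (g.curvature ξ X X p) (ξ p)
      = - dirD X (g.pairing (g.nabla ξ X) ξ) p - 3 * g.inner p (s p) (s p) := by
    simp only [Metric.curvature, map_sub, sub_apply, t3, map_add, add_apply, map_neg, neg_apply]
    linarith
  -- `⟨∇_ξ X, ξ⟩ = -½ X|ξ|²` along the curve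
  have hv : ∀ᶠ t in 𝓝 0, HasDerivAt (fun s => g.pairing ξ ξ (c s))
      (- 2 * g.pairing (g.nabla ξ X) ξ (c t)) t := by
    filter_upwards [hc, hS] with t ht hSt
    have h := ht.hasDerivAt (g.mdifferentiable_pairing hξ hξ (c t))
    rw [g.dirD_pairing hX hξ hξ, g.symm _ (ξ (c t)), ← hg.inner_verProj _ (hξv (c t)), hSt, shape,
      map_neg, neg_apply, hg.inner_verProj _ (hξv (c t))] at h
    refine h.congr_deriv ?_
    show _ = -2 * g.inner (c t) (g.nabla ξ X (c t)) (ξ (c t))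
    ring
  have hv' : HasDerivAt (fun t => - 2 * g.pairing (g.nabla ξ X) ξ (c t))
      (- 2 * dirD X (g.pairing (g.nabla ξ X) ξ) p) 0 :=
    (hc.self_of_nhds.hasDerivAt (g.mdifferentiable_pairing hN hξ p)).const_mul _
  refine not_isLocalMax_of_hasDerivAt_pos hv hv' ?_
  have := g.inner_self_nonneg (s p)
  linarith

/-- If `A^*_a` has no kernel for `a ≠ 0`, then `A_a` is onto. -/
theorem IsAdapted.isFat_of_dualA_ne_zero
    (h : ∀ p : M, ∀ a ∈ ℋ.hor p, a ≠ 0 → ∀ ξ ∈ vert E E' π p, ℋ.dualA g p a ξ = 0 → ξ = 0) :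
    ℋ.IsFat := by
  intro p a ha ha0
  obtain ⟨X, hX, hXh, hXp⟩ := ℋ.exists_horizontal_apply_eq ha
  have hc := (g.contMDiff_pairing hX hX).continuous
  refine ⟨{q | 0 < g.pairing X X q}, isOpen_lt continuous_const hc,
    by simpa [Metric.pairing, hXp] using g.pos p a ha0, X, hX.contMDiffOn, fun q _ => hXh q, hXp,
    fun q hq d hd => ?_⟩
  have hXq : X q ≠ 0 := fun h0 => by
    simp [Metric.pairing, h0] at hq
  -- the image of `A_X` on horizontal vectors
  let S : Submodule ℝ (TangentSpace 𝓘(ℝ, E) q) :=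
    { carrier := {v | ∃ y ∈ ℋ.hor q, ℋ.tensorA q (X q) y = v}
      add_mem' := by
        rintro _ _ ⟨y, hy, rfl⟩ ⟨z, hz, rfl⟩
        exact ⟨y + z, Submodule.add_mem _ hy hz, hg.tensorA_add_right hπ (hXh q) hy hz⟩
      zero_mem' := ⟨0, Submodule.zero_mem _, by
        have h := hg.tensorA_smul_right hπ 0 (hXh q) (Submodule.zero_mem (ℋ.hor q))
        rwa [zero_smul, zero_smul] at h⟩
      smul_mem' := by
        rintro r _ ⟨y, hy, rfl⟩
        exact ⟨r • y, Submodule.smul_mem _ _ hy, hg.tensorA_smul_right hπ r (hXh q) hy⟩ }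
  have hSv : ∀ v ∈ S, v ∈ vert E E' π q := by
    rintro _ ⟨y, -, rfl⟩; exact ℋ.tensorA_mem _ _
  obtain ⟨s, hs, hsφ⟩ := g.exists_inner_eq S ((g.inner q d).toLinearMap ∘ₗ S.subtype)
  have hds : d - s = 0 := by
    refine h q (X q) (hXh q) hXq _ (Submodule.sub_mem _ hd (hSv s hs)) ?_
    refine hg.dualA_eq hπ (hXh q) (Submodule.zero_mem _) fun y hy => ?_
    have h1 : g.inner q s (ℋ.tensorA q (X q) y) = g.inner q d (ℋ.tensorA q (X q) y) :=
      hsφ ⟨_, y, hy, rfl⟩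
    rw [g.symm q _ (d - s)]
    simp [h1]
  obtain ⟨y, hy, hys⟩ := hs
  obtain ⟨Y, hY, hYh, hYq⟩ := ℋ.exists_horizontal_apply_eq (Submodule.smul_mem _ (1 / 2 : ℝ) hy)
  refine ⟨Y, hY.contMDiffOn, fun r _ => hYh r, ?_⟩
  have h2 := hg.tensorA_eq hπ hX hY hXh hYh q
  rw [hYq, hg.tensorA_smul_right hπ _ (hXh q) hy, hys, ← sub_eq_zero.1 hds] at h2
  exact (smul_right_injective _ (by norm_num : (1 / 2 : ℝ) ≠ 0) h2).symm

end HorizontalConnection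

end Core

/-! ### Geodesics in a chart -/

section Geodesic

variable {E' : Type*} [NormedAddCommGroup E'] [NormedSpace ℝ E'] [FiniteDimensional ℝ E']
  {β : E' → E' →L[ℝ] E' →L[ℝ] ℝ} {T : Set E'}

/-- The functional `c ↦ ½ (D_c β)(w, w) - (D_w β)(w, c)`, which is `β (x'', c)` for a geodesic `x`
with velocity `w`. -/
def geodesicForm (β : E' → E' →L[ℝ] E' →L[ℝ] ℝ) (z : E' × E') : E' →L[ℝ] ℝ :=
  (1 / 2 : ℝ) • ((fderiv ℝ β z.1).flip z.2).flip z.2 - fderiv ℝ β z.1 z.2 z.2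

theorem geodesicForm_apply (z : E' × E') (c : E') : geodesicForm β z c
    = 1 / 2 * fderiv ℝ β z.1 c z.2 z.2 - fderiv ℝ β z.1 z.2 z.2 c := by
  simp [geodesicForm]

set_option maxSynthPendingDepth 4 in
theorem contDiffOn_geodesicForm (hT : IsOpen T) (hβ : ContDiffOn ℝ ∞ β T) :
    ContDiffOn ℝ ∞ (geodesicForm β) (T ×ˢ Set.univ) := by
  have h1 : ContDiffOn ℝ ∞ (fun z : E' × E' => fderiv ℝ β z.1) (T ×ˢ Set.univ) :=
    (hβ.fderiv_of_isOpen hT (by simp)).comp contDiffOn_fst fun z hz => hz.1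
  have h2 : ContDiffOn ℝ ∞ (fun z : E' × E' => z.2) (T ×ˢ Set.univ) := contDiffOn_snd
  refine contDiffOn_clm_apply.2 fun c => ?_
  simp only [geodesicForm_apply]
  exact (contDiffOn_const.mul (((h1.clm_apply contDiffOn_const).clm_apply h2).clm_apply h2)).sub
    (((h1.clm_apply h2).clm_apply h2).clm_apply contDiffOn_const)

theorem isInvertible_of_pos {B : E' →L[ℝ] E' →L[ℝ] ℝ} (h : ∀ u, u ≠ 0 → 0 < B u u) :
    B.IsInvertible := by
  have hinj : Function.Injective
      (ContinuousLinearMap.coeLM ℝ ∘ₗ B.toLinearMap : E' →ₗ[ℝ] Module.Dual ℝ E') := by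
    rw [injective_iff_map_eq_zero]
    intro a ha
    by_contra h0
    have h1 := h a h0
    have h2 := LinearMap.congr_fun ha a
    simp at h2
    linarith
  have hinj' : Function.Injective B.toLinearMap := fun x y hxy => hinj (by
    simp only [LinearMap.comp_apply, hxy])
  have hfin : Module.finrank ℝ E' = Module.finrank ℝ (E' →L[ℝ] ℝ) := by
    rw [← (LinearMap.toContinuousLinearMap (𝕜 := ℝ) (E := E') (F' := ℝ)).finrank_eq]
    exact (Subspace.dual_finrank_eq (K := ℝ) (V := E')).symm
  exact ⟨(LinearEquiv.ofInjectiveOfFinrankEq B.toLinearMap hinj' hfin).toContinuousLinearEquiv,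
    by ext; rfl⟩

/-- Local existence of geodesics of a Riemannian metric `β` on an open subset of a vector space. -/
theorem exists_geodesic (hT : IsOpen T) (hβ : ContDiffOn ℝ ∞ β T)
    (hpos : ∀ y ∈ T, ∀ u, u ≠ 0 → 0 < β y u u) {y₀ : E'} (hy₀ : y₀ ∈ T) (w₀ : E') :
    ∃ ε : ℝ, 0 < ε ∧ ∃ x : ℝ → E', ContDiffOn ℝ ∞ x (Set.Ioo (-ε) ε) ∧
      (∀ t ∈ Set.Ioo (-ε) ε, x t ∈ T) ∧ x 0 = y₀ ∧ deriv x 0 = w₀ ∧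
      ∀ t ∈ Set.Ioo (-ε) ε, ∀ c, β (x t) (deriv (deriv x) t) c
        = 1 / 2 * fderiv ℝ β (x t) c (deriv x t) (deriv x t)
          - fderiv ℝ β (x t) (deriv x t) (deriv x t) c := by
  have : CompleteSpace E' := FiniteDimensional.complete ℝ E'
  let f : E' × E' → E' × E' := fun z => (z.2, (β z.1).inverse (geodesicForm β z))
  have hTu : IsOpen (T ×ˢ (Set.univ : Set E')) := hT.prod isOpen_univ
  have hf : ContDiffOn ℝ ∞ f (T ×ˢ Set.univ) := by
    refine contDiffOn_snd.prodMk (ContDiffOn.clm_apply ?_ (contDiffOn_geodesicForm hT hβ))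
    intro z hz
    obtain ⟨e, he⟩ := isInvertible_of_pos (hpos z.1 hz.1)
    have h1 : ContDiffAt ℝ ∞ ContinuousLinearMap.inverse (β z.1) := he ▸ contDiffAt_map_inverse e
    have h2 : ContDiffAt ℝ ∞ (fun z : E' × E' => β z.1) z :=
      (hβ.contDiffAt (hT.mem_nhds hz.1)).comp z contDiffAt_fst
    exact (h1.comp z h2).contDiffWithinAt
  have hz₀ : (y₀, w₀) ∈ T ×ˢ (Set.univ : Set E') := ⟨hy₀, trivial⟩
  obtain ⟨α, h0, ε, hε, hα⟩ := ((hf.contDiffAt (hTu.mem_nhds hz₀)).of_le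
    (by simp : (1 : WithTop ℕ∞) ≤ ∞)).exists_forall_mem_closedBall_exists_eq_forall_mem_Ioo_hasDerivAt₀ 0
  simp only [zero_sub, zero_add] at hα
  have hmem : ∀ᶠ t in 𝓝 (0 : ℝ), α t ∈ T ×ˢ (Set.univ : Set E') :=
    (hα 0 ⟨by linarith, hε⟩).continuousAt.eventually_mem (h0 ▸ hTu.mem_nhds hz₀)
  obtain ⟨δ, hδ, hδm⟩ := Metric.eventually_nhds_iff_ball.1 hmem
  set r := min ε δ / 2 with hr
  have hr0 : 0 < r := by have := lt_min hε hδ; positivity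
  have hrε : r < ε := by have := min_le_left ε δ; linarith
  have hrδ : r < δ := by have := min_le_right ε δ; linarith
  have hα' : ∀ t ∈ Set.Icc (-r) r, HasDerivAt α (f (α t)) t := fun t ht =>
    hα t ⟨by linarith [ht.1], by linarith [ht.2]⟩
  have hαm : ∀ t ∈ Set.Icc (-r) r, α t ∈ T ×ˢ (Set.univ : Set E') := fun t ht =>
    hδm t (by rw [Real.ball_eq_Ioo]; exact ⟨by linarith [ht.1], by linarith [ht.2]⟩)
  have hsm : ContDiffOn ℝ ∞ α (Set.Icc (-r) r) :=
    ODE.contDiffOn_enat_Icc_of_hasDerivWithinAt (n := ⊤) (f := fun _ => f) (u := T ×ˢ Set.univ)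
      (hf.comp contDiffOn_snd fun z hz => hz.2) (fun t ht => (hα' t ht).hasDerivWithinAt) hαm
  have hd1 : ∀ t ∈ Set.Icc (-r) r, HasDerivAt (fun s => (α s).1) (α t).2 t := fun t ht =>
    (hα' t ht).fst
  have hd2 : ∀ t ∈ Set.Ioo (-r) r, HasDerivAt (deriv fun s => (α s).1)
      ((β (α t).1).inverse (geodesicForm β (α t))) t := fun t ht => by
    have h := (hα' t (Set.Ioo_subset_Icc_self ht)).snd
    refine HasDerivAt.congr_of_eventuallyEq h ?_
    filter_upwards [isOpen_Ioo.mem_nhds ht] with s hs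
    exact (hd1 s (Set.Ioo_subset_Icc_self hs)).deriv
  have h0r : (0 : ℝ) ∈ Set.Icc (-r) r := ⟨by linarith, hr0.le⟩
  refine ⟨r, hr0, fun s => (α s).1, (hsm.mono Set.Ioo_subset_Icc_self).fst,
    fun t ht => (hαm t (Set.Ioo_subset_Icc_self ht)).1, by simp only [h0], by rw [(hd1 0 h0r).deriv, h0],
    fun t ht c => ?_⟩
  have ht' := Set.Ioo_subset_Icc_self ht
  rw [(hd2 t ht).deriv, (hd1 t ht').deriv, (isInvertible_of_pos (hpos _ (hαm t ht').1)).self_apply_inverse,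
    geodesicForm_apply]

/-- Near the time `0`, the geodesic with given initial velocity is a smooth curve which is defined
for all times: it is reparametrized away from `0`. -/
theorem exists_curve_geodesic_near_zero (hT : IsOpen T) (hβ : ContDiffOn ℝ ∞ β T)
    (hpos : ∀ y ∈ T, ∀ u, u ≠ 0 → 0 < β y u u) {y₀ : E'} (hy₀ : y₀ ∈ T) (w₀ : E') :
    ∃ x : ℝ → E', ContDiff ℝ ∞ x ∧ (∀ t, x t ∈ T) ∧ x 0 = y₀ ∧ deriv x 0 = w₀ ∧
      ∀ᶠ t in 𝓝 0, ∀ c, β (x t) (deriv (deriv x) t) c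
        = 1 / 2 * fderiv ℝ β (x t) c (deriv x t) (deriv x t)
          - fderiv ℝ β (x t) (deriv x t) (deriv x t) c := by
  obtain ⟨ε, hε, x, hx, hxT, h0, h0', hgeo⟩ := exists_geodesic hT hβ hpos hy₀ w₀
  let f : ContDiffBump (0 : ℝ) := ⟨ε / 3, 2 * ε / 3, by positivity, by linarith⟩
  let r : ℝ → ℝ := fun t => t * f t
  have hr : ContDiff ℝ ∞ r := contDiff_id.mul f.contDiff
  have hr1 : ∀ᶠ t in 𝓝 0, r t = t := by
    filter_upwards [f.eventuallyEq_one] with t ht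
    simp [r, ht]
  have hrm : ∀ t, r t ∈ Set.Ioo (-ε) ε := fun t => by
    rw [Set.mem_Ioo, ← abs_lt]
    rcases le_or_gt (2 * ε / 3) (dist t 0) with h | h
    · have : f t = 0 := f.zero_of_le_dist h
      simpa [r, this] using hε
    · rw [Real.dist_eq, sub_zero] at h
      have h1 : |r t| ≤ |t| := by
        rw [abs_mul, abs_of_nonneg f.nonneg]
        exact mul_le_of_le_one_right (abs_nonneg t) f.le_one
      linarith
  have e : (fun t => x (r t)) =ᶠ[𝓝 0] x := hr1.mono fun t ht => congrArg x ht
  refine ⟨fun t => x (r t), contDiffOn_univ.1 (hx.comp hr.contDiffOn fun t _ => hrm t),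
    fun t => hxT _ (hrm t), e.eq_of_nhds.trans h0, by rw [e.deriv_eq, h0'], ?_⟩
  filter_upwards [e, e.deriv, e.deriv.deriv, Ioo_mem_nhds (neg_lt_zero.2 hε) hε]
    with t h1 h2 h3 ht c
  simp only [h2, h3, h1]
  exact hgeo t ht c

omit [FiniteDimensional ℝ E'] in
/-- The parameter of a regular curve extends to a smooth function. -/
theorem exists_leftInverse_curve {x : ℝ → E'} (hx : ContDiff ℝ ∞ x) (h0 : deriv x 0 ≠ 0) :
    ∃ (τ : E' → ℝ) (N : Set E'), IsOpen N ∧ x 0 ∈ N ∧ ContDiffOn ℝ ∞ τ N ∧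
      (∀ y ∈ N, τ y ∈ Set.Ioo (-1 : ℝ) 1) ∧ ∀ᶠ t in 𝓝 0, τ (x t) = t := by
  obtain ⟨l, hl⟩ := SeparatingDual.exists_eq_one (R := ℝ) h0
  let s : ℝ → ℝ := fun t => l (x t)
  have hs : ContDiff ℝ ∞ s := l.contDiff.comp hx
  have hd : ∀ t, HasDerivAt s (l (deriv x t)) t := fun t =>
    l.hasFDerivAt.comp_hasDerivAt t (hx.differentiable (by simp) t).hasDerivAt
  have hd0 : HasFDerivAt s ((ContinuousLinearEquiv.refl ℝ ℝ : ℝ ≃L[ℝ] ℝ) : ℝ →L[ℝ] ℝ) 0 := by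
    have h := hd 0
    rw [hl] at h
    exact h.hasFDerivAt.congr_fderiv (by ext; simp)
  let Φ := (hs.contDiffAt (x := 0)).toOpenPartialHomeomorph s hd0 (by simp)
  have hΦ0 : (0 : ℝ) ∈ Φ.source :=
    (hs.contDiffAt (x := 0)).mem_toOpenPartialHomeomorph_source hd0 (by simp)
  have hΦ : ∀ t, Φ t = s t := fun t => rfl
  have hcd : Continuous fun t => l (deriv x t) :=
    l.continuous.comp (hx.continuous_deriv (by simp))
  let P : Set ℝ := {t | l (deriv x t) ≠ 0} ∩ Set.Ioo (-1) 1
  have hP : IsOpen P := (isOpen_ne_fun hcd continuous_const).inter isOpen_Ioo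
  have h0P : (0 : ℝ) ∈ P := ⟨by simp [hl], by norm_num⟩
  have hN : IsOpen (Φ.target ∩ Φ.symm ⁻¹' P) := Φ.isOpen_inter_preimage_symm hP
  refine ⟨fun y => Φ.symm (l y), l ⁻¹' (Φ.target ∩ Φ.symm ⁻¹' P), hN.preimage l.continuous,
    ⟨Φ.map_source hΦ0, ?_⟩, fun y hy => ?_, fun y hy => hy.2.2, ?_⟩
  · rw [Set.mem_preimage, show l (x 0) = Φ 0 from rfl, Φ.left_inv hΦ0]
    exact h0P
  · have h1 : ContDiffAt ℝ ∞ Φ.symm (l y) :=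
      Φ.contDiffAt_symm_deriv hy.2.1 hy.1 (hd _) hs.contDiffAt
    exact (h1.comp y l.contDiff.contDiffAt).contDiffWithinAt
  · filter_upwards [Φ.open_source.mem_nhds hΦ0] with t ht
    exact Φ.left_inv ht

end Geodesic

/-! ### Basic horizontal fields and vertical gradients -/

section Basic

open VectorField

variable {E : Type*} [NormedAddCommGroup E] [NormedSpace ℝ E] [FiniteDimensional ℝ E]
  {M : Type*} [TopologicalSpace M] [T2Space M] [ChartedSpace E M] [IsManifold 𝓘(ℝ, E) ∞ M]
  {E' : Type*} [NormedAddCommGroup E'] [NormedSpace ℝ E'] [FiniteDimensional ℝ E']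
  {B : Type*} [TopologicalSpace B] [ChartedSpace E' B] [IsManifold 𝓘(ℝ, E') ∞ B]
  {π : M → B} {ℋ : HorizontalConnection E E' π} {b : Metric E' B} {g : Metric E M}
  {X Y ξ : VField E M} (hπ : Manifold.IsSubmersion 𝓘(ℝ, E) 𝓘(ℝ, E') ∞ π)
  (hg : ℋ.IsAdapted b g) {x : B} {p q : M} {w : E' → E'}

include hπ

theorem isOpen_baseDomain_inter_preimage (x : B) {N : Set E'} (hN : IsOpen N) :
    IsOpen (baseDomain E' π x ∩ baseCoord E' π x ⁻¹' N) :=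
  (contMDiffOn_baseCoord hπ x).continuousOn.isOpen_inter_preimage (isOpen_baseDomain hπ x) hN

theorem dirD_inChart (b : Metric E' B) (hq : q ∈ baseDomain E' π x) :
    dirD X (fun r => b.inChart x (π r)) q
      = fderiv ℝ (fun y => b.inChart x ((extChartAt 𝓘(ℝ, E') x).symm y)) (baseCoord E' π x q)
        (dirD X (baseCoord E' π x) q) := by
  have hU := isOpen_baseDomain hπ x
  have hqs : π q ∈ (extChartAt 𝓘(ℝ, E') x).source := hq
  have h1 : DifferentiableAt ℝ (fun y => b.inChart x ((extChartAt 𝓘(ℝ, E') x).symm y))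
      (baseCoord E' π x q) :=
    ((b.contDiffOn_inChart_symm x).contDiffAt ((isOpen_extChartAt_target x).mem_nhds
      ((extChartAt 𝓘(ℝ, E') x).map_source hqs))).differentiableAt (by simp)
  refine Eq.trans ?_ (dirD_comp (F' := E' →L[ℝ] E' →L[ℝ] ℝ) (X := X)
    (k := fun y => b.inChart x ((extChartAt 𝓘(ℝ, E') x).symm y)) (ψ := baseCoord E' π x) h1
    (((contMDiffOn_baseCoord hπ x).contMDiffAt (hU.mem_nhds hq)).mdifferentiableAt (by simp)))
  refine dirD_congr ?_
  filter_upwards [hU.mem_nhds hq] with r hr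
  have hr' : π r ∈ (extChartAt 𝓘(ℝ, E') x).source := hr
  rw [baseCoord, (extChartAt 𝓘(ℝ, E') x).left_inv hr']

namespace HorizontalConnection

theorem exists_dirD_baseCoord_eq (ℋ : HorizontalConnection E E' π) (hq : q ∈ baseDomain E' π x)
    (u : E') :
    ∃ A : VField E M, A q ∈ ℋ.hor q ∧ dirD A (baseCoord E' π x) q = u := by
  have := isManifold_one (E' := E') (B := B)
  have h5 := isInvertible_mfderiv_extChartAt (I := 𝓘(ℝ, E')) (x := x) (y := π q) hq
  obtain ⟨v, hv⟩ := h5.surjective u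
  obtain ⟨v, rfl⟩ := surjective_mfderiv_of_isSubmersion hπ q v
  obtain ⟨V, -, hV⟩ := exists_smoothField_apply_eq v
  refine ⟨fun r => ℋ.horProj r (V r), ℋ.horProj_mem _, ?_⟩
  rw [dirD_baseCoord_horProj hπ hq, dirD_baseCoord hπ hq, hV]
  exact hv

include hg

theorem IsAdapted.eq_of_dirD_baseCoord_eq (hXh : X q ∈ ℋ.hor q) (hYh : Y q ∈ ℋ.hor q)
    (hq : q ∈ baseDomain E' π x)
    (h : dirD X (baseCoord E' π x) q = dirD Y (baseCoord E' π x) q) : X q = Y q := by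
  refine g.ext_inner_mem hXh hYh fun v hv => ?_
  obtain ⟨Z, -, -, rfl⟩ := ℋ.exists_horizontal_apply_eq hv
  rw [← hg.inChart_dirD hπ hXh hv hq, ← hg.inChart_dirD hπ hYh hv hq, h]

/-- The horizontal lift of a vector field of the base, given in a chart. -/
theorem IsAdapted.exists_horizontal_lift (hp : p ∈ baseDomain E' π x) {N : Set E'} (hN : IsOpen N)
    (hpN : baseCoord E' π x p ∈ N) (hw : ContDiffOn ℝ ∞ w N) :
    ∃ X : VField E M, SmoothField X ∧ ℋ.IsHorizontal X ∧
      ∀ᶠ q in 𝓝 p, dirD X (baseCoord E' π x) q = w (baseCoord E' π x q) := by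
  obtain ⟨e, he, heh, hon⟩ := ℋ.exists_horizontal_frame g hπ p
  have hU := isOpen_baseDomain hπ x
  have hψ := contMDiffOn_baseCoord hπ x
  have hO := isOpen_baseDomain_inter_preimage hπ x hN
  have hpO : p ∈ baseDomain E' π x ∩ baseCoord E' π x ⁻¹' N := ⟨hp, hpN⟩
  have hm : ∀ j, ContMDiffOn 𝓘(ℝ, E) 𝓘(ℝ, ℝ) ∞ (fun q => b.inChart x (π q)
      (w (baseCoord E' π x q)) (dirD (e j) (baseCoord E' π x) q))
      (baseDomain E' π x ∩ baseCoord E' π x ⁻¹' N) := fun j =>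
    ((((contMDiffOn_inChart_comp hπ b x).mono Set.inter_subset_left).clm_apply
      ((contMDiffOn_iff_contDiffOn.2 hw).comp (hψ.mono Set.inter_subset_left) fun q hq => hq.2)).clm_apply
      ((contMDiffOn_dirD hU hψ (he j).contMDiffOn).mono Set.inter_subset_left))
  choose m hms hme using fun j => exists_contMDiff_eventuallyEq hO hpO (hm j)
  refine ⟨fun q => ∑ j, (m j • e j) q, SmoothField.sum _ fun j _ => (he j).smul (hms j),
    fun q => Submodule.sum_mem _ fun j _ => Submodule.smul_mem _ _ (heh j q), ?_⟩
  filter_upwards [hon, hO.mem_nhds hpO, Filter.eventually_all.2 hme] with q h1 h2 h3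
  obtain ⟨A, hA, hAw⟩ := ℋ.exists_dirD_baseCoord_eq hπ h2.1 (w (baseCoord E' π x q))
  rw [← hAw]
  refine dirD_congr_left _ ?_
  conv_rhs => rw [g.eq_sum_of_orthonormal h1 (fun i => heh i q) (finrank_hor hπ q) hA]
  refine Finset.sum_congr rfl fun j _ => ?_
  rw [Pi.smul_apply', h3 j, ← hAw, hg.inChart_dirD hπ hA (heh j q) h2.1]

theorem IsAdapted.exists_vertical_gradient {O : Set M} (hO : IsOpen O) (hp : p ∈ O) {φ : M → ℝ}
    (hφ : ContMDiffOn 𝓘(ℝ, E) 𝓘(ℝ, ℝ) ∞ φ O) :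
    ∃ ξ : VField E M, SmoothField ξ ∧ (∀ q, ξ q ∈ vert E E' π q) ∧
      ∀ᶠ q in 𝓝 p, ∀ v ∈ vert E E' π q, g.inner q (ξ q) v = mvfderiv 𝓘(ℝ, E) φ q v := by
  obtain ⟨φ', h1, h2⟩ := exists_contMDiff_eventuallyEq hO hp hφ
  obtain ⟨e, he, hev, hon⟩ := hg.exists_vertical_frame hπ p
  refine ⟨fun q => ∑ j, (dirD (e j) φ' • e j) q,
    SmoothField.sum _ fun j _ => (he j).smul (contMDiff_dirD h1 (he j)),
    fun q => Submodule.sum_mem _ fun j _ => Submodule.smul_mem _ _ (hev j q), ?_⟩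
  filter_upwards [hon, h2.eventuallyEq_nhds] with q h3 h4 v hv
  obtain ⟨V, -, rfl⟩ := exists_smoothField_apply_eq v
  conv_rhs => rw [g.eq_sum_of_orthonormal h3 (fun i => hev i q) (finrank_vert ℋ hπ q) hv]
  rw [map_sum, map_sum, FunLike.coe_sum, Finset.sum_apply]
  refine Finset.sum_congr rfl fun j _ => ?_
  rw [Pi.smul_apply', map_smul, map_smul, dirD_congr h4, g.symm q (V q)]
  simp only [smul_apply, smul_eq_mul, dirD]
  ring

/-- For horizontal fields, the horizontal part of `∇_X X` is computed in a chart of the base: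
it vanishes if the base curve satisfies the geodesic equation. -/
theorem IsAdapted.nabla_self_eq_zero (hX : SmoothField X) (hXh : ℋ.IsHorizontal X)
    (hq : q ∈ baseDomain E' π x)
    (h : ∀ c, b.inChart x (π q) (dirD X (dirD X (baseCoord E' π x)) q) c
      = geodesicForm (fun y => b.inChart x ((extChartAt 𝓘(ℝ, E') x).symm y))
        (baseCoord E' π x q, dirD X (baseCoord E' π x) q) c) :
    g.nabla X X q = 0 := by
  have : CompleteSpace E := FiniteDimensional.complete ℝ E
  have hU := isOpen_baseDomain hπ x
  have hψ := contMDiffOn_baseCoord hπ x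
  have hv : ℋ.verProj q (g.nabla X X q) = 0 := by
    rw [hg.verProj_nabla_hor hπ hX hX hXh hXh, hg.tensorA_self hπ (hXh q)]
  rw [← ℋ.horProj_add_verProj (g.nabla X X q), hv, add_zero]
  refine g.ext_inner_mem (ℋ.horProj_mem _) (Submodule.zero_mem _) fun v hvh => ?_
  obtain ⟨Y, hY, hYh, rfl⟩ := ℋ.exists_horizontal_apply_eq hvh
  rw [hg.inner_horProj _ hvh]
  have k := g.nabla_spec hX hX hY q
  have kb : g.inner q (mlieBracket 𝓘(ℝ, E) X Y q) (X q) = b.inChart x (π q)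
      (dirD X (dirD Y (baseCoord E' π x)) q - dirD Y (dirD X (baseCoord E' π x)) q)
      (dirD X (baseCoord E' π x) q) := by
    rw [← hg.inner_horProj _ (hXh q), ← dirD_mlieBracket hU hq hψ hX hY,
      ← dirD_baseCoord_horProj (ℋ := ℋ) hπ hq]
    exact (hg.inChart_dirD hπ (X := fun r => ℋ.horProj r (mlieBracket 𝓘(ℝ, E) X Y r))
      (ℋ.horProj_mem _) (hXh q) hq).symm
  have sy : ∀ u v, b.inChart x (π q) u v = b.inChart x (π q) v u := fun u v => b.symm _ _ _
  have hc := h (dirD Y (baseCoord E' π x) q)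
  rw [geodesicForm_apply] at hc
  dsimp only at hc
  rw [← dirD_inChart hπ b hq, ← dirD_inChart hπ b hq] at hc
  rw [g.koszul_eq, hg.dirD_pairing_hor hπ hX hY hXh hYh hq, hg.dirD_pairing_hor hπ hX hX hXh hXh hq,
    kb, mlieBracket_self, hc, sy (dirD X (baseCoord E' π x) q) (dirD Y (dirD X _) q),
    sy (dirD X (baseCoord E' π x) q) (dirD X (dirD Y _) q)] at k
  simp only [map_sub, sub_apply, Pi.zero_apply, map_zero, zero_apply] at k ⊢
  linarith

/-- If `ξ` is the vertical gradient of `φ`, `X` is basic and the derivative of `X φ` along the fiber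
vanishes, then `(∇_X ξ)^v = S_X ξ`. -/
theorem IsAdapted.verProj_nabla_eq_shape (hX : SmoothField X) (hξ : SmoothField ξ)
    (hXh : ℋ.IsHorizontal X) (hξv : ∀ r, ξ r ∈ vert E E' π r) (hq : q ∈ baseDomain E' π x)
    (hXw : dirD X (baseCoord E' π x) =ᶠ[𝓝 q] fun r => w (baseCoord E' π x r))
    (hw : DifferentiableAt ℝ w (baseCoord E' π x q)) {O : Set M} (hO : IsOpen O) (hqO : q ∈ O)
    {φ : M → ℝ} (hφ : ContMDiffOn 𝓘(ℝ, E) 𝓘(ℝ, ℝ) ∞ φ O)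
    (hgrad : ∀ᶠ r in 𝓝 q, ∀ v ∈ vert E E' π r, g.inner r (ξ r) v = mvfderiv 𝓘(ℝ, E) φ r v)
    (h0 : ∀ v ∈ vert E E' π q, mvfderiv 𝓘(ℝ, E) (dirD X φ) q v = 0) :
    ℋ.verProj q (g.nabla X ξ q) = ℋ.shape g X ξ q := by
  have : CompleteSpace E := FiniteDimensional.complete ℝ E
  have hU := isOpen_baseDomain hπ x
  have hψ := contMDiffOn_baseCoord hπ x
  refine g.ext_inner_mem (ℋ.verProj_mem _) (Submodule.neg_mem _ (ℋ.verProj_mem _)) fun v hv => ?_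
  obtain ⟨ν, hν, hνv, rfl⟩ := hg.exists_vertical_apply_eq hπ hv
  -- `[X, ν]` is vertical, as `X` is basic
  have hbr : mlieBracket 𝓘(ℝ, E) X ν q ∈ vert E E' π q := by
    rw [← dirD_baseCoord_eq_zero_iff (X := mlieBracket 𝓘(ℝ, E) X ν) hπ hq,
      dirD_mlieBracket hU hq hψ hX hν, dirD_congr hXw,
      dirD_comp hw ((hψ.contMDiffAt (hU.mem_nhds hq)).mdifferentiableAt (by simp)),
      (dirD_baseCoord_eq_zero_iff hπ hq).2 hv, map_zero, sub_zero]
    have : dirD ν (baseCoord E' π x) =ᶠ[𝓝 q] fun _ => 0 := by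
      filter_upwards [hU.mem_nhds hq] with r hr
      exact (dirD_baseCoord_eq_zero_iff hπ hr).2 (hνv r)
    rw [dirD_congr this, dirD_const]
  have h1 := g.dirD_pairing hX hξ hν q
  have h2 : g.pairing ξ ν =ᶠ[𝓝 q] dirD ν φ := by
    filter_upwards [hgrad] with r hr
    exact hr _ (hνv r)
  have h3 := dirD_mlieBracket hO hqO hφ hX hν
  have h4 : dirD ν (dirD X φ) q = 0 := h0 _ hv
  have h5 : dirD (mlieBracket 𝓘(ℝ, E) X ν) φ q = g.inner q (ξ q) (mlieBracket 𝓘(ℝ, E) X ν q) :=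
    (hgrad.self_of_nhds _ hbr).symm
  rw [dirD_congr h2] at h1
  rw [h4, sub_zero, h5, ← g.nabla_sub_nabla hX hν, map_sub, h1] at h3
  rw [shape, map_neg, neg_apply, hg.inner_verProj _ hv, hg.inner_verProj _ hv,
    hg.inner_nabla_vert_symm hπ hX hξ hν hXh hξv hνv, g.symm q _ (ξ q)]
  linarith

end HorizontalConnection

end Basic

/-! ### Bundles with structure group -/

section Bundle

variable {E : Type u} [NormedAddCommGroup E] [NormedSpace ℝ E] [FiniteDimensional ℝ E]
  {M : Type v} [TopologicalSpace M] [T2Space M] [ChartedSpace E M] [IsManifold 𝓘(ℝ, E) ∞ M]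
  {E' : Type w} [NormedAddCommGroup E'] [NormedSpace ℝ E'] [FiniteDimensional ℝ E']
  {B : Type x} [TopologicalSpace B] [ChartedSpace E' B] [IsManifold 𝓘(ℝ, E') ∞ B]
  {π : M → B} {ℋ : HorizontalConnection E E' π} {b : Metric E' B} {g : Metric E M}
  {d k : ℕ} {G : Type} [TopologicalSpace G] [ChartedSpace (EuclideanSpace ℝ (Fin d)) G] [Group G]
  {F : Type v} [TopologicalSpace F] [ChartedSpace (EuclideanSpace ℝ (Fin k)) F]
  [MulAction G F]
  {W : Type*} [NormedAddCommGroup W] [NormedSpace ℝ W] {κ : F → W} {i j : B} {y : M}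

namespace GBundleStructure

/-- The map of the fiber through `y` to the vector space `W` that is given by a map `κ : F → W`
and the coordinate with index `i`, shifted by `h ∈ G`. -/
def fiberMap (Φ : GBundleStructure ℋ (d := d) (k := k) G F) (κ : F → W) (i : B) (h : G) (y : M) :
    W :=
  κ (h • Φ.coord i y)

/-- On the vertical space at `p`, the form `g(ξ, ·)` is the differential of the composition of the
linear form `c` with `fiberMap κ i h`. -/
def IsDual (Φ : GBundleStructure ℋ (d := d) (k := k) G F) (g : Metric E M) (κ : F → W) (i : B)
    (p : M) (ξ : TangentSpace 𝓘(ℝ, E) p) (h : G) (c : W →L[ℝ] ℝ) : Prop :=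
  ∀ v ∈ vert E E' π p, g.inner p ξ v = c (mvfderiv 𝓘(ℝ, E) (Φ.fiberMap κ i h) p v)

variable (Φ : GBundleStructure ℋ (d := d) (k := k) G F)

theorem coord_eq_smul (hi : π y ∈ Φ.U i) (hj : π y ∈ Φ.U j) :
    Φ.coord j y = Φ.trans i j (π y) • Φ.coord i y := by
  have h := Φ.triv_eq i j (π y) ⟨hi, hj⟩ (Φ.coord i y)
  rw [Φ.triv_coord i y hi] at h
  rw [← Φ.coord_triv j (π y) hj (Φ.trans i j (π y) • Φ.coord i y), ← h]

theorem fiberMap_eq (κ : F → W) (h : G) (hi : π y ∈ Φ.U i) (hj : π y ∈ Φ.U j) :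
    Φ.fiberMap κ i h y = Φ.fiberMap κ j (h * Φ.trans j i (π y)) y := by
  rw [fiberMap, fiberMap, mul_smul, ← Φ.coord_eq_smul hj hi]

variable (hπ : Manifold.IsSubmersion 𝓘(ℝ, E) 𝓘(ℝ, E') ∞ π)

include hπ

theorem isOpen_preimage_U (i : B) : IsOpen (π ⁻¹' Φ.U i) :=
  (Φ.isOpen_U i).preimage hπ.contMDiff.continuous

theorem hasMFDerivAt_coord (hy : π y ∈ Φ.U i) :
    HasMFDerivAt 𝓘(ℝ, E) (𝓡 k) (Φ.coord i) y (mfderiv 𝓘(ℝ, E) (𝓡 k) (Φ.coord i) y) :=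
  (((Φ.smooth_coord i).contMDiffAt ((Φ.isOpen_preimage_U hπ i).mem_nhds hy)).mdifferentiableAt
    (by simp)).hasMFDerivAt

/-- The retraction `z ↦ triv i (π y) (coord i z)` onto the fiber through `y` has a differential at
`y` which is the identity on vertical vectors. -/
theorem exists_hasMFDerivAt_retraction (hy : π y ∈ Φ.U i) :
    ∃ D : E →L[ℝ] E, HasMFDerivAt 𝓘(ℝ, E) 𝓘(ℝ, E) (fun z => Φ.triv i (π y) (Φ.coord i z)) y D ∧
      ∀ v ∈ vert E E' π y, D v = v := by
  have hT := ((Φ.smooth_triv i).contMDiffAt (x := (π y, Φ.coord i y))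
    (((Φ.isOpen_U i).prod isOpen_univ).mem_nhds ⟨hy, trivial⟩)).mdifferentiableAt (by simp)
  have hc := Φ.hasMFDerivAt_coord hπ hy
  have hA := (mdifferentiableAt_submersion hπ y).hasMFDerivAt.prodMk hc
  have hC := (hasMFDerivAt_const (I := 𝓘(ℝ, E)) (I' := 𝓘(ℝ, E')) (π y) y).prodMk hc
  have h1 := HasMFDerivAt.comp (g := fun z : B × F => Φ.triv i z.1 z.2) y hT.hasMFDerivAt hA
  have h2 := HasMFDerivAt.comp (g := fun z : B × F => Φ.triv i z.1 z.2) y hT.hasMFDerivAt hC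
  have h3 : HasMFDerivAt 𝓘(ℝ, E) 𝓘(ℝ, E) ((fun z : B × F => Φ.triv i z.1 z.2) ∘
      fun z => (π z, Φ.coord i z)) y (ContinuousLinearMap.id ℝ E) := by
    refine (hasMFDerivAt_id y).congr_of_eventuallyEq ?_
    filter_upwards [(Φ.isOpen_preimage_U hπ i).mem_nhds hy] with z hz
    exact Φ.triv_coord i z hz
  have h4 := hasMFDerivAt_unique h1 h3
  refine ⟨_, h2, fun v hv => ?_⟩
  have h5 := DFunLike.congr_fun h4 v
  refine Eq.trans ?_ h5
  refine congrArg (mfderiv (𝓘(ℝ, E').prod (𝓡 k)) 𝓘(ℝ, E) (fun z : B × F => Φ.triv i z.1 z.2)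
    (π y, Φ.coord i y)) ?_
  exact Prod.ext (mem_vert.1 hv).symm rfl

/-- Functions which agree on the fiber through `y` have the same derivative along it. -/
theorem mvfderiv_eq_of_eq_on_fiber (hy : π y ∈ Φ.U i) {f₁ f₂ : M → W}
    (h₁ : MDifferentiableAt 𝓘(ℝ, E) 𝓘(ℝ, W) f₁ y) (h₂ : MDifferentiableAt 𝓘(ℝ, E) 𝓘(ℝ, W) f₂ y)
    (h : ∀ᶠ z in 𝓝 y, π z = π y → f₁ z = f₂ z) {v : TangentSpace 𝓘(ℝ, E) y}
    (hv : v ∈ vert E E' π y) : mvfderiv 𝓘(ℝ, E) f₁ y v = mvfderiv 𝓘(ℝ, E) f₂ y v := by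
  obtain ⟨D, hD, hDv⟩ := Φ.exists_hasMFDerivAt_retraction hπ hy
  have e := Φ.triv_coord i y hy
  have comp : ∀ {f : M → W}, MDifferentiableAt 𝓘(ℝ, E) 𝓘(ℝ, W) f y →
      HasMFDerivAt 𝓘(ℝ, E) 𝓘(ℝ, W) (f ∘ fun z => Φ.triv i (π y) (Φ.coord i z)) y
        ((mfderiv 𝓘(ℝ, E) 𝓘(ℝ, W) f y : E →L[ℝ] W).comp D) := fun {f} hf =>
    HasMFDerivAt.comp y (by rw [e]; exact hf.hasMFDerivAt) hD
  have k1 := comp h₁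
  have k2 := comp h₂
  have k3 : (f₁ ∘ fun z => Φ.triv i (π y) (Φ.coord i z)) =ᶠ[𝓝 y]
      (f₂ ∘ fun z => Φ.triv i (π y) (Φ.coord i z)) := by
    have hc : Filter.Tendsto (fun z => Φ.triv i (π y) (Φ.coord i z)) (𝓝 y) (𝓝 y) := by
      have := hD.continuousAt
      rwa [ContinuousAt, e] at this
    filter_upwards [hc.eventually h] with z hz
    exact hz (Φ.proj_triv i _ hy _)
  have k4 := DFunLike.congr_fun (hasMFDerivAt_unique k1 (k2.congr_of_eventuallyEq k3)) v
  have k5 : mfderiv 𝓘(ℝ, E) 𝓘(ℝ, W) f₁ y (D v) = mfderiv 𝓘(ℝ, E) 𝓘(ℝ, W) f₂ y (D v) := k4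
  rw [hDv v hv] at k5
  exact k5

variable [IsManifold (𝓡 k) ∞ F] [LieGroup (𝓡 d) ∞ G] [ContMDiffSMul (𝓡 d) (𝓡 k) ∞ G F]
  (hκ : ContMDiff (𝓡 k) 𝓘(ℝ, W) ∞ κ)
include hκ

omit hπ in
theorem contMDiffOn_fiberMap_prod (i : B) :
    ContMDiffOn ((𝓡 d).prod 𝓘(ℝ, E)) 𝓘(ℝ, W) ∞ (fun z : G × M => Φ.fiberMap κ i z.1 z.2)
      (Set.univ ×ˢ (π ⁻¹' Φ.U i)) :=
  hκ.comp_contMDiffOn ((contMDiff_smul (I := 𝓡 d) (I' := 𝓡 k) (n := ∞) (G := G)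
    (M := F)).comp_contMDiffOn (contMDiffOn_fst.prodMk
      ((Φ.smooth_coord i).comp contMDiffOn_snd fun _ h => h.2)))

theorem contMDiffOn_fiberMap (i : B) (h : G) :
    ContMDiffOn 𝓘(ℝ, E) 𝓘(ℝ, W) ∞ (Φ.fiberMap κ i h) (π ⁻¹' Φ.U i) :=
  (Φ.contMDiffOn_fiberMap_prod hκ i).comp (contMDiffOn_const.prodMk contMDiffOn_id)
    fun _ hz => ⟨trivial, hz⟩

theorem mdifferentiableAt_fiberMap (h : G) (hy : π y ∈ Φ.U i) :
    MDifferentiableAt 𝓘(ℝ, E) 𝓘(ℝ, W) (Φ.fiberMap κ i h) y :=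
  ((Φ.contMDiffOn_fiberMap hπ hκ i h).contMDiffAt
    ((Φ.isOpen_preimage_U hπ i).mem_nhds hy)).mdifferentiableAt (by simp)

theorem mvfderiv_fiberMap_eq (h : G) (hi : π y ∈ Φ.U i) (hj : π y ∈ Φ.U j)
    {v : TangentSpace 𝓘(ℝ, E) y} (hv : v ∈ vert E E' π y) :
    mvfderiv 𝓘(ℝ, E) (Φ.fiberMap κ i h) y v
      = mvfderiv 𝓘(ℝ, E) (Φ.fiberMap κ j (h * Φ.trans j i (π y))) y v := by
  refine Φ.mvfderiv_eq_of_eq_on_fiber hπ hi (Φ.mdifferentiableAt_fiberMap hπ hκ h hi)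
    (Φ.mdifferentiableAt_fiberMap hπ hκ _ hj) (Filter.Eventually.of_forall fun z hz => ?_) hv
  rw [← hz]
  exact Φ.fiberMap_eq κ h (hz ▸ hi) (hz ▸ hj)

omit hκ in
/-- If `κ` is the restriction to a fiber of an immersion of `M`, then `fiberMap κ i h` is an
immersion of the fibers. -/
theorem eq_zero_of_mvfderiv_fiberMap_eq_zero {f : M → W} (hf : ContMDiff 𝓘(ℝ, E) 𝓘(ℝ, W) ∞ f)
    (hinj : ∀ z, Function.Injective (mfderiv 𝓘(ℝ, E) 𝓘(ℝ, W) f z)) (i₀ : B)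
    (hκf : κ = fun z => f (Φ.triv i₀ i₀ z)) (h : G) (hy : π y ∈ Φ.U i)
    {v : TangentSpace 𝓘(ℝ, E) y} (hv : v ∈ vert E E' π y)
    (h0 : mvfderiv 𝓘(ℝ, E) (Φ.fiberMap κ i h) y v = 0) : v = 0 := by
  let m : M → M := fun z => Φ.triv i₀ i₀ (h • Φ.coord i z)
  let n : M → M := fun z => Φ.triv i (π y) (h⁻¹ • Φ.coord i₀ z)
  have hmem : ∀ z, π (m z) ∈ Φ.U i₀ := fun z => by
    rw [Φ.proj_triv i₀ i₀ (Φ.mem_U i₀)]; exact Φ.mem_U i₀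
  have hm : ContMDiffAt 𝓘(ℝ, E) 𝓘(ℝ, E) ∞ m y := by
    refine ContMDiffOn.contMDiffAt (s := π ⁻¹' Φ.U i) ?_ ((Φ.isOpen_preimage_U hπ i).mem_nhds hy)
    exact (Φ.smooth_triv i₀).comp (contMDiffOn_const.prodMk
      ((ContMDiffSMul.contMDiff_const_smul (I := 𝓡 d) h).comp_contMDiffOn (Φ.smooth_coord i)))
      fun z _ => ⟨Φ.mem_U i₀, trivial⟩
  have hn : ContMDiffAt 𝓘(ℝ, E) 𝓘(ℝ, E) ∞ n (m y) := by
    refine ContMDiffOn.contMDiffAt (s := π ⁻¹' Φ.U i₀) ?_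
      ((Φ.isOpen_preimage_U hπ i₀).mem_nhds (hmem y))
    exact (Φ.smooth_triv i).comp (contMDiffOn_const.prodMk
      ((ContMDiffSMul.contMDiff_const_smul (I := 𝓡 d) h⁻¹).comp_contMDiffOn (Φ.smooth_coord i₀)))
      fun z _ => ⟨hy, trivial⟩
  have hm' := (hm.mdifferentiableAt (by simp)).hasMFDerivAt
  have hn' := (hn.mdifferentiableAt (by simp)).hasMFDerivAt
  have hf' := (hf.mdifferentiableAt (by simp) (x := m y)).hasMFDerivAt
  have k1 : mvfderiv 𝓘(ℝ, E) (Φ.fiberMap κ i h) y v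
      = mfderiv 𝓘(ℝ, E) 𝓘(ℝ, W) f (m y) (mfderiv 𝓘(ℝ, E) 𝓘(ℝ, E) m y v) := by
    have e : Φ.fiberMap κ i h = f ∘ m := by ext z; simp only [fiberMap, hκf]; rfl
    rw [e]
    exact DFunLike.congr_fun (hf'.comp y hm').mfderiv v
  have k2 : mfderiv 𝓘(ℝ, E) 𝓘(ℝ, E) m y v = 0 := hinj _ (by
    rw [map_zero, ← k1, h0]; rfl)
  obtain ⟨D, hD, hDv⟩ := Φ.exists_hasMFDerivAt_retraction hπ hy
  have e : n ∘ m = fun z => Φ.triv i (π y) (Φ.coord i z) := by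
    ext z
    simp only [n, m, Function.comp_apply, Φ.coord_triv i₀ i₀ (Φ.mem_U i₀), inv_smul_smul]
  have k3 := hn'.comp y hm'
  rw [e] at k3
  have k4 := DFunLike.congr_fun (hasMFDerivAt_unique hD k3) v
  rw [← hDv v hv]
  refine k4.trans ?_
  refine Eq.trans (congrArg (mfderiv 𝓘(ℝ, E) 𝓘(ℝ, E) n (m y)) k2) (map_zero _)

end GBundleStructure

end Bundle

/-! ### Parallel vertical fields along horizontal geodesics -/

section Parallel

variable {E : Type u} [NormedAddCommGroup E] [NormedSpace ℝ E] [FiniteDimensional ℝ E]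
  {M : Type v} [TopologicalSpace M] [T2Space M] [ChartedSpace E M] [IsManifold 𝓘(ℝ, E) ∞ M]
  {E' : Type w} [NormedAddCommGroup E'] [NormedSpace ℝ E'] [FiniteDimensional ℝ E']
  {B : Type x} [TopologicalSpace B] [ChartedSpace E' B] [IsManifold 𝓘(ℝ, E') ∞ B]
  {π : M → B} {ℋ : HorizontalConnection E E' π} {b : Metric E' B} {g : Metric E M}

theorem Metric.inChart_pos (b : Metric E' B) {x z : B} (hz : z ∈ (extChartAt 𝓘(ℝ, E') x).source)
    {u : E'} (hu : u ≠ 0) : 0 < b.inChart x z u u := by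
  have := isManifold_one (E' := E') (B := B)
  have h5 := isInvertible_mfderiv_extChartAt (I := 𝓘(ℝ, E')) hz
  obtain ⟨a, rfl⟩ := h5.surjective u
  have ha : a ≠ 0 := by
    rintro rfl
    exact hu (map_zero _)
  exact (b.pos z a ha).trans_eq (b.inChart_mvfderiv hz a a).symm

variable (hπ : Manifold.IsSubmersion 𝓘(ℝ, E) 𝓘(ℝ, E') ∞ π) (hg : ℋ.IsAdapted b g)
include hπ hg

/-- A curve with horizontal velocity is tangent to the horizontal field `X` if its projection is
tangent to the projection of `X`. -/
theorem HorizontalConnection.IsAdapted.hasVelocityAt_of_horizontal {X : VField E M} {γ : ℝ → M}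
    {t : ℝ} {x : B} (hγ : MDifferentiableAt 𝓘(ℝ, ℝ) 𝓘(ℝ, E) γ t)
    (hγh : mfderiv 𝓘(ℝ, ℝ) 𝓘(ℝ, E) γ t (1 : ℝ) ∈ ℋ.hor (γ t)) (hXh : X (γ t) ∈ ℋ.hor (γ t))
    (ht : γ t ∈ baseDomain E' π x)
    (hd : HasDerivAt (fun s => baseCoord E' π x (γ s)) (dirD X (baseCoord E' π x) (γ t)) t) :
    HasVelocityAt X γ t := by
  obtain ⟨V, -, hV⟩ := exists_smoothField_apply_eq (mfderiv 𝓘(ℝ, ℝ) 𝓘(ℝ, E) γ t (1 : ℝ))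
  have h1 : HasVelocityAt V γ t := by
    have h := hγ.hasMFDerivAt
    have e : (mfderiv 𝓘(ℝ, ℝ) 𝓘(ℝ, E) γ t : ℝ →L[ℝ] E)
        = (1 : ℝ →L[ℝ] ℝ).smulRight (V (γ t) : E) := by
      refine ContinuousLinearMap.ext_ring ?_
      rw [hV]
      exact (one_smul ℝ (mfderiv 𝓘(ℝ, ℝ) 𝓘(ℝ, E) γ t (1 : ℝ) : E)).symm
    rw [HasVelocityAt, ← e]
    exact h
  have h2 := h1.hasDerivAt (((contMDiffOn_baseCoord hπ x).contMDiffAt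
    ((isOpen_baseDomain hπ x).mem_nhds ht)).mdifferentiableAt (by simp))
  have h3 := hg.eq_of_dirD_baseCoord_eq hπ hXh (hV ▸ hγh) ht (hd.unique h2)
  rw [HasVelocityAt, h3]
  exact h1

variable {d k : ℕ} {G : Type} [TopologicalSpace G] [ChartedSpace (EuclideanSpace ℝ (Fin d)) G]
  [Group G] {F : Type v} [TopologicalSpace F] [ChartedSpace (EuclideanSpace ℝ (Fin k)) F]
  [MulAction G F] [IsManifold (𝓡 k) ∞ F] [LieGroup (𝓡 d) ∞ G] [ContMDiffSMul (𝓡 d) (𝓡 k) ∞ G F]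
  {W : Type*} [NormedAddCommGroup W] [NormedSpace ℝ W] {κ : F → W}
  (Φ : GBundleStructure ℋ (d := d) (k := k) G F) (hκ : ContMDiff (𝓡 k) 𝓘(ℝ, W) ∞ κ)
include hκ

/-- Through every point there is a horizontal geodesic along which a given vertical vector extends
to a field `ξ` with `(∇_X ξ)^v = S_X ξ`. The field `ξ` is the vertical gradient of a function which
is invariant under the parallel transport along the projected geodesic; so it stays dual to the same
form `c`. -/
theorem GBundleStructure.exists_parallel_field {p : M} {a ξ₀ : TangentSpace 𝓘(ℝ, E) p}
    (ha : a ∈ ℋ.hor p) (ha0 : a ≠ 0) (hξ₀ : ξ₀ ∈ vert E E' π p) {h₀ : G} {c : W →L[ℝ] ℝ}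
    (hdual : Φ.IsDual g κ (π p) p ξ₀ h₀ c) :
    ∃ (X ξ : VField E M) (γ : ℝ → M), SmoothField X ∧ SmoothField ξ ∧ ℋ.IsHorizontal X ∧
      (∀ q, ξ q ∈ vert E E' π q) ∧ γ 0 = p ∧ X p = a ∧ ξ p = ξ₀ ∧
      (∀ᶠ t in 𝓝 0, HasVelocityAt X γ t) ∧ (∀ᶠ t in 𝓝 0, g.nabla X X (γ t) = 0) ∧
      (∀ᶠ t in 𝓝 0, ℋ.verProj (γ t) (g.nabla X ξ (γ t)) = ℋ.shape g X ξ (γ t)) ∧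
      ∀ᶠ t in 𝓝 0, ∃ h : G, Φ.IsDual g κ (π (γ t)) (γ t) (ξ (γ t)) h c := by
  obtain ⟨i, hi⟩ : ∃ i, i = π p := ⟨_, rfl⟩
  rw [← hi] at hdual
  set χ := extChartAt 𝓘(ℝ, E') i with hχ
  set ψ : M → E' := baseCoord E' π i with hψdef
  have hpU : p ∈ baseDomain E' π i := hi ▸ mem_baseDomain
  have hU := isOpen_baseDomain hπ i
  have hψ := contMDiffOn_baseCoord hπ i
  have hiU : π p ∈ Φ.U i := hi ▸ Φ.mem_U i
  -- the geodesic of the base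
  have hT : IsOpen (χ.target ∩ χ.symm ⁻¹' Φ.U i) :=
    (continuousOn_extChartAt_symm i).isOpen_inter_preimage (isOpen_extChartAt_target i)
      (Φ.isOpen_U i)
  obtain ⟨A, -, hA⟩ := exists_smoothField_apply_eq a
  have hw0 : dirD A ψ p ≠ 0 := fun h => ha0 (by
    have h1 := (dirD_baseCoord_eq_zero_iff hπ hpU).1 h
    rw [hA] at h1
    rw [← HorizontalConnection.horProj_of_mem ha]
    exact ℋ.horProj_of_mem_vert h1)
  obtain ⟨x, hx, hxT, hx0, hx0', hgeo⟩ := exists_curve_geodesic_near_zero hT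
    ((b.contDiffOn_inChart_symm i).mono Set.inter_subset_left)
    (fun y hy u hu => b.inChart_pos (χ.map_target hy.1) hu) (y₀ := ψ p)
    ⟨χ.map_source hpU, by
      rw [Set.mem_preimage, hψdef, baseCoord, χ.left_inv hpU]; exact hiU⟩ (dirD A ψ p)
  obtain ⟨τ, N, hN, hxN, hτ, hτm, hτx⟩ := exists_leftInverse_curve hx (hx0' ▸ hw0)
  have hτ0 : τ (x 0) = 0 := hτx.self_of_nhds
  have hpN : ψ p ∈ N := hx0 ▸ hxN
  let w : E' → E' := fun y => deriv x (τ y)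
  have hw : ContDiffOn ℝ ∞ w N :=
    ((contDiff_infty_iff_deriv.1 hx).2).comp_contDiffOn hτ
  obtain ⟨X, hX, hXh, hXw⟩ := hg.exists_horizontal_lift hπ hpU hN hpN hw
  -- the horizontal lifts of the geodesic
  let γ₀ : ℝ → B := fun t => χ.symm (x t)
  have hγ₀ : ContMDiff 𝓘(ℝ, ℝ) 𝓘(ℝ, E') ∞ γ₀ := by
    rw [← contMDiffOn_univ]
    exact (contMDiffOn_extChartAt_symm i).comp hx.contMDiff.contMDiffOn fun t _ => (hxT t).1
  have hγ₀U : ∀ t, γ₀ t ∈ Φ.U i := fun t => (hxT t).2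
  have hχγ : ∀ t, χ (γ₀ t) = x t := fun t => χ.right_inv (hxT t).1
  obtain ⟨h, hh, hhor⟩ := Φ.transport i γ₀ (-1) 1 hγ₀ fun t _ => hγ₀U t
  let lift : F → ℝ → M := fun f t => Φ.triv i (γ₀ t) (h t • f)
  have hπl : ∀ f t, π (lift f t) = γ₀ t := fun f t => Φ.proj_triv i _ (hγ₀U t) _
  have hψl : ∀ f t, ψ (lift f t) = x t := fun f t => by
    rw [hψdef, baseCoord, hπl]; exact hχγ t
  have hlU : ∀ f t, lift f t ∈ baseDomain E' π i := fun f t => by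
    rw [baseDomain, Set.mem_preimage, hπl]; exact χ.map_target (hxT t).1
  have hls : ∀ f, ContMDiffOn 𝓘(ℝ, ℝ) 𝓘(ℝ, E) ∞ (lift f) (Set.Ioo (-1) 1) := fun f =>
    (Φ.smooth_triv i).comp (hγ₀.contMDiffOn.prodMk
      ((contMDiff_smul (I := 𝓡 d) (I' := 𝓡 k) (n := ∞) (G := G) (M := F)).comp_contMDiffOn
        (hh.prodMk contMDiffOn_const))) fun t _ => ⟨hγ₀U t, trivial⟩
  have hlv : ∀ f, ∀ t ∈ Set.Ioo (-1 : ℝ) 1, dirD X ψ (lift f t) = deriv x t →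
      HasVelocityAt X (lift f) t := fun f t ht hd =>
    hg.hasVelocityAt_of_horizontal hπ
      (((hls f).contMDiffAt (isOpen_Ioo.mem_nhds ht)).mdifferentiableAt (by simp))
      (hhor f t ht) (hXh _) (hlU f t) (by
        rw [← hψdef, hd]
        simp only [hψl]
        exact (hx.differentiable (by simp) t).hasDerivAt)
  let γ := lift ((h 0)⁻¹ • Φ.coord i p)
  have hγ0 : γ 0 = p := by
    have e : γ₀ 0 = π p := by
      simp only [γ₀, hx0]
      exact χ.left_inv hpU
    simp only [γ, lift, smul_inv_smul, e]
    exact Φ.triv_coord i p hiU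
  have hγc : Filter.Tendsto γ (𝓝 0) (𝓝 p) := by
    have := ((hls ((h 0)⁻¹ • Φ.coord i p)).contMDiffAt
      (Ioo_mem_nhds (by norm_num : (-1 : ℝ) < 0) one_pos)).continuousAt
    rwa [ContinuousAt, show lift ((h 0)⁻¹ • Φ.coord i p) 0 = p from hγ0] at this
  -- the function which is invariant under parallel transport, and its gradient
  let O : Set M := (baseDomain E' π i ∩ ψ ⁻¹' N) ∩ π ⁻¹' Φ.U i
  have hO : IsOpen O :=
    (isOpen_baseDomain_inter_preimage hπ i hN).inter (Φ.isOpen_preimage_U hπ i)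
  have hpO : p ∈ O := ⟨⟨hpU, hpN⟩, hiU⟩
  let θ : M → G := fun y => h₀ * h 0 * (h (τ (ψ y)))⁻¹
  have hθ : ContMDiffOn 𝓘(ℝ, E) (𝓡 d) ∞ θ O := by
    have h1 : ContMDiffOn 𝓘(ℝ, E) (𝓡 d) ∞ (fun y => h (τ (ψ y))) O :=
      hh.comp ((contMDiffOn_iff_contDiffOn.2 hτ).comp (hψ.mono fun y hy => hy.1.1)
        fun y hy => hy.1.2) fun y hy => hτm _ hy.1.2
    exact contMDiffOn_const.mul h1.inv
  let φ : M → ℝ := fun y => c (Φ.fiberMap κ i (θ y) y)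
  have hφ : ContMDiffOn 𝓘(ℝ, E) 𝓘(ℝ, ℝ) ∞ φ O :=
    c.contMDiff.comp_contMDiffOn ((Φ.contMDiffOn_fiberMap_prod hκ i).comp
      (hθ.prodMk contMDiffOn_id) fun y hy => ⟨trivial, hy.2⟩)
  obtain ⟨ξ, hξ, hξv, hξg⟩ := hg.exists_vertical_gradient hπ hO hpO hφ
  -- duality, at all points where `ξ` is the gradient
  have hdualq : ∀ q ∈ O, (∀ v ∈ vert E E' π q, g.inner q (ξ q) v = mvfderiv 𝓘(ℝ, E) φ q v) →
      Φ.IsDual g κ i q (ξ q) (θ q) c := by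
    intro q hq hgr v hv
    obtain ⟨V, -, rfl⟩ := exists_smoothField_apply_eq v
    rw [hgr _ hv]
    have h1 := Φ.mdifferentiableAt_fiberMap hπ hκ (θ q) hq.2
    refine Eq.trans ?_ (dirD_clm_comp (X := V) c h1)
    have h2 : MDifferentiableAt 𝓘(ℝ, E) 𝓘(ℝ, ℝ) (fun y => c (Φ.fiberMap κ i (θ q) y)) q :=
      c.contMDiff.mdifferentiableAt (n := ∞) (by simp) |>.comp q h1
    refine Φ.mvfderiv_eq_of_eq_on_fiber hπ hq.2
      ((hφ.contMDiffAt (hO.mem_nhds hq)).mdifferentiableAt (by simp)) h2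
      (Filter.Eventually.of_forall fun z hz => ?_) hv
    have : ψ z = ψ q := by rw [hψdef, baseCoord, baseCoord, hz]
    simp only [φ, θ, this]
  -- what holds near `p` and near the time `0`
  have hnear : ∀ᶠ t in 𝓝 (0 : ℝ), t ∈ Set.Ioo (-1 : ℝ) 1 ∧ γ t ∈ O ∧
      (∀ᶠ q in 𝓝 (γ t), dirD X ψ q = w (ψ q)) ∧
      (∀ᶠ q in 𝓝 (γ t), ∀ v ∈ vert E E' π q, g.inner q (ξ q) v = mvfderiv 𝓘(ℝ, E) φ q v) ∧
      ∀ᶠ s in 𝓝 t, τ (x s) = s := by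
    filter_upwards [Ioo_mem_nhds (by norm_num : (-1 : ℝ) < 0) one_pos, hγc (hO.mem_nhds hpO),
      hγc.eventually hXw.eventually_nhds, hγc.eventually hξg.eventually_nhds,
      hτx.eventually_nhds] with t h1 h2 h3 h4 h5
    exact ⟨h1, h2, h3, h4, h5⟩
  have hXγ : ∀ᶠ t in 𝓝 (0 : ℝ), dirD X ψ (γ t) = deriv x t := by
    filter_upwards [hnear] with t ⟨_, _, h3, _, h5⟩
    rw [h3.self_of_nhds, hψl]
    simp only [w, h5.self_of_nhds]
  have hvel : ∀ᶠ t in 𝓝 (0 : ℝ), HasVelocityAt X γ t := by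
    filter_upwards [hnear, hXγ] with t ⟨h1, _⟩ h2
    exact hlv _ t h1 h2
  refine ⟨X, ξ, γ, hX, hξ, hXh, hξv, hγ0, ?_, ?_, hvel, ?_, ?_, ?_⟩
  · have h1 := hXγ.self_of_nhds
    rw [hγ0, hx0'] at h1
    rw [← hA]
    exact hg.eq_of_dirD_baseCoord_eq hπ (hXh p) (hA ▸ ha) hpU h1
  · refine g.ext_inner_mem (hξv p) hξ₀ fun v hv => ?_
    have h1 := hdualq p hpO hξg.self_of_nhds v hv
    have h2 : θ p = h₀ := by
      simp only [θ, ← hx0, hτ0, mul_inv_cancel_right]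
    rw [h1, h2, hdual v hv]
  · filter_upwards [hvel, hXγ.eventually_nhds, hgeo, hnear] with t h1 h2 h3 h4
    refine hg.nabla_self_eq_zero hπ hX hXh (hlU _ t) fun u => ?_
    have hmd : MDifferentiableAt 𝓘(ℝ, E) 𝓘(ℝ, E') (dirD X ψ) (γ t) :=
      ((contMDiffOn_dirD hU hψ hX.contMDiffOn).contMDiffAt
        (hU.mem_nhds (hlU _ t))).mdifferentiableAt (by simp)
    have h5 := (h1.hasDerivAt hmd).deriv
    rw [Filter.EventuallyEq.deriv_eq h2] at h5
    have h6 := h3 u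
    rw [geodesicForm_apply, ← hψdef, ← h5]
    dsimp only
    rw [hψl, h2.self_of_nhds]
    rw [hπl]
    exact h6
  · filter_upwards [hnear, hXγ] with t ⟨h1, h2, h3, h4, h5⟩ h6
    have hψt : ψ (γ t) = x t := hψl _ t
    have hwd : DifferentiableAt ℝ w (ψ (γ t)) :=
      (hw.contDiffAt (hN.mem_nhds h2.1.2)).differentiableAt (by simp)
    refine hg.verProj_nabla_eq_shape hπ (w := w) hX hξ hXh hξv (hlU _ t) h3 hwd hO h2 hφ h4 fun v hv => ?_
    -- `X φ` vanishes on the fiber, as `φ` is constant along the horizontal lifts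
    have h7 : ∀ᶠ z in 𝓝 (γ t), π z = π (γ t) → dirD X φ z = (fun _ => 0) z := by
      filter_upwards [hO.mem_nhds h2, h3] with z hzO hzX hz
      have hzγ : π z = γ₀ t := hz.trans (hπl _ t)
      have hlz : lift ((h t)⁻¹ • Φ.coord i z) t = z := by
        simp only [lift, smul_inv_smul, ← hzγ]
        exact Φ.triv_coord i z hzO.2
      have hψz : ψ z = x t := by rw [← hlz, hψl]
      have h8 : HasVelocityAt X (lift ((h t)⁻¹ • Φ.coord i z)) t := by
        refine hlv _ t h1 ?_
        rw [hlz, hzX, hψz]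
        simp only [w, h5.self_of_nhds]
      have h9 := h8.hasDerivAt (f := φ) (by
        rw [hlz]
        exact (hφ.contMDiffAt (hO.mem_nhds hzO)).mdifferentiableAt (by simp))
      rw [hlz] at h9
      refine h9.unique ((hasDerivAt_const t (c (κ ((h₀ * h 0) • (h t)⁻¹ • Φ.coord i z)))).congr_of_eventuallyEq ?_)
      filter_upwards [h5] with s hs
      simp only [φ, θ, hψl, hs, GBundleStructure.fiberMap, lift, Φ.coord_triv i _ (hγ₀U s)]
      rw [mul_smul (h₀ * h 0), inv_smul_smul]
    rw [Φ.mvfderiv_eq_of_eq_on_fiber hπ h2.2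
      (((contMDiffOn_dirD hO hφ hX.contMDiffOn).contMDiffAt
        (hO.mem_nhds h2)).mdifferentiableAt (by simp)) mdifferentiableAt_const h7 hv]
    simp [mvfderiv_const]
  · filter_upwards [hnear] with t ⟨_, h2, _, h4, _⟩
    refine ⟨θ (γ t) * Φ.trans (π (γ t)) i (π (γ t)), fun v hv => ?_⟩
    rw [hdualq _ h2 h4.self_of_nhds v hv,
      Φ.mvfderiv_fiberMap_eq hπ hκ _ h2.2 (Φ.mem_U (π (γ t))) hv]

end Parallel

/-! ### Maximal degenerate vertical vectors -/

section Compactness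

open Filter HorizontalConnection

variable {E : Type u} [NormedAddCommGroup E] [NormedSpace ℝ E] [FiniteDimensional ℝ E]
  {M : Type v} [TopologicalSpace M] [T2Space M] [ChartedSpace E M] [IsManifold 𝓘(ℝ, E) ∞ M]
  {E' : Type w} [NormedAddCommGroup E'] [NormedSpace ℝ E'] [FiniteDimensional ℝ E']
  {B : Type x} [TopologicalSpace B] [ChartedSpace E' B] [IsManifold 𝓘(ℝ, E') ∞ B]
  {π : M → B} {ℋ : HorizontalConnection E E' π} {b : Metric E' B} {g : Metric E M}

theorem exists_tendsto_ultrafilter {T Y : Type*} [TopologicalSpace Y] {𝒰 : Ultrafilter T}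
    {f : T → Y} {K : Set Y} (hK : IsCompact K) (h : ∀ᶠ t in (𝒰 : Filter T), f t ∈ K) :
    ∃ y ∈ K, Tendsto f 𝒰 (𝓝 y) :=
  hK.ultrafilter_le_nhds (𝒰.map f) (le_principal_iff.2 h)

theorem Metric.inner_sum_of_orthonormal (g : Metric E M) {q : M} {n : ℕ}
    {e : Fin n → TangentSpace 𝓘(ℝ, E) q}
    (he : ∀ i j, g.inner q (e i) (e j) = if i = j then 1 else 0) (α : Fin n → ℝ) (j : Fin n) :
    g.inner q (∑ i, α i • e i) (e j) = α j := by
  simp [map_sum, he]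

theorem Metric.inner_self_of_orthonormal (g : Metric E M) {q : M} {n : ℕ}
    {e : Fin n → TangentSpace 𝓘(ℝ, E) q}
    (he : ∀ i j, g.inner q (e i) (e j) = if i = j then 1 else 0)
    {S : Submodule ℝ (TangentSpace 𝓘(ℝ, E) q)} (heS : ∀ i, e i ∈ S)
    (hS : Module.finrank ℝ S = n) {v : TangentSpace 𝓘(ℝ, E) q} (hv : v ∈ S) :
    g.inner q v v = ∑ i, g.inner q v (e i) ^ 2 := by
  conv_lhs => rw [g.eq_sum_of_orthonormal he heS hS hv]
  rw [← g.eq_sum_of_orthonormal he heS hS hv]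
  conv_lhs => arg 2; rw [g.eq_sum_of_orthonormal he heS hS hv]
  rw [map_sum]
  exact Finset.sum_congr rfl fun i _ => by rw [map_smul, smul_eq_mul, sq]

variable (hπ : Manifold.IsSubmersion 𝓘(ℝ, E) 𝓘(ℝ, E') ∞ π) (hg : ℋ.IsAdapted b g)
include hπ hg

/-- The equation `A^*_a ξ = 0` in terms of the coefficients of `a` and `ξ`. -/
theorem HorizontalConnection.IsAdapted.dualA_eq_zero_iff_of_orthonormal {q : M}
    {e : Fin (Module.finrank ℝ E') → TangentSpace 𝓘(ℝ, E) q} (heh : ∀ i, e i ∈ ℋ.hor q)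
    (he : ∀ i j, g.inner q (e i) (e j) = if i = j then 1 else 0) {m : ℕ}
    (v : Fin m → TangentSpace 𝓘(ℝ, E) q) (α : Fin (Module.finrank ℝ E') → ℝ) (ζ : Fin m → ℝ) :
    ℋ.dualA g q (∑ j, α j • e j) (∑ k, ζ k • v k) = 0 ↔
      ∀ l, ∑ j, ∑ k, α j * (ζ k * g.inner q (ℋ.tensorA q (e j) (e l)) (v k)) = 0 := by
  have ha : ∑ j, α j • e j ∈ ℋ.hor q :=
    Submodule.sum_mem _ fun j _ => Submodule.smul_mem _ _ (heh j)
  have key : ∀ l, g.inner q (ℋ.dualA g q (∑ j, α j • e j) (∑ k, ζ k • v k)) (e l)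
      = ∑ j, ∑ k, α j * (ζ k * g.inner q (ℋ.tensorA q (e j) (e l)) (v k)) := fun l => by
    let L : ℋ.hor q →ₗ[ℝ] TangentSpace 𝓘(ℝ, E) q :=
      { toFun := fun a => ℋ.tensorA q a (e l)
        map_add' := fun a c => hg.tensorA_add_left hπ (heh l) a.2 c.2
        map_smul' := fun r a => hg.tensorA_smul_left hπ r (heh l) a.2 }
    have hL : ℋ.tensorA q (∑ j, α j • e j) (e l) = ∑ j, α j • ℋ.tensorA q (e j) (e l) := by
      have h := map_sum L (fun j => α j • (⟨e j, heh j⟩ : ℋ.hor q)) Finset.univ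
      simp only [map_smul] at h
      refine Eq.trans ?_ h
      show _ = ℋ.tensorA q ((∑ j, α j • (⟨e j, heh j⟩ : ℋ.hor q) : ℋ.hor q) :
        TangentSpace 𝓘(ℝ, E) q) (e l)
      rw [Submodule.coe_sum]
      rfl
    rw [hg.inner_dualA hπ ha (heh l), hL, map_sum, Finset.sum_comm]
    refine Finset.sum_congr rfl fun k _ => ?_
    rw [map_smul, smul_eq_mul, map_sum, FunLike.coe_sum, Finset.sum_apply, Finset.mul_sum]
    refine Finset.sum_congr rfl fun j _ => ?_
    rw [map_smul, smul_apply, smul_eq_mul]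
    ring
  constructor
  · intro h l
    rw [← key, h]
    simp
  · intro h
    rw [g.eq_sum_of_orthonormal he heh (finrank_hor hπ q) (hg.dualA_mem hπ ha (∑ k, ζ k • v k))]
    simp [key, h]

variable {d k : ℕ} {G : Type} [TopologicalSpace G] [ChartedSpace (EuclideanSpace ℝ (Fin d)) G]
  [Group G] {F : Type v} [TopologicalSpace F] [ChartedSpace (EuclideanSpace ℝ (Fin k)) F]
  [MulAction G F]
  {W : Type*} [NormedAddCommGroup W] [NormedSpace ℝ W] {κ : F → W}

omit hπ hg in
/-- A vertical vector `ξ` is admissible if `A^*_a ξ = 0` for some horizontal `a ≠ 0` and if `ξ` is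
dual to the differential of `fiberMap κ i h`, composed with a linear form of norm at most `1`. -/
def GBundleStructure.Admissible (Φ : GBundleStructure ℋ (d := d) (k := k) G F) (g : Metric E M)
    (κ : F → W) (s : TangentBundle 𝓘(ℝ, E) M) : Prop :=
  s.snd ∈ vert E E' π s.proj ∧ (∃ a ∈ ℋ.hor s.proj, a ≠ 0 ∧ ℋ.dualA g s.proj a s.snd = 0) ∧
    ∃ (h : G) (c : W →L[ℝ] ℝ), ‖c‖ ≤ 1 ∧ Φ.IsDual g κ (π s.proj) s.proj s.snd h c

variable [IsManifold (𝓡 k) ∞ F] [LieGroup (𝓡 d) ∞ G] [ContMDiffSMul (𝓡 d) (𝓡 k) ∞ G F]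
  (Φ : GBundleStructure ℋ (d := d) (k := k) G F) (hκ : ContMDiff (𝓡 k) 𝓘(ℝ, W) ∞ κ)
include hκ

omit hg in
theorem GBundleStructure.continuousOn_mvfderiv_fiberMap {V : VField E M} (hV : SmoothField V)
    (i : B) :
    ContinuousOn (fun z : G × M => mvfderiv 𝓘(ℝ, E) (Φ.fiberMap κ i z.1) z.2 (V z.2))
      (Set.univ ×ˢ (π ⁻¹' Φ.U i)) := by
  have hO : IsOpen ((Set.univ : Set G) ×ˢ (π ⁻¹' Φ.U i)) :=
    isOpen_univ.prod (Φ.isOpen_preimage_U hπ i)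
  have hf := Φ.contMDiffOn_fiberMap_prod hκ i
  have h1 := hf.contMDiffOn_tangentMapWithin (m := ∞) (by simp) hO.uniqueMDiffOn
  have h0 : ContMDiff (𝓡 d) (𝓡 d).tangent ∞
      (fun h : G => (⟨h, 0⟩ : TangentBundle (𝓡 d) G)) :=
    Bundle.contMDiff_zeroSection ℝ (fun h : G => TangentSpace (𝓡 d) h)
  have h2 : ContMDiff ((𝓡 d).prod 𝓘(ℝ, E)) ((𝓡 d).prod 𝓘(ℝ, E)).tangent ∞ (fun z : G × M =>
      (⟨z, (0, V z.2)⟩ : TangentBundle ((𝓡 d).prod 𝓘(ℝ, E)) (G × M))) :=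
    contMDiff_equivTangentBundleProd_symm.comp
      ((h0.comp contMDiff_fst).prodMk (hV.comp contMDiff_snd))
  have h3 := h1.comp h2.contMDiffOn (s := Set.univ ×ˢ (π ⁻¹' Φ.U i)) (fun z hz => hz)
  intro z hz
  have h4 := h3 z hz
  rw [Bundle.contMDiffWithinAt_totalSpace] at h4
  refine (h4.2.congr_of_mem (fun y hy => ?_) hz).continuousWithinAt
  have hmd := (hf.contMDiffAt (hO.mem_nhds hy)).mdifferentiableAt (by simp)
  have h5 : mfderiv ((𝓡 d).prod 𝓘(ℝ, E)) 𝓘(ℝ, W) (fun z : G × M => Φ.fiberMap κ i z.1 z.2) y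
      ((0, V y.2) : EuclideanSpace ℝ (Fin d) × E)
      = mfderiv 𝓘(ℝ, E) 𝓘(ℝ, W) (Φ.fiberMap κ i y.1) y.2 (V y.2) := by
    refine (mfderiv_prod_eq_add_apply
      (v := ((0, V y.2) : EuclideanSpace ℝ (Fin d) × E)) hmd).trans ?_
    exact (congrArg (· + _) (map_zero _)).trans (zero_add _)
  simp only [Function.comp_apply, tangentMapWithin, mfderivWithin_of_isOpen hO hy]
  simp
  exact h5.symm

/-- If `M` and `G` are compact, then there is a longest admissible vector. -/
theorem GBundleStructure.exists_forall_admissible_le [CompactSpace M] [CompactSpace G]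
    [FiniteDimensional ℝ W] (hne : ∃ s, Φ.Admissible g κ s) :
    ∃ s, Φ.Admissible g κ s ∧ ∀ s', Φ.Admissible g κ s' →
      g.inner s'.proj s'.snd s'.snd ≤ g.inner s.proj s.snd s.snd := by
  have : Nonempty {s // Φ.Admissible g κ s} := nonempty_subtype.2 hne
  obtain ⟨s, hs⟩ := exists_forall_le_of_ultrafilter
    (fun s : {s // Φ.Admissible g κ s} => g.inner s.1.proj s.1.snd s.1.snd) (by
    intro 𝒰
    have hv := fun s : {s // Φ.Admissible g κ s} => s.2.1
    choose a hah ha0 hda using fun s : {s // Φ.Admissible g κ s} => s.2.2.1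
    choose h c hc hdual using fun s : {s // Φ.Admissible g κ s} => s.2.2.2
    obtain ⟨p, -, hp⟩ := exists_tendsto_ultrafilter (𝒰 := 𝒰) (f := fun s => s.1.proj)
      (isCompact_univ (X := M)) (by simp)
    obtain ⟨e, hes, heh, heon⟩ := ℋ.exists_horizontal_frame g hπ p
    obtain ⟨ν, hνs, hνv, hνon⟩ := hg.exists_vertical_frame hπ p
    let i := π p
    have hUi := (Φ.isOpen_preimage_U hπ i).mem_nhds (Φ.mem_U i : π p ∈ Φ.U i)
    have hnear : ∀ᶠ s : {s // Φ.Admissible g κ s} in 𝒰,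
        (∀ i j, g.inner s.1.proj (e i s.1.proj) (e j s.1.proj) = if i = j then 1 else 0) ∧
        (∀ i j, g.inner s.1.proj (ν i s.1.proj) (ν j s.1.proj) = if i = j then 1 else 0) ∧
        π s.1.proj ∈ Φ.U i := hp.eventually (heon.and (hνon.and hUi))
    -- the limits of the group elements, of the linear forms and of the horizontal directions
    let h' : {s // Φ.Admissible g κ s} → G := fun s =>
      h s * Φ.trans i (π s.1.proj) (π s.1.proj)
    obtain ⟨h₁, -, hh₁⟩ := exists_tendsto_ultrafilter (𝒰 := 𝒰) (f := h')
      (isCompact_univ (X := G)) (by simp)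
    obtain ⟨c₁, hc₁, hcc₁⟩ := exists_tendsto_ultrafilter (𝒰 := 𝒰) (f := c)
      (isCompact_closedBall (0 : W →L[ℝ] ℝ) 1) (Eventually.of_forall fun s => by simpa using hc s)
    let α : {s // Φ.Admissible g κ s} → Fin (Module.finrank ℝ E') → ℝ := fun s j =>
      (g.length s.1.proj (a s))⁻¹ * g.inner s.1.proj (a s) (e j s.1.proj)
    have hα1 : ∀ᶠ s in (𝒰 : Filter _), ∑ j, α s j ^ 2 = 1 := by
      filter_upwards [hnear] with s hs
      simp only [α, mul_pow, ← Finset.mul_sum]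
      rw [← g.inner_self_of_orthonormal hs.1 (fun j => heh j _) (finrank_hor hπ _) (hah s),
        Metric.length, inv_pow, Real.sq_sqrt (g.inner_self_nonneg _)]
      exact inv_mul_cancel₀ (g.pos _ _ (ha0 s)).ne'
    obtain ⟨α₁, -, hα₁⟩ := exists_tendsto_ultrafilter (𝒰 := 𝒰) (f := α)
      (isCompact_univ_pi fun _ => isCompact_Icc (a := (-1 : ℝ)) (b := 1)) (by
        filter_upwards [hα1] with s hs j _
        show α s j ∈ Set.Icc (-1 : ℝ) 1
        rw [Set.mem_Icc, ← abs_le, ← sq_le_one_iff_abs_le_one, ← hs]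
        exact Finset.single_le_sum (f := fun j => α s j ^ 2) (fun j _ => sq_nonneg _)
          (Finset.mem_univ j))
    have hα₁j : ∀ j, Tendsto (fun s => α s j) 𝒰 (𝓝 (α₁ j)) := tendsto_pi_nhds.1 hα₁
    have hα₁1 : ∑ j, α₁ j ^ 2 = 1 :=
      tendsto_nhds_unique (tendsto_finsetSum _ fun j _ => (hα₁j j).pow 2)
        (tendsto_const_nhds.congr' (hα1.mono fun s hs => hs.symm))
    -- the coefficients of the vertical vectors
    let D : Fin (Module.finrank ℝ E - Module.finrank ℝ E') → G × M → W := fun k z =>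
      mvfderiv 𝓘(ℝ, E) (Φ.fiberMap κ i z.1) z.2 (ν k z.2)
    have hD : ∀ k, Tendsto (fun s => c s (D k (h' s, s.1.proj))) 𝒰 (𝓝 (c₁ (D k (h₁, p)))) :=
      fun k => by
        have h1 : ContinuousAt (D k) (h₁, p) :=
          (Φ.continuousOn_mvfderiv_fiberMap hπ hκ (hνs k) i).continuousAt
            ((isOpen_univ.prod (Φ.isOpen_preimage_U hπ i)).mem_nhds ⟨trivial, Φ.mem_U i⟩)
        exact (isBoundedBilinearMap_apply.continuous.tendsto (c₁, D k (h₁, p))).comp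
          (hcc₁.prodMk_nhds (h1.tendsto.comp (hh₁.prodMk_nhds hp)))
    have hζ : ∀ k, ∀ᶠ s : {s // Φ.Admissible g κ s} in 𝒰, g.inner s.1.proj s.1.snd (ν k s.1.proj)
        = c s (D k (h' s, s.1.proj)) := fun k => by
      filter_upwards [hnear] with s hs
      rw [hdual s _ (hνv k _), Φ.mvfderiv_fiberMap_eq hπ hκ (h s) (Φ.mem_U _) hs.2.2 (hνv k _)]
    have hζt : ∀ k, Tendsto (fun s : {s // Φ.Admissible g κ s} =>
        g.inner s.1.proj s.1.snd (ν k s.1.proj)) 𝒰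
        (𝓝 (c₁ (D k (h₁, p)))) := fun k => (hD k).congr' ((hζ k).mono fun s hs => hs.symm)
    let ξ₁ : TangentSpace 𝓘(ℝ, E) p := ∑ k, c₁ (D k (h₁, p)) • ν k p
    have hξ₁v : ξ₁ ∈ vert E E' π p :=
      Submodule.sum_mem _ fun k _ => Submodule.smul_mem _ _ (hνv k p)
    have hξ₁ν : ∀ k, g.inner p ξ₁ (ν k p) = c₁ (D k (h₁, p)) :=
      g.inner_sum_of_orthonormal hνon.self_of_nhds _
    have hadm : Φ.Admissible g κ ⟨p, ξ₁⟩ := by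
      refine ⟨hξ₁v, ⟨∑ j, α₁ j • e j p,
        Submodule.sum_mem _ fun j _ => Submodule.smul_mem _ _ (heh j p), fun h0 => ?_, ?_⟩,
        h₁, c₁, by simpa using hc₁, fun v hv => ?_⟩
      · have h1 : ∀ j, α₁ j = 0 := fun j => by
          rw [← g.inner_sum_of_orthonormal heon.self_of_nhds α₁ j, h0]
          simp
        simp [h1] at hα₁1
      · refine (hg.dualA_eq_zero_iff_of_orthonormal hπ (fun j => heh j p) heon.self_of_nhds
          (fun k => ν k p) α₁ (fun k => c₁ (D k (h₁, p)))).2 fun l => ?_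
        have ht : ∀ j k, Tendsto (fun s : {s // Φ.Admissible g κ s} => g.inner s.1.proj
            (ℋ.tensorA s.1.proj (e j s.1.proj) (e l s.1.proj)) (ν k s.1.proj)) 𝒰
            (𝓝 (g.inner p (ℋ.tensorA p (e j p) (e l p)) (ν k p))) := fun j k =>
          ((g.contMDiff_pairing (hg.smoothField_tensorA hπ (hes j) (hes l) (heh j) (heh l))
            (hνs k)).continuous.tendsto p).comp hp
        refine tendsto_nhds_unique (tendsto_finsetSum _ fun j _ => tendsto_finsetSum _ fun k _ =>
          (hα₁j j).mul ((hζt k).mul (ht j k))) (tendsto_const_nhds.congr' ?_)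
        filter_upwards [hnear] with s hs
        refine (((hg.dualA_eq_zero_iff_of_orthonormal hπ (fun j => heh j _) hs.1
          (fun k => ν k s.1.proj) (α s) _).1 ?_) l).symm
        rw [← g.eq_sum_of_orthonormal hs.2.1 (fun k => hνv k _) (finrank_vert ℋ hπ _) (hv s)]
        have h1 : ∑ j, α s j • e j s.1.proj = (g.length s.1.proj (a s))⁻¹ • a s := by
          simp only [α, mul_smul, ← Finset.smul_sum]
          rw [← g.eq_sum_of_orthonormal hs.1 (fun j => heh j _) (finrank_hor hπ _) (hah s)]
        rw [h1, hg.dualA_smul_left hπ (hah s), hda, smul_zero]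
      · have hs := g.eq_sum_of_orthonormal hνon.self_of_nhds (fun k => hνv k p)
          (finrank_vert ℋ hπ p) hv
        have h1 : g.inner p ξ₁ v = ∑ k, g.inner p v (ν k p) * c₁ (D k (h₁, p)) := by
          conv_lhs => rw [hs, map_sum]
          exact Finset.sum_congr rfl fun k _ => by rw [map_smul, smul_eq_mul, hξ₁ν]
        have h2 : mvfderiv 𝓘(ℝ, E) (Φ.fiberMap κ i h₁) p v
            = ∑ k, g.inner p v (ν k p) • D k (h₁, p) := by
          conv_lhs => rw [hs, map_sum]
          exact Finset.sum_congr rfl fun k _ => by rw [map_smul]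
        show g.inner p ξ₁ v = c₁ (mvfderiv 𝓘(ℝ, E) (Φ.fiberMap κ i h₁) p v)
        rw [h1, h2, map_sum]
        exact Finset.sum_congr rfl fun k _ => by rw [map_smul, smul_eq_mul]
    refine ⟨⟨⟨p, ξ₁⟩, hadm⟩, ?_⟩
    have h1 : g.inner p ξ₁ ξ₁ = ∑ k, c₁ (D k (h₁, p)) ^ 2 := by
      rw [g.inner_self_of_orthonormal hνon.self_of_nhds (fun k => hνv k p) (finrank_vert ℋ hπ p)
        hξ₁v]
      simp only [hξ₁ν]
    show Tendsto _ _ (𝓝 (g.inner p ξ₁ ξ₁))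
    rw [h1]
    refine (tendsto_finsetSum _ fun k _ => (hζt k).pow 2).congr' ?_
    filter_upwards [hnear] with s hs
    exact (g.inner_self_of_orthonormal hs.2.1 (fun k => hνv k _) (finrank_vert ℋ hπ _) (hv s)).symm)
  exact ⟨s.1, s.2, fun s' hs' => hs ⟨s', hs'⟩⟩

end Compactness

/-! ### Fatness -/

section Fatness

open Filter HorizontalConnection

variable {E : Type u} [NormedAddCommGroup E] [NormedSpace ℝ E] [FiniteDimensional ℝ E]
  {M : Type v} [TopologicalSpace M] [T2Space M] [ChartedSpace E M] [IsManifold 𝓘(ℝ, E) ∞ M]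
  {E' : Type w} [NormedAddCommGroup E'] [NormedSpace ℝ E'] [FiniteDimensional ℝ E']
  {B : Type x} [TopologicalSpace B] [ChartedSpace E' B] [IsManifold 𝓘(ℝ, E') ∞ B]
  {π : M → B} {ℋ : HorizontalConnection E E' π} {b : Metric E' B} {g : Metric E M}
  (hπ : Manifold.IsSubmersion 𝓘(ℝ, E) 𝓘(ℝ, E') ∞ π) (hg : ℋ.IsAdapted b g)
  {d k : ℕ} {G : Type} [TopologicalSpace G] [ChartedSpace (EuclideanSpace ℝ (Fin d)) G]
  [Group G] {F : Type v} [TopologicalSpace F] [ChartedSpace (EuclideanSpace ℝ (Fin k)) F]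
  [MulAction G F] [IsManifold (𝓡 k) ∞ F] [LieGroup (𝓡 d) ∞ G] [ContMDiffSMul (𝓡 d) (𝓡 k) ∞ G F]
  {W : Type*} [NormedAddCommGroup W] [NormedSpace ℝ W] {κ : F → W}
  (Φ : GBundleStructure ℋ (d := d) (k := k) G F) (hκ : ContMDiff (𝓡 k) 𝓘(ℝ, W) ∞ κ)
include hπ hg hκ

/-- A multiple of a degenerate vertical vector is admissible. -/
theorem GBundleStructure.exists_admissible [FiniteDimensional ℝ W] {f : M → W}
    (hf : ContMDiff 𝓘(ℝ, E) 𝓘(ℝ, W) ∞ f)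
    (hinj : ∀ z, Function.Injective (mfderiv 𝓘(ℝ, E) 𝓘(ℝ, W) f z)) (i₀ : B)
    (hκf : κ = fun z => f (Φ.triv i₀ i₀ z)) {p : M} {a ξ : TangentSpace 𝓘(ℝ, E) p}
    (ha : a ∈ ℋ.hor p) (ha0 : a ≠ 0) (hξ : ξ ∈ vert E E' π p) (h : ℋ.dualA g p a ξ = 0) :
    ∃ r : ℝ, r ≠ 0 ∧ Φ.Admissible g κ ⟨p, r • ξ⟩ := by
  let L : vert E E' π p →ₗ[ℝ] W :=
    (mvfderiv 𝓘(ℝ, E) (Φ.fiberMap κ (π p) 1) p).toLinearMap ∘ₗ (vert E E' π p).subtype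
  have hL : LinearMap.ker L = ⊥ := by
    refine LinearMap.ker_eq_bot'.2 fun v hv => Subtype.ext ?_
    exact Φ.eq_zero_of_mvfderiv_fiberMap_eq_zero hπ hf hinj i₀ hκf 1 (Φ.mem_U _) v.2 hv
  obtain ⟨L', hL'⟩ := L.exists_leftInverse_of_injective hL
  let c : W →L[ℝ] ℝ := LinearMap.toContinuousLinearMap
    ((g.inner p ξ).toLinearMap ∘ₗ (vert E E' π p).subtype ∘ₗ L')
  have hc : ∀ v (hv : v ∈ vert E E' π p),
      c (mvfderiv 𝓘(ℝ, E) (Φ.fiberMap κ (π p) 1) p v) = g.inner p ξ v := fun v hv =>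
    congrArg (fun u : vert E E' π p => g.inner p ξ u) (LinearMap.congr_fun hL' ⟨v, hv⟩)
  have hr : 0 < (‖c‖ + 1)⁻¹ := by positivity
  refine ⟨(‖c‖ + 1)⁻¹, hr.ne', Submodule.smul_mem _ _ hξ, ⟨a, ha, ha0, ?_⟩, 1,
    (‖c‖ + 1)⁻¹ • c, ?_, fun v hv => ?_⟩
  · rw [hg.dualA_smul_right hπ ha, h, smul_zero]
  · rw [norm_smul, Real.norm_of_nonneg hr.le, inv_mul_le_one₀ (by positivity)]
    linarith
  · rw [smul_apply, hc v hv, map_smul, smul_apply]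

/-- In positive curvature, an admissible vector which is not zero is not the longest one: it
extends along a horizontal geodesic, and its length is not maximal there. -/
theorem GBundleStructure.exists_admissible_lt (hwnn : ℋ.IsWNN g) (hsec : g.PosSectional)
    {p : M} {ξ₀ : TangentSpace 𝓘(ℝ, E) p} (hs : Φ.Admissible g κ ⟨p, ξ₀⟩) (hs0 : ξ₀ ≠ 0) :
    ∃ s', Φ.Admissible g κ s' ∧ g.inner p ξ₀ ξ₀ < g.inner s'.proj s'.snd s'.snd := by
  obtain ⟨hξ₀, ⟨a, ha, ha0, had⟩, h₀, c, hc, hdual⟩ := hs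
  dsimp only at a hξ₀ ha ha0 had hdual
  obtain ⟨X, ξ, γ, hX, hξ, hXh, hξv, rfl, rfl, rfl, hvel, hXX, hS, hγ⟩ :=
    Φ.exists_parallel_field hπ hg hκ ha ha0 hξ₀ hdual
  have hd := hg.dualA_eq_zero_along hπ hwnn hX hξ hXh hξv hvel hXX hS had
  have hX0 : ∀ᶠ t in 𝓝 0, X (γ t) ≠ 0 := by
    have h1 : ContinuousAt (fun t => g.pairing X X (γ t)) 0 :=
      (g.contMDiff_pairing hX hX).continuous.continuousAt.comp hvel.self_of_nhds.continuousAt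
    filter_upwards [h1.eventually_const_lt (g.pos _ _ ha0)] with t ht h0
    simp [Metric.pairing, h0] at ht
  have hmax := hg.not_isLocalMax_pairing hπ hsec hX hξ hXh hξv hvel hXX.self_of_nhds hS had ha0 hs0
  by_contra! hcon
  refine hmax ?_
  filter_upwards [hd, hX0, hγ] with t h1 h2 ⟨h, h3⟩
  exact hcon ⟨γ t, ξ (γ t)⟩ ⟨hξv _, ⟨X (γ t), hXh _, h2, h1⟩, h, c, hc, h3⟩

omit hκ Φ [IsManifold (𝓡 k) ∞ F] [LieGroup (𝓡 d) ∞ G] [ContMDiffSMul (𝓡 d) (𝓡 k) ∞ G F] in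
theorem HorizontalConnection.IsAdapted.isFat [CompactSpace M] (hwnn : ℋ.IsWNN g)
    (hG : HasCompactStructureGroup ℋ) (hsec : g.PosSectional) : ℋ.IsFat := by
  obtain ⟨d, k, G, _, _, _, F, _, _, _, _, _, _, _, ⟨Φ⟩⟩ := hG
  obtain ⟨n, f, hf, -, hinj⟩ := exists_embedding_euclidean_of_compact (I := 𝓘(ℝ, E)) (M := M)
  refine hg.isFat_of_dualA_ne_zero hπ fun p a ha ha0 ξ hξ h => ?_
  by_contra hξ0
  let κ : F → EuclideanSpace ℝ (Fin n) := fun z => f (Φ.triv (π p) (π p) z)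
  have hκ : ContMDiff (𝓡 k) (𝓡 n) ∞ κ := by
    rw [← contMDiffOn_univ]
    exact hf.comp_contMDiffOn ((Φ.smooth_triv (π p)).comp
      (contMDiffOn_const.prodMk contMDiffOn_id) fun z _ => ⟨Φ.mem_U _, trivial⟩)
  obtain ⟨r, hr, hadm⟩ := Φ.exists_admissible hπ hg hκ hf hinj (π p) rfl ha ha0 hξ h
  obtain ⟨s, hs, hmax⟩ := Φ.exists_forall_admissible_le hπ hg hκ ⟨_, hadm⟩
  have hs0 : s.snd ≠ 0 := fun h0 => by
    have h1 := hmax _ hadm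
    rw [h0, map_zero] at h1
    exact (g.pos p _ (smul_ne_zero hr hξ0)).not_ge h1
  obtain ⟨s', hs', hlt⟩ := Φ.exists_admissible_lt hπ hg hκ hwnn hsec hs hs0
  exact (hmax s' hs').not_gt hlt

end Fatness

end SubmersionCurvature

end

theorem mainTheorem1
    {E : Type*} [NormedAddCommGroup E] [NormedSpace ℝ E] [FiniteDimensional ℝ E]
    {E' : Type*} [NormedAddCommGroup E'] [NormedSpace ℝ E'] [FiniteDimensional ℝ E']
    {M : Type*} [TopologicalSpace M] [T2Space M] [ChartedSpace E M] [IsManifold 𝓘(ℝ, E) ∞ M]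
    {B : Type*} [TopologicalSpace B] [T2Space B] [ChartedSpace E' B] [IsManifold 𝓘(ℝ, E') ∞ B]
    (π : M → B) (hπ : Manifold.IsSubmersion 𝓘(ℝ, E) 𝓘(ℝ, E') ∞ π)
    (ℋ : SubmersionCurvature.HorizontalConnection E E' π)
    (b : SubmersionCurvature.Metric E' B) (g : SubmersionCurvature.Metric E M)
    (hg : ℋ.IsAdapted b g) :
    (ℋ.IsWNN g ↔ ∀ g' : SubmersionCurvature.Metric E M, ℋ.IsAdapted b g' → ℋ.IsWNN g') ∧
    (g.NonnegSectional → SubmersionCurvature.TotallyGeodesicFibers E' π g → ℋ.IsWNN g) ∧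
    (CompactSpace M → ℋ.IsWNN g → SubmersionCurvature.HasCompactStructureGroup ℋ →
      g.PosSectional → ℋ.IsFat) := by
  refine ⟨⟨fun h g' hg' => hg.isWNN_of_isWNN hπ hg' h, fun h => h g hg⟩,
    fun h1 h2 => hg.isWNN_of_nonnegSectional hπ h2 h1, fun hM h1 h2 h3 => ?_⟩
  exact hg.isFat hπ h1 h2 h3
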